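/- Let $d\ge 1$, $\omega>0$ and masses $m_1,\dots,m_d\ge 0$ be given, and let $m=(m_1,\dots,m_d)\neq 0$. Consider real fields $\varphi_n(x,t),\pi_n(x,t)$, $x\in\mathbb R^3$, $n=1,\dots,d$, coupled to a particle $q(t),p(t)\in\mathbb R^3$ by $$\dot\varphi_n=\pi_n,\quad \dot\pi_n=(\Delta-m_n^2)\varphi_n-q\cdot\nabla\rho_n,\quad \dot q=p,\quad \dot p=-\omega^2q-\sum_{n=1}^d\int_{\mathbb R^3}\varphi_n\nabla\rho_n\,dx,\qquad t\in\mathbb R .$$ Put $\hat\rho_n(k)=\int e^{ik\cdot x}\rho_n(x)\,dx$ and $m_*=\min_n m_n$, and assume: **A1.** The $3\times3$ matrix $(\omega^2-m_*^2)I-K$ is positive definite, where $K_{ij}=\sum_{n=1}^d(2\pi)^{-3}\int_{\mathbb R^3}\frac{k_ik_j|\hat\rho_n(k)|^2}{k^2+m_n^2-m_*^2}\,dk$. **A2.** The functions $\rho_1,\dots,\rho_d$ are real-valued, smooth and even, and vanish outside some ball. **A3.** $\hat\rho_n(k)\ne0$ for all $n$ and all $k\in\mathbb R^3\setminus\{0\}$.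 Let $E=H^1(\mathbb R^3;\mathbb R^d)\oplus L^2(\mathbb R^3;\mathbb R^d)\oplus\mathbb R^3\oplus\mathbb R^3$ be the space of states $Y=(\varphi,\pi,q,p)$, with $\|Y\|^2=\sum_n(\|\varphi_n\|_{L^2}^2+\|\nabla\varphi_n\|_{L^2}^2+\|\pi_n\|_{L^2}^2)+|q|^2+|p|^2$. Then for every $R_1>0$ there is a constant $C>0$, depending only on $m,\omega,\rho,R_1$, such that the following holds. Let $Y_0\in E$ have fields that vanish almost everywhere in $|x|>R_1$, and let $Y=(\varphi,\pi,q,p)\in C(\mathbb R,E)$ be a solution of the system with $Y(0)=Y_0$, where the field equations hold in the sense of distributions in $x$. Then $q(t)$ and $p(t)$ are continuous, and $$|q(t)|+|p(t)|\le C(1+t)^{-3/2}\,\|Y_0\|,\qquad t\ge0 .$$ -/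

import Mathlib

open MeasureTheory

namespace KGParticle

/-- Euclidean three-space. -/
abbrev E3 : Type := EuclideanSpace ℝ (Fin 3)

/-- The real space `L²(ℝ³)`. -/
abbrev L2 : Type := Lp ℝ 2 (volume : Measure E3)

/-- The space `L²(ℝ³; ℝ³)` of square integrable vector fields. -/
abbrev L2vec : Type := Lp E3 2 (volume : Measure E3)

/-- The test functions: smooth real functions on `ℝ³` with compact support. -/
def IsTest (χ : E3 → ℝ) : Prop :=
  ContDiff ℝ (⊤ : ℕ∞) χ ∧ HasCompactSupport χ

/-- `g` is the weak (distributional) gradient of `u`. -/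
def IsWeakGradient (u : L2) (g : L2vec) : Prop :=
  ∀ χ : E3 → ℝ, IsTest χ →
    ∫ x, (u x) • gradient χ x = -∫ x, χ x • g x

/-- The Sobolev space `H¹(ℝ³)`: a function `u ∈ L²` together with its weak gradient `∇u ∈ L²`
(which is determined by `u`). As a subset of `L² × L²` it carries the `H¹` topology. -/
def H1 : Set (L2 × L2vec) :=
  {w | IsWeakGradient w.1 w.2}

/-- The space of states of finite energy
`(φ, π, q, p) ∈ H¹(ℝ³; ℝᵈ) ⊕ L²(ℝ³; ℝᵈ) ⊕ ℝ³ ⊕ ℝ³`, with the product topology. -/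
abbrev PhaseSpace (d : ℕ) : Type := (Fin d → H1) × (Fin d → L2) × E3 × E3

/-- The field component `φ_n`. -/
def fieldPos {d : ℕ} (Y : PhaseSpace d) (n : Fin d) : L2 := (Y.1 n).1.1

/-- The gradient `∇φ_n` of the field component `φ_n`. -/
def fieldGrad {d : ℕ} (Y : PhaseSpace d) (n : Fin d) : L2vec := (Y.1 n).1.2

/-- The field momentum component `π_n`. -/
def fieldMom {d : ℕ} (Y : PhaseSpace d) (n : Fin d) : L2 := Y.2.1 n

/-- The position `q` of the particle. -/
def pos {d : ℕ} (Y : PhaseSpace d) : E3 := Y.2.2.1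

/-- The momentum `p` of the particle. -/
def mom {d : ℕ} (Y : PhaseSpace d) : E3 := Y.2.2.2

/-- The norm of a state:
`‖Y‖² = ∑ₙ (‖φ_n‖² + ‖∇φ_n‖² + ‖π_n‖²) + |q|² + |p|²`, with `L²` norms of the fields. -/
noncomputable def stateNorm {d : ℕ} (Y : PhaseSpace d) : ℝ :=
  Real.sqrt (∑ n, (‖fieldPos Y n‖ ^ 2 + ‖fieldGrad Y n‖ ^ 2 + ‖fieldMom Y n‖ ^ 2)
    + ‖pos Y‖ ^ 2 + ‖mom Y‖ ^ 2)

/-- The initial fields `φ` and `π` vanish for `|x| > R`. -/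
def FieldsVanishOutside {d : ℕ} (Y : PhaseSpace d) (R : ℝ) : Prop :=
  ∀ n, (∀ᵐ x : E3, R < ‖x‖ → fieldPos Y n x = 0) ∧
    (∀ᵐ x : E3, R < ‖x‖ → fieldMom Y n x = 0)

/-- `Y` is a solution, continuous in time with values in the space of states of finite energy, of
`φ̇_n = π_n`, `π̇_n = (Δ - m_n²) φ_n - q · ∇ρ_n`,
`q̇ = p`, `ṗ = -ω² q - ∑ₙ ∫ φ_n ∇ρ_n dx`.
The field equations are understood in the sense of distributions in `x`. -/
structure IsSolution {d : ℕ} (m : Fin d → ℝ) (ω : ℝ) (ρ : Fin d → E3 → ℝ)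
    (Y : ℝ → PhaseSpace d) : Prop where
  continuous : Continuous Y
  field_pos : ∀ (n : Fin d) (χ : E3 → ℝ), IsTest χ → ∀ t : ℝ,
    HasDerivAt (fun s => ∫ x, fieldPos (Y s) n x * χ x) (∫ x, fieldMom (Y t) n x * χ x) t
  field_mom : ∀ (n : Fin d) (χ : E3 → ℝ), IsTest χ → ∀ t : ℝ,
    HasDerivAt (fun s => ∫ x, fieldMom (Y s) n x * χ x)
      ((∫ x, fieldPos (Y t) n x * (Laplacian.laplacian χ x - m n ^ 2 * χ x))
        - ∫ x, inner ℝ (pos (Y t)) (gradient (ρ n) x) * χ x) t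
  particle_pos : ∀ t : ℝ, HasDerivAt (fun s => pos (Y s)) (mom (Y t)) t
  particle_mom : ∀ t : ℝ, HasDerivAt (fun s => mom (Y s))
    (-(ω ^ 2 • pos (Y t)) - ∑ n, ∫ x, (fieldPos (Y t) n x) • gradient (ρ n) x) t

/-- The Fourier transform `ρ̂(k) = ∫ exp(i k·x) ρ(x) dx`. -/
noncomputable def rhoHat (f : E3 → ℝ) (k : E3) : ℂ :=
  ∫ x, Complex.exp (Complex.I * ((inner ℝ k x : ℝ) : ℂ)) * ((f x : ℝ) : ℂ)

/-- The number `m_*`, the least of the masses. If all the masses vanish it is `0`, and if none of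
them vanishes it is the least nonzero mass. If some masses vanish and some do not, it is `0`, so
that the integrals below converge in all cases. -/
noncomputable def mStar {d : ℕ} (m : Fin d → ℝ) : ℝ := ⨅ n, m n

/-- The matrix
`K_ij = ∑ₙ (2π)⁻³ ∫ k_i k_j |ρ̂_n(k)|² / (k² + m_n² - m_*²) dk`. -/
noncomputable def couplingMatrix {d : ℕ} (m : Fin d → ℝ) (ρ : Fin d → E3 → ℝ) :
    Matrix (Fin 3) (Fin 3) ℝ :=
  Matrix.of fun i j => ∑ n, (1 / (2 * Real.pi) ^ 3) *
    ∫ k : E3, k i * k j * ‖rhoHat (ρ n) k‖ ^ 2 / (‖k‖ ^ 2 + m n ^ 2 - mStar m ^ 2)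

/-- Condition A1: the matrix `(ω² - m_*²) I - K` is positive definite. -/
def ConditionA1 {d : ℕ} (m : Fin d → ℝ) (ω : ℝ) (ρ : Fin d → E3 → ℝ) : Prop :=
  ((ω ^ 2 - mStar m ^ 2) • (1 : Matrix (Fin 3) (Fin 3) ℝ) - couplingMatrix m ρ).PosDef

/-- Condition A2: `ρ` is smooth, even, and vanishes outside a ball. -/
def ConditionA2 {d : ℕ} (ρ : Fin d → E3 → ℝ) : Prop :=
  (∀ n, ContDiff ℝ (⊤ : ℕ∞) (ρ n)) ∧ (∀ n x, ρ n (-x) = ρ n x) ∧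
    ∃ R : ℝ, ∀ n (x : E3), R ≤ ‖x‖ → ρ n x = 0

/-- Condition A3: `ρ̂_n(k) ≠ 0` for all `n` and all `k ≠ 0`. -/
def ConditionA3 {d : ℕ} (ρ : Fin d → E3 → ℝ) : Prop :=
  ∀ n (k : E3), k ≠ 0 → rhoHat (ρ n) k ≠ 0

end KGParticle

/-! Solving the field equations by Duhamel's formula and inserting the result into the force leaves
a closed Volterra equation for the particle, q'' + ω² q = D * q + g (`IsSolution.solvesVolterra`).
Here g is the force of the free Klein–Gordon fields launched by the initial data, and D is the
memory kernel D_ij(t) = ∑ₙ 4π² ∫ k_i k_j |ρ̂ₙ(k)|² sin(tλₙ)/λₙ dk with λₙ = √((2π|k|)² + mₙ²), where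
ρ̂ₙ is taken with Mathlib's exponential exp(-2πi k·x).

Decay of D and g. Both are integrals over rays with phase t√(r² + m²). The volume factor r² allows
one integration by parts without boundary term, and van der Corput's estimate yields another
t^(-1/2); hence g = O(t^(-3/2)) for data supported in a fixed ball (`exists_norm_freeForce_le`). The
double zero k_i k_j of the memory integrand allows one more integration by parts, so D = O(t^(-5/2))
(`exists_norm_memoryKernel_le`). These estimates include m = 0.

Invertibility. For zero data the Laplace transform turns the equation into S(z) q̂ = ĝ with S(z) =
z² + ω² - D̂(z). The central point is that S(z) is invertible for Re z ≥ 0 (`dispersion_ne_zero`,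
`exists_admissibleKernel`). For z = σ + iμ with σ > 0 one has ⟨v, S(z)v⟩ = (z² + ω²)|v|² - ∑ₙ ∫
wₙ/(λₙ² + z²) with weights wₙ ≥ 0. If μ² ≤ m_*², the real part is bounded below by the positive gap
in A1. If μ² > m_*², the imaginary part is 2σμ times a sum of positive terms. It stays away from 0
as σ → 0, because the integral concentrates on the resonant sphere λ = |μ| and grows like 1/σ; A3
makes the weight positive on part of that sphere.

Decay of q and p. Since t D(t) = O(t^(-3/2)), the function S⁻¹ on the imaginary axis has a
Hölder-1/2 derivative, and it decays quadratically. Its Fourier transform is therefore O(t^(-3/2))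
(`exists_norm_greenKernel_le`). After moving the inversion contour to the imaginary axis, q is a
convolution of two functions of order t^(-3/2), and this class is stable under convolution. General
initial data are reduced to zero data by subtracting an explicit decaying function, and p is
recovered from q and the bound on p' (`AdmissibleKernel.exists_decay`). -/

namespace KGParticle
open Set Filter Topology

/-! ### The decay weight and its stability under convolution. -/

/-- The decay weight `(1 + |t|)^(-3/2)`. -/
noncomputable def wt (t : ℝ) : ℝ := (1 + |t|) ^ (-(3 / 2) : ℝ)

lemma wt_pos (t : ℝ) : 0 < wt t := Real.rpow_pos_of_pos (by positivity) _

lemma wt_nonneg (t : ℝ) : 0 ≤ wt t := (wt_pos t).le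

lemma wt_neg (t : ℝ) : wt (-t) = wt t := by simp [wt]

lemma wt_le_one (t : ℝ) : wt t ≤ 1 :=
  Real.rpow_le_one_of_one_le_of_nonpos (by simp) (by norm_num)

lemma wt_anti {s t : ℝ} (h : |s| ≤ |t|) : wt t ≤ wt s :=
  Real.rpow_le_rpow_of_nonpos (by positivity) (by linarith) (by norm_num)

lemma continuous_wt : Continuous wt := by
  unfold wt
  refine Continuous.rpow_const (by fun_prop) fun x => Or.inl ?_
  positivity

lemma integrable_wt : Integrable wt := by
  have := integrable_one_add_norm (E := ℝ) (μ := volume) (r := 3 / 2) (by simp; norm_num)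
  change Integrable fun x : ℝ => (1 + |x|) ^ (-(3 / 2) : ℝ)
  simpa using this

/-- Halving the argument costs at most 2^(3/2), which is below 3. -/
lemma wt_half_le {s t : ℝ} (h : |t| ≤ 2 * |s|) : wt s ≤ 3 * wt t := by
  have h1 : (1 + |t|) / 2 ≤ 1 + |s| := by linarith
  have h2 : wt s ≤ ((1 + |t|) / 2) ^ (-(3 / 2) : ℝ) :=
    Real.rpow_le_rpow_of_nonpos (by positivity) h1 (by norm_num)
  rw [Real.div_rpow (by positivity) (by norm_num)] at h2
  have h3 : (1 / 3 : ℝ) ≤ (2 : ℝ) ^ (-(3 / 2) : ℝ) := by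
    rw [Real.rpow_neg (by norm_num), show (3 / 2 : ℝ) = 1 + 1 / 2 by norm_num,
      Real.rpow_add (by norm_num), ← Real.sqrt_eq_rpow, Real.rpow_one, one_div]
    apply inv_anti₀ (by positivity)
    nlinarith [Real.sq_sqrt (show (0 : ℝ) ≤ 2 by norm_num), Real.sqrt_nonneg 2]
  refine h2.trans ?_
  rw [div_le_iff₀ (by positivity)]
  have := wt_pos t
  change wt t ≤ _
  nlinarith

/-- One of |s| and |t - s| is at least |t|/2, so one of the two factors is already of the size of
`wt t`; the other is kept and is integrable in s. -/
lemma wt_mul_le (t s : ℝ) : wt (t - s) * wt s ≤ 3 * wt t * (wt (t - s) + wt s) := by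
  have h : |t| ≤ |t - s| + |s| := by simpa using abs_add_le (t - s) s
  have h1 := wt_nonneg (t - s)
  have h2 := wt_nonneg s
  have h3 := wt_nonneg t
  rcases le_total |s| |t - s| with h' | h'
  · have := wt_half_le (s := t - s) (t := t) (by linarith)
    nlinarith [mul_nonneg h3 h1]
  · have := wt_half_le (s := s) (t := t) (by linarith)
    nlinarith [mul_nonneg h3 h2]

lemma integrable_wt_sub (t : ℝ) : Integrable fun s => wt (t - s) :=
  integrable_wt.comp_sub_left t

lemma integrable_wt_mul (t : ℝ) : Integrable fun s => wt (t - s) * wt s := by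
  refine (integrable_wt).mono' ?_ (ae_of_all _ fun s => ?_)
  · exact ((continuous_wt.comp (by fun_prop)).mul continuous_wt).aestronglyMeasurable
  · rw [Real.norm_of_nonneg (mul_nonneg (wt_nonneg _) (wt_nonneg _))]
    exact mul_le_of_le_one_left (wt_nonneg _) (wt_le_one _)

lemma wt_integral_pos : 0 < ∫ s, wt s := by
  rw [integral_pos_iff_support_of_nonneg wt_nonneg integrable_wt]
  have : Function.support wt = univ := by
    ext x; simp [(wt_pos x).ne']
  simp [this]

/-- The weight is stable under convolution. -/
lemma integral_wt_mul_le (t : ℝ) :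
    ∫ s, wt (t - s) * wt s ≤ (6 * ∫ s, wt s) * wt t := by
  calc ∫ s, wt (t - s) * wt s ≤ ∫ s, 3 * wt t * (wt (t - s) + wt s) := by
        refine integral_mono (integrable_wt_mul t) ?_ fun s' => wt_mul_le t s'
        exact ((integrable_wt_sub t).add integrable_wt).const_mul _
    _ = (6 * ∫ s, wt s) * wt t := by
        rw [integral_const_mul, integral_add (integrable_wt_sub t) integrable_wt,
          integral_sub_left_eq_self wt]
        ring

lemma setIntegral_wt_mul_le {S : Set ℝ} (t : ℝ) :
    ∫ s in S, wt (t - s) * wt s ≤ (6 * ∫ s, wt s) * wt t :=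
  (setIntegral_le_integral (integrable_wt_mul t)
    (ae_of_all _ fun _ => mul_nonneg (wt_nonneg _) (wt_nonneg _))).trans (integral_wt_mul_le t)

/-! ### Laplace transform -/

section Laplace

variable {X : Type*} [NormedAddCommGroup X] [NormedSpace ℂ X]

/-- The Laplace transform `∫₀^∞ exp (-λ t) h t dt`. -/
noncomputable def laplace (h : ℝ → X) (z : ℂ) : X :=
  ∫ t in Ioi (0 : ℝ), Complex.exp (-z * t) • h t

lemma norm_cexp_neg_mul (z : ℂ) (t : ℝ) : ‖Complex.exp (-z * t)‖ = Real.exp (-z.re * t) := by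
  rw [Complex.norm_exp]; simp

lemma norm_cexp_le_one {z : ℂ} (hz : 0 ≤ z.re) {t : ℝ} (ht : 0 ≤ t) :
    ‖Complex.exp (-z * t)‖ ≤ 1 := by
  rw [norm_cexp_neg_mul, Real.exp_le_one_iff]; nlinarith

lemma integrableOn_laplace {h : ℝ → X} (hh : IntegrableOn h (Ioi 0)) {z : ℂ} (hz : 0 ≤ z.re) :
    IntegrableOn (fun t : ℝ => Complex.exp (-z * t) • h t) (Ioi 0) := by
  refine Integrable.mono hh ?_ ?_
  · exact (Continuous.aestronglyMeasurable (by fun_prop)).smul hh.aestronglyMeasurable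
  · filter_upwards [ae_restrict_mem measurableSet_Ioi] with t ht
    rw [norm_smul]
    exact mul_le_of_le_one_left (norm_nonneg _) (norm_cexp_le_one hz (le_of_lt ht))

lemma norm_laplace_le {h : ℝ → X} (hh : IntegrableOn h (Ioi 0)) {z : ℂ} (hz : 0 ≤ z.re) :
    ‖laplace h z‖ ≤ ∫ t in Ioi (0 : ℝ), ‖h t‖ := by
  refine norm_integral_le_of_norm_le hh.norm ?_
  filter_upwards [ae_restrict_mem measurableSet_Ioi] with t ht
  rw [norm_smul]
  exact mul_le_of_le_one_left (norm_nonneg _) (norm_cexp_le_one hz (le_of_lt ht))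

lemma continuousOn_laplace {h : ℝ → X} (hh : IntegrableOn h (Ioi 0)) :
    ContinuousOn (laplace h) {z | 0 ≤ z.re} := by
  refine continuousOn_of_dominated (bound := fun t => ‖h t‖) ?_ ?_ hh.norm ?_
  · exact fun z hz => (integrableOn_laplace hh hz).aestronglyMeasurable
  · intro z hz
    filter_upwards [ae_restrict_mem measurableSet_Ioi] with t ht
    rw [norm_smul]
    exact mul_le_of_le_one_left (norm_nonneg _) (norm_cexp_le_one hz (le_of_lt ht))
  · refine ae_of_all _ fun t => ?_
    fun_prop

/-- In the open half-plane no moment of `h` is needed: on Re w > Re z / 2 the factor t exp(-t Re w)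
is at most 2 / Re z. -/
lemma differentiableAt_laplace [CompleteSpace X] {h : ℝ → X} (hh : IntegrableOn h (Ioi 0)) {z : ℂ}
    (hz : 0 < z.re) : DifferentiableAt ℂ (laplace h) z := by
  have key := hasDerivAt_integral_of_dominated_loc_of_deriv_le (𝕜 := ℂ)
    (μ := volume.restrict (Ioi (0 : ℝ)))
    (F := fun (w : ℂ) (t : ℝ) => Complex.exp (-w * t) • h t)
    (F' := fun (w : ℂ) (t : ℝ) => (Complex.exp (-w * t) * (-t)) • h t)
    (x₀ := z) (s := {w | z.re / 2 < w.re}) (bound := fun t => (2 / z.re) * ‖h t‖)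
    ((isOpen_lt continuous_const Complex.continuous_re).mem_nhds
      (by simp; linarith)) ?_ (integrableOn_laplace hh hz.le) ?_ ?_ (hh.norm.const_mul _) ?_
  · exact key.2.differentiableAt
  · have h1 : ∀ᶠ w : ℂ in 𝓝 z, 0 < w.re :=
      (isOpen_lt continuous_const Complex.continuous_re).mem_nhds hz
    filter_upwards [h1] with w hw
    exact (integrableOn_laplace hh (le_of_lt hw)).aestronglyMeasurable
  · exact (Continuous.aestronglyMeasurable (by fun_prop)).smul hh.aestronglyMeasurable
  · filter_upwards [ae_restrict_mem measurableSet_Ioi] with t ht w hw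
    have ht : 0 < t := ht
    have hw : z.re / 2 < w.re := hw
    rw [norm_smul, norm_mul, norm_cexp_neg_mul]
    refine mul_le_mul_of_nonneg_right ?_ (norm_nonneg _)
    rw [norm_neg, Complex.norm_real, Real.norm_of_nonneg ht.le, neg_mul, Real.exp_neg,
      inv_mul_le_iff₀ (Real.exp_pos _)]
    have h2 := Real.add_one_le_exp (w.re * t)
    have h3 : z.re / 2 * t ≤ w.re * t := by gcongr
    have : t = (z.re / 2 * t) * (2 / z.re) := by field_simp
    calc t = (z.re / 2 * t) * (2 / z.re) := this
      _ ≤ _ := by gcongr; linarith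
  · refine ae_of_all _ fun t w _ => ?_
    refine HasDerivAt.smul_const ?_ _
    have : HasDerivAt (fun w : ℂ => -w * (t : ℂ)) (-t) w := by
      simpa using (hasDerivAt_id w).neg.mul_const (t : ℂ)
    exact this.cexp

/-- On the boundary there is no exponential damping, so the first moment of `h` must be integrable,
and the derivative is taken along the axis only. -/
lemma hasDerivAt_laplace_imag [CompleteSpace X] {h : ℝ → X} (hh : IntegrableOn h (Ioi 0))
    (hh' : IntegrableOn (fun t => t • h t) (Ioi 0)) (μ : ℝ) :
    HasDerivAt (fun μ : ℝ => laplace h (Complex.I * μ))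
      (laplace (fun t => (-Complex.I) • t • h t) (Complex.I * μ)) μ := by
  have hre : ∀ μ : ℝ, 0 ≤ (Complex.I * (μ : ℂ)).re := fun μ => by simp
  have h1' : IntegrableOn (fun t => (-Complex.I) • t • h t) (Ioi 0) := hh'.smul (-Complex.I)
  refine (hasDerivAt_integral_of_dominated_loc_of_deriv_le (𝕜 := ℝ)
    (μ := volume.restrict (Ioi (0 : ℝ)))
    (F := fun (w : ℝ) (t : ℝ) => Complex.exp (-(Complex.I * w) * t) • h t)
    (F' := fun (w : ℝ) (t : ℝ) => Complex.exp (-(Complex.I * w) * t) • (-Complex.I) • t • h t)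
    (x₀ := μ) (s := univ) (bound := fun t => ‖t • h t‖) univ_mem ?_
    (integrableOn_laplace hh (hre μ)) (integrableOn_laplace h1' (hre μ)).aestronglyMeasurable ?_
    hh'.norm ?_).2
  · exact Eventually.of_forall fun w => (integrableOn_laplace hh (hre w)).aestronglyMeasurable
  · filter_upwards [ae_restrict_mem measurableSet_Ioi] with t ht w hw
    rw [norm_smul]
    refine (mul_le_of_le_one_left (norm_nonneg _) (norm_cexp_le_one (hre w) (le_of_lt ht))).trans ?_
    rw [norm_smul]; simp
  · refine ae_of_all _ fun t w _ => ?_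
    have h2 : HasDerivAt (fun w : ℝ => -(Complex.I * (w : ℂ)) * (t : ℂ)) (-Complex.I * t) w := by
      have := ((Complex.ofRealCLM.hasDerivAt (x := w)).const_mul Complex.I).neg.mul_const (t : ℂ)
      simpa using this
    have h3 := h2.cexp.smul_const (h t)
    convert h3 using 1
    rw [mul_smul, mul_smul]
    rfl

end Laplace

/-! ### The symbol of the Volterra equation and its inverse. -/

section Resolvent

variable {V : Type*} [NormedAddCommGroup V] [NormedSpace ℂ V]

/-- The symbol `λ² + ω² - ∫₀^∞ exp (-λ t) D(t) dt` of the Volterra equation. -/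
noncomputable def symbol (ω : ℝ) (D : ℝ → V →L[ℂ] V) (z : ℂ) : V →L[ℂ] V :=
  (z ^ 2 + (ω : ℂ) ^ 2) • (1 : V →L[ℂ] V) - laplace D z

/-- The inverse of the symbol. -/
noncomputable def resolvent (ω : ℝ) (D : ℝ → V →L[ℂ] V) (z : ℂ) : V →L[ℂ] V :=
  Ring.inverse (symbol ω D z)

/-- Hypotheses on the kernel of the Volterra equation: continuity, decay, and invertibility of the
symbol on the closed right half-plane. -/
structure AdmissibleKernel (ω : ℝ) (D : ℝ → V →L[ℂ] V) (A : ℝ) : Prop where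
  continuous : Continuous D
  bound : ∀ t, 0 ≤ t → (1 + t) * ‖D t‖ ≤ A * wt t
  isUnit : ∀ z : ℂ, 0 ≤ z.re → IsUnit (symbol ω D z)

namespace AdmissibleKernel

variable {ω : ℝ} {D : ℝ → V →L[ℂ] V} {A : ℝ} (hD : AdmissibleKernel ω D A)

include hD

lemma const_nonneg : 0 ≤ A := by
  have := hD.bound 0 le_rfl
  have h : 0 ≤ (1 + 0) * ‖D 0‖ := by positivity
  have h2 := wt_pos 0
  nlinarith

lemma norm_le {t : ℝ} (ht : 0 ≤ t) : ‖D t‖ ≤ A * wt t := by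
  have := hD.bound t ht
  have h : 0 ≤ t * ‖D t‖ := by positivity
  nlinarith

/-- This is the purpose of the additional power of 1 + t in `AdmissibleKernel.bound`: the first
moment of the kernel is still of order t^(-3/2), hence integrable. -/
lemma norm_smul_le {t : ℝ} (ht : 0 ≤ t) : ‖t • D t‖ ≤ A * wt t := by
  have := hD.bound t ht
  rw [norm_smul, Real.norm_of_nonneg ht]
  have h : 0 ≤ ‖D t‖ := by positivity
  nlinarith

lemma integrableOn : IntegrableOn D (Ioi 0) := by
  refine Integrable.mono' (integrable_wt.integrableOn.const_mul A)
    hD.continuous.aestronglyMeasurable ?_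
  filter_upwards [ae_restrict_mem measurableSet_Ioi] with t ht using hD.norm_le (le_of_lt ht)

lemma integrableOn_smul : IntegrableOn (fun t => t • D t) (Ioi 0) := by
  refine Integrable.mono' (integrable_wt.integrableOn.const_mul A)
    (continuous_id.smul hD.continuous).aestronglyMeasurable ?_
  filter_upwards [ae_restrict_mem measurableSet_Ioi] with t ht using hD.norm_smul_le (le_of_lt ht)

lemma symbol_mul_resolvent {z : ℂ} (hz : 0 ≤ z.re) : symbol ω D z * resolvent ω D z = 1 :=
  Ring.mul_inverse_cancel _ (hD.isUnit z hz)

lemma resolvent_mul_symbol {z : ℂ} (hz : 0 ≤ z.re) : resolvent ω D z * symbol ω D z = 1 :=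
  Ring.inverse_mul_cancel _ (hD.isUnit z hz)

lemma continuousOn_symbol : ContinuousOn (symbol ω D) {z | 0 ≤ z.re} := by
  refine ContinuousOn.sub ?_ (continuousOn_laplace hD.integrableOn)
  exact Continuous.continuousOn (by fun_prop)

variable [CompleteSpace V]

lemma continuousOn_resolvent : ContinuousOn (resolvent ω D) {z | 0 ≤ z.re} := by
  intro z hz
  obtain ⟨u, hu⟩ := hD.isUnit z hz
  have h := NormedRing.inverse_continuousAt u
  rw [hu] at h
  exact h.comp_continuousWithinAt (hD.continuousOn_symbol z hz)

lemma differentiableAt_resolvent {z : ℂ} (hz : 0 < z.re) :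
    DifferentiableAt ℂ (resolvent ω D) z := by
  have h1 : DifferentiableAt ℂ (symbol ω D) z := by
    refine DifferentiableAt.sub ?_ (differentiableAt_laplace hD.integrableOn hz)
    fun_prop
  obtain ⟨u, hu⟩ := hD.isUnit z hz.le
  have h := (hasFDerivAt_ringInverse (𝕜 := ℂ) u).differentiableAt
  rw [hu] at h
  exact h.comp z h1

/-- For large |z| the term z² dominates the bounded perturbation D̂(z) - ω², and on the remaining
half-disc the resolvent is bounded by compactness. -/
lemma exists_norm_resolvent_le : ∃ C, 0 < C ∧ ∀ z : ℂ, 0 ≤ z.re →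
    ‖resolvent ω D z‖ ≤ C * (1 + ‖z‖ ^ 2)⁻¹ := by
  set a : ℝ := (∫ t in Ioi (0 : ℝ), ‖D t‖) + ω ^ 2 with ha
  have ha0 : 0 ≤ a := add_nonneg (integral_nonneg fun _ => norm_nonneg _) (sq_nonneg _)
  set n1 : ℝ := ‖(1 : V →L[ℂ] V)‖
  have hK : IsCompact (Metric.closedBall (0 : ℂ) (2 * a + 2) ∩ {z | 0 ≤ z.re}) :=
    (isCompact_closedBall _ _).inter_right (isClosed_le continuous_const Complex.continuous_re)
  obtain ⟨C₁, hC₁⟩ := hK.exists_bound_of_continuousOn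
    (hD.continuousOn_resolvent.mono inter_subset_right)
  refine ⟨|C₁| * (1 + (2 * a + 2) ^ 2) + 4 * n1 + 1, by positivity, fun z hz => ?_⟩
  rw [← div_eq_mul_inv, le_div_iff₀ (by positivity)]
  rcases le_total ‖z‖ (2 * a + 2) with h | h
  · have h1 := hC₁ z ⟨by simpa using h, hz⟩
    have h2 : ‖z‖ ^ 2 ≤ (2 * a + 2) ^ 2 := by gcongr
    calc ‖resolvent ω D z‖ * (1 + ‖z‖ ^ 2) ≤ |C₁| * (1 + (2 * a + 2) ^ 2) := by
          gcongr; exact h1.trans (le_abs_self _)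
      _ ≤ _ := by have : 0 ≤ n1 := norm_nonneg _
                  linarith
  · set F := resolvent ω D z
    have h1 : z ^ 2 • F = 1 + (laplace D z - ((ω : ℂ) ^ 2) • 1) * F := by
      have h0 : symbol ω D z * F = 1 := hD.symbol_mul_resolvent hz
      have h6 : z ^ 2 • F = symbol ω D z * F + (laplace D z - ((ω : ℂ) ^ 2) • 1) * F := by
        rw [symbol]
        simp only [sub_mul, add_smul, add_mul, smul_mul_assoc, one_mul]
        abel
      rwa [h0] at h6
    have h2 : ‖laplace D z - ((ω : ℂ) ^ 2) • (1 : V →L[ℂ] V)‖ ≤ a := by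
      refine (norm_sub_le _ _).trans ?_
      refine add_le_add (norm_laplace_le hD.integrableOn hz) ?_
      rw [norm_smul, norm_pow, Complex.norm_real, Real.norm_eq_abs, sq_abs]
      exact mul_le_of_le_one_right (sq_nonneg _) ContinuousLinearMap.norm_id_le
    have h3 : ‖z‖ ^ 2 * ‖F‖ ≤ n1 + a * ‖F‖ := by
      rw [← norm_pow, ← norm_smul, h1]
      refine (norm_add_le _ _).trans (add_le_add le_rfl ?_)
      exact (norm_mul_le _ _).trans (by gcongr)
    -- Here ‖z‖ ≥ 2a + 2 enters: a‖F‖ is absorbed on the left and a quarter of (1 + ‖z‖²)‖F‖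
    -- remains.
    have h4 : a + (1 + ‖z‖ ^ 2) / 4 ≤ ‖z‖ ^ 2 := by nlinarith
    have h5 := mul_le_mul_of_nonneg_right h4 (norm_nonneg F)
    have : 0 ≤ |C₁| * (1 + (2 * a + 2) ^ 2) := by positivity
    nlinarith

lemma hasDerivAt_resolvent_imag (μ : ℝ) :
    HasDerivAt (fun μ : ℝ => resolvent ω D (Complex.I * μ))
      (-(resolvent ω D (Complex.I * μ) *
        ((-2 * μ : ℂ) • 1 - laplace (fun t => (-Complex.I) • t • D t) (Complex.I * μ)) *
          resolvent ω D (Complex.I * μ))) μ := by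
  have hre : 0 ≤ (Complex.I * (μ : ℂ)).re := by simp
  have h1 : HasDerivAt (fun μ : ℝ => symbol ω D (Complex.I * μ))
      ((-2 * μ : ℂ) • 1 - laplace (fun t => (-Complex.I) • t • D t) (Complex.I * μ)) μ := by
    refine HasDerivAt.sub ?_ (hasDerivAt_laplace_imag hD.integrableOn hD.integrableOn_smul μ)
    have h2 := ((Complex.ofRealCLM.hasDerivAt (x := μ)).const_mul Complex.I).pow 2
    have h3 := (h2.add_const ((ω : ℂ) ^ 2)).smul_const (1 : V →L[ℂ] V)
    convert! h3 using 2
    simp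
    linear_combination (-2 * μ : ℂ) * Complex.I_mul_I
  obtain ⟨u, hu⟩ := hD.isUnit _ hre
  have h := (hasFDerivAt_ringInverse (𝕜 := ℝ) u)
  have hi : resolvent ω D (Complex.I * μ) = (↑u⁻¹ : V →L[ℂ] V) := by
    rw [resolvent, ← hu, Ring.inverse_unit]
  rw [hu] at h
  have h5 := h.comp_hasDerivAt μ h1
  rw [hi]
  convert! h5 using 1

end AdmissibleKernel

end Resolvent

/-! ### Hölder continuity on the imaginary axis and decay of the Fourier transform. -/

lemma wt_eq (t : ℝ) : wt t = ((1 + |t|) * √(1 + |t|))⁻¹ := by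
  have h : (0 : ℝ) < 1 + |t| := by positivity
  rw [wt, Real.rpow_neg h.le, show (3 / 2 : ℝ) = 1 + 1 / 2 by norm_num, Real.rpow_add h,
    Real.rpow_one, ← Real.sqrt_eq_rpow]

lemma wt_le_rpow {t : ℝ} (ht : 0 < t) : wt t ≤ t ^ (-(3 / 2) : ℝ) := by
  rw [wt, abs_of_pos ht]
  exact Real.rpow_le_rpow_of_nonpos ht (by linarith) (by norm_num)

lemma integrable_min_mul_wt {δ : ℝ} (hδ : 0 ≤ δ) :
    IntegrableOn (fun t => min 2 (δ * t) * wt t) (Ioi 0) := by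
  refine (integrable_wt.integrableOn.const_mul (2 : ℝ)).mono' ?_ ?_
  · exact (Continuous.mul (by fun_prop) continuous_wt).aestronglyMeasurable
  · filter_upwards [ae_restrict_mem measurableSet_Ioi] with t ht
    have ht : 0 < t := ht
    rw [Real.norm_of_nonneg (mul_nonneg (le_min (by norm_num) (by positivity)) (wt_nonneg t))]
    exact mul_le_mul_of_nonneg_right (min_le_left _ _) (wt_nonneg t)

/-- Splitting at t = 1/δ, the integral of δt · t^(-3/2) on the near side gives 2√δ and that of 2
t^(-3/2) on the far side gives 4√δ. -/
lemma integral_min_mul_wt_le {δ : ℝ} (hδ : 0 < δ) :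
    ∫ t in Ioi (0 : ℝ), min 2 (δ * t) * wt t ≤ 6 * √δ := by
  have hi := integrable_min_mul_wt hδ.le
  have hc : 0 < δ⁻¹ := inv_pos.mpr hδ
  have hs : √δ * √δ = δ := Real.mul_self_sqrt hδ.le
  have hs0 : 0 < √δ := Real.sqrt_pos.mpr hδ
  rw [← Ioc_union_Ioi_eq_Ioi hc.le, setIntegral_union (Ioc_disjoint_Ioi le_rfl) measurableSet_Ioi
    (hi.mono_set Ioc_subset_Ioi_self) (hi.mono_set (Ioi_subset_Ioi hc.le))]
  have h1 : ∫ t in Ioc 0 δ⁻¹, min 2 (δ * t) * wt t ≤ 2 * √δ := by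
    have e : ∫ t in Ioc 0 δ⁻¹, δ * t ^ (-(1 / 2) : ℝ) = 2 * √δ := by
      rw [integral_const_mul, ← intervalIntegral.integral_of_le hc.le,
        integral_rpow (Or.inl (by norm_num))]
      norm_num
      rw [← Real.sqrt_eq_rpow, Real.sqrt_inv]
      field_simp
      nlinarith
    rw [← e]
    refine setIntegral_mono_on (hi.mono_set Ioc_subset_Ioi_self) ?_ measurableSet_Ioc ?_
    · rw [← intervalIntegrable_iff_integrableOn_Ioc_of_le hc.le]
      exact (intervalIntegral.intervalIntegrable_rpow' (by norm_num)).const_mul _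
    · intro t ht
      have ht0 : 0 < t := ht.1
      calc min 2 (δ * t) * wt t ≤ (δ * t) * t ^ (-(3 / 2) : ℝ) := by
            exact mul_le_mul (min_le_right _ _) (wt_le_rpow ht0) (wt_nonneg t) (by positivity)
        _ = δ * t ^ (-(1 / 2) : ℝ) := by
            rw [mul_assoc, ← Real.rpow_one_add' ht0.le (by norm_num)]; norm_num
  have h2 : ∫ t in Ioi δ⁻¹, min 2 (δ * t) * wt t ≤ 4 * √δ := by
    have e : ∫ t in Ioi δ⁻¹, 2 * t ^ (-(3 / 2) : ℝ) = 4 * √δ := by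
      rw [integral_const_mul, integral_Ioi_rpow_of_lt (by norm_num) hc]
      norm_num
      rw [Real.inv_rpow hδ.le, Real.rpow_neg hδ.le, inv_inv, ← Real.sqrt_eq_rpow]
      ring
    rw [← e]
    refine setIntegral_mono_on (hi.mono_set (Ioi_subset_Ioi hc.le))
      ((integrableOn_Ioi_rpow_of_lt (by norm_num) hc).const_mul _) measurableSet_Ioi ?_
    intro t ht
    have ht0 : 0 < t := hc.trans ht
    exact mul_le_mul (min_le_left _ _) (wt_le_rpow ht0) (wt_nonneg t) (by norm_num)
  linarith

lemma norm_cexp_I_mul_sub_le (a b : ℝ) :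
    ‖Complex.exp (Complex.I * a) - Complex.exp (Complex.I * b)‖ ≤ min 2 |a - b| := by
  refine le_min ?_ ?_
  · refine (norm_sub_le _ _).trans ?_
    rw [mul_comm, Complex.norm_exp_ofReal_mul_I, mul_comm, Complex.norm_exp_ofReal_mul_I]; norm_num
  · have h : Complex.exp (Complex.I * a) - Complex.exp (Complex.I * b)
        = Complex.exp (Complex.I * b) * (Complex.exp (Complex.I * ((a - b : ℝ) : ℂ)) - 1) := by
      rw [mul_sub, ← Complex.exp_add, mul_one]; congr 2; push_cast; ring
    rw [h, norm_mul, mul_comm Complex.I, Complex.norm_exp_ofReal_mul_I, one_mul]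
    exact Real.norm_exp_I_mul_ofReal_sub_one_le

/-- The Laplace transform of a function of order `t^(-3/2)` is Hölder continuous of order `1/2` on
the imaginary axis. -/
lemma norm_laplace_imag_sub_le {X : Type*} [NormedAddCommGroup X] [NormedSpace ℂ X] {h : ℝ → X}
    {A : ℝ} (hA : 0 ≤ A)
    (hm : AEStronglyMeasurable h (volume.restrict (Ioi 0))) (hh : ∀ t, 0 < t → ‖h t‖ ≤ A * wt t)
    (μ ν : ℝ) :
    ‖laplace h (Complex.I * μ) - laplace h (Complex.I * ν)‖ ≤ 6 * A * √|μ - ν| := by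
  rcases eq_or_ne μ ν with rfl | hne
  · simp
  have hδ : 0 < |μ - ν| := abs_pos.mpr (sub_ne_zero.mpr hne)
  have hint : IntegrableOn h (Ioi 0) := by
    refine Integrable.mono' (integrable_wt.integrableOn.const_mul A) hm ?_
    filter_upwards [ae_restrict_mem measurableSet_Ioi] with t ht using hh t ht
  rw [laplace, laplace, ← integral_sub (integrableOn_laplace hint (by simp))
    (integrableOn_laplace hint (by simp))]
  calc _ ≤ ∫ t in Ioi (0 : ℝ), A * (min 2 (|μ - ν| * t) * wt t) := by
        refine norm_integral_le_of_norm_le ((integrable_min_mul_wt hδ.le).const_mul A) ?_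
        filter_upwards [ae_restrict_mem measurableSet_Ioi] with t ht
        have ht : 0 < t := ht
        rw [← sub_smul, norm_smul]
        have e1 := norm_cexp_I_mul_sub_le (-(μ * t)) (-(ν * t))
        have e2 : |-(μ * t) - -(ν * t)| = |μ - ν| * t := by
          rw [← abs_of_pos ht, ← abs_mul, abs_of_pos ht, ← abs_neg]; congr 1; ring
        rw [e2] at e1
        have e3 : ∀ μ : ℝ, -(Complex.I * μ) * t = Complex.I * ((-(μ * t) : ℝ) : ℂ) := by
          intro μ; push_cast; ring
        rw [e3, e3]
        have := hh t ht
        calc _ ≤ min 2 (|μ - ν| * t) * (A * wt t) := by gcongr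
          _ = _ := by ring
    _ ≤ A * (6 * √|μ - ν|) := by
        rw [integral_const_mul]; gcongr; exact integral_min_mul_wt_le hδ
    _ = _ := by ring

/-- A function on the line whose derivative is integrable and Hölder continuous of order `1/2` in
`L¹` has a Fourier transform of order `t^(-3/2)`. -/
lemma exists_norm_fourier_le_wt {X : Type*} [NormedAddCommGroup X] [NormedSpace ℂ X]
    {F F' : ℝ → X} {C : ℝ} (hF : ∀ μ, HasDerivAt F (F' μ) μ) (hFi : Integrable F)
    (hFi' : Integrable F')
    (hH : ∀ h : ℝ, |h| ≤ 1 → ∫ μ, ‖F' μ - F' (μ + h)‖ ≤ C * √|h|) :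
    ∃ K, 0 < K ∧ ∀ t : ℝ, ‖∫ μ : ℝ, Complex.exp (Complex.I * μ * t) • F μ‖ ≤ K * wt t := by
  have hn : ∀ μ t : ℝ, ‖Complex.exp (Complex.I * μ * t)‖ = 1 := fun μ t => by
    rw [Complex.norm_exp]; simp
  have hint : ∀ (G : ℝ → X) (t : ℝ), Integrable G →
      Integrable fun μ : ℝ => Complex.exp (Complex.I * μ * t) • G μ := by
    intro G t hG
    refine hG.norm.mono' ?_ (ae_of_all _ fun μ => by rw [norm_smul, hn, one_mul])
    exact (Continuous.aestronglyMeasurable (by fun_prop)).smul hG.aestronglyMeasurable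
  set M := ∫ μ, ‖F μ‖
  have hM0 : 0 ≤ M := integral_nonneg fun _ => norm_nonneg _
  have hbd : ∀ t : ℝ, ‖∫ μ : ℝ, Complex.exp (Complex.I * μ * t) • F μ‖ ≤ M := by
    intro t
    refine norm_integral_le_of_norm_le hFi.norm (ae_of_all _ fun μ => ?_)
    rw [norm_smul, hn, one_mul]
  have hC : 0 ≤ C := by
    have := (integral_nonneg fun _ => norm_nonneg _).trans (hH 1 (by simp))
    simpa using this
  have hpi := Real.pi_gt_three
  -- The first term serves |t| ≤ π through the plain L¹ bound; the second serves |t| ≥ π.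
  refine ⟨M / wt Real.pi + 6 * C + 1, by have := wt_pos Real.pi; positivity, fun t => ?_⟩
  rcases le_total |t| Real.pi with ht | ht
  · have h1 : wt Real.pi ≤ wt t := wt_anti (by rwa [abs_of_pos Real.pi_pos])
    have h2 := wt_pos Real.pi
    have h3 : M ≤ M / wt Real.pi * wt t := by
      rw [div_mul_eq_mul_div, le_div_iff₀ h2]; gcongr
    have h4 := wt_pos t
    have := hbd t
    nlinarith
  have ht0 : 0 < |t| := Real.pi_pos.trans_le ht
  have htne : t ≠ 0 := abs_pos.mp ht0
  set W := ∫ μ : ℝ, Complex.exp (Complex.I * μ * t) • F' μ with hW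
  -- Integration by parts: the total integral of the derivative of exp(iμt) F(μ) vanishes.
  have e1 : (Complex.I * t) • (∫ μ : ℝ, Complex.exp (Complex.I * μ * t) • F μ) + W = 0 := by
    rw [← integral_smul, hW, ← integral_add (f := fun μ : ℝ =>
      (Complex.I * (t : ℂ)) • Complex.exp (Complex.I * μ * t) • F μ)
      ((hint F t hFi).smul _) (hint F' t hFi')]
    refine integral_eq_zero_of_hasDerivAt_of_integrable
      (f := fun μ : ℝ => Complex.exp (Complex.I * μ * t) • F μ) (fun μ => ?_)
      (((hint F t hFi).smul _).add (hint F' t hFi')) (hint F t hFi)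
    have h2 : HasDerivAt (fun μ : ℝ => Complex.I * (μ : ℂ) * (t : ℂ)) (Complex.I * t) μ := by
      have := ((Complex.ofRealCLM.hasDerivAt (x := μ)).const_mul Complex.I).mul_const (t : ℂ)
      simpa using this
    have h3 := h2.cexp.smul (hF μ)
    convert! h3 using 1
    rw [add_comm, smul_smul, mul_comm (Complex.I * (t : ℂ))]
  -- A shift by the half period π/t reverses the sign of exp(iμt), so 2W is an integral of
  -- increments of F'. The condition |h| ≤ 1 is the reason for the threshold |t| ≥ π.
  set h := Real.pi / t with hh
  have hht : h * t = Real.pi := by rw [hh]; field_simp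
  have hhabs : |h| = Real.pi / |t| := by rw [hh, abs_div, abs_of_pos Real.pi_pos]
  have hh1 : |h| ≤ 1 := by rw [hhabs, div_le_one ht0]; exact ht
  have e2 : W = -∫ μ : ℝ, Complex.exp (Complex.I * μ * t) • F' (μ + h) := by
    rw [hW, ← integral_add_right_eq_self _ h, ← integral_neg]
    congr 1; ext μ
    rw [← neg_smul]; congr 1
    have : Complex.I * ((μ + h : ℝ) : ℂ) * t = Complex.I * μ * t + Real.pi * Complex.I := by
      rw [← hht]; push_cast; ring
    rw [this, Complex.exp_add, Complex.exp_pi_mul_I]; ring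
  have e3 : (2 : ℝ) * ‖W‖ ≤ C * √|h| := by
    have : (2 : ℝ) • W = ∫ μ : ℝ, Complex.exp (Complex.I * μ * t) • (F' μ - F' (μ + h)) := by
      simp_rw [smul_sub]
      rw [integral_sub (hint F' t hFi') (hint (fun μ => F' (μ + h)) t (hFi'.comp_add_right h)),
        two_smul, ← hW, sub_eq_add_neg, ← e2]
    rw [← Real.norm_of_nonneg (show (0 : ℝ) ≤ 2 by norm_num), ← norm_smul, this]
    refine (norm_integral_le_of_norm_le (g := fun μ => ‖F' μ - F' (μ + h)‖) ?_ ?_).trans (hH h hh1)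
    · exact (hFi'.sub (hFi'.comp_add_right h)).norm
    · exact ae_of_all _ fun μ => by rw [norm_smul, hn, one_mul]
  have e4 : |t| * ‖∫ μ : ℝ, Complex.exp (Complex.I * μ * t) • F μ‖ = ‖W‖ := by
    rw [eq_neg_of_add_eq_zero_right e1, norm_neg, norm_smul]; simp
  set N := ‖∫ μ : ℝ, Complex.exp (Complex.I * μ * t) • F μ‖
  have hN : N ≤ 6 * C * wt t := by
    rw [wt_eq, ← div_eq_mul_inv, le_div_iff₀ (by positivity)]
    have h5 : √|h| * √|t| = √Real.pi := by
      rw [← Real.sqrt_mul (abs_nonneg _), hhabs, div_mul_cancel₀ _ ht0.ne']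
    have h6 : √(1 + |t|) ≤ 3 / 2 * √|t| := by
      rw [Real.sqrt_le_left (by positivity), mul_pow, Real.sq_sqrt ht0.le]; linarith
    have h7 : √Real.pi ≤ 2 := by
      rw [Real.sqrt_le_left (by norm_num)]; linarith [Real.pi_lt_four]
    calc N * ((1 + |t|) * √(1 + |t|)) ≤ N * (4 / 3 * |t| * (3 / 2 * √|t|)) := by
          gcongr
          linarith
      _ = 2 * ‖W‖ * √|t| := by rw [← e4]; ring
      _ ≤ C * √|h| * √|t| := by gcongr
      _ = C * √Real.pi := by rw [mul_assoc, h5]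
      _ ≤ 6 * C := by nlinarith
  have h8 : 0 ≤ M / wt Real.pi := div_nonneg hM0 (wt_nonneg _)
  have h9 := wt_pos t
  nlinarith [mul_nonneg h8 h9.le]

lemma norm_mul_mul_sub_le {R : Type*} [NormedRing R] (F F₁ P P₁ : R) :
    ‖F * P * F - F₁ * P₁ * F₁‖ ≤
      ‖F - F₁‖ * ‖P₁‖ * ‖F₁‖ + ‖F‖ * ‖P - P₁‖ * ‖F₁‖ + ‖F‖ * ‖P‖ * ‖F - F₁‖ := by
  have : F * P * F - F₁ * P₁ * F₁
      = (F - F₁) * P₁ * F₁ + F * (P - P₁) * F₁ + F * P * (F - F₁) := by noncomm_ring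
  rw [this]
  exact (norm_add₃_le).trans (add_le_add (add_le_add (norm_mul₃_le ..) (norm_mul₃_le ..))
    (norm_mul₃_le ..))

section

variable {V : Type*} [NormedAddCommGroup V] [NormedSpace ℂ V] [CompleteSpace V]

/-- The inverse Fourier transform of the resolvent on the imaginary axis. -/
noncomputable def greenKernel (ω : ℝ) (D : ℝ → V →L[ℂ] V) (t : ℝ) : V →L[ℂ] V :=
  ∫ μ : ℝ, Complex.exp (Complex.I * μ * t) • resolvent ω D (Complex.I * μ)

namespace AdmissibleKernel

variable {ω : ℝ} {D : ℝ → V →L[ℂ] V} {A : ℝ} (hD : AdmissibleKernel ω D A)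

include hD

lemma continuous_resolvent_imag : Continuous fun μ : ℝ => resolvent ω D (Complex.I * μ) :=
  hD.continuousOn_resolvent.comp_continuous (by fun_prop) (by simp)

lemma integrable_resolvent_imag : Integrable fun μ : ℝ => resolvent ω D (Complex.I * μ) := by
  obtain ⟨C, hC0, hC⟩ := hD.exists_norm_resolvent_le
  refine (integrable_inv_one_add_sq.const_mul C).mono'
    hD.continuous_resolvent_imag.aestronglyMeasurable (ae_of_all _ fun μ => ?_)
  simpa using hC (Complex.I * μ) (by simp)

/-- With P the derivative of the symbol along the axis, the resolvent F has derivative -F P F. Since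
P grows linearly and is locally Hölder of order 1/2 while F decays quadratically, both F P F and its
increments are dominated by multiples of (1 + μ²)⁻¹, which is what `exists_norm_fourier_le_wt`
requires. -/
lemma exists_norm_greenKernel_le :
    ∃ K, 0 < K ∧ ∀ t : ℝ, ‖greenKernel ω D t‖ ≤ K * wt t := by
  obtain ⟨C, hC0, hC⟩ := hD.exists_norm_resolvent_le
  set F : ℝ → V →L[ℂ] V := fun μ => resolvent ω D (Complex.I * μ) with hF
  set L : ℝ → V →L[ℂ] V := fun μ => laplace (fun t => (-Complex.I) • t • D t) (Complex.I * μ)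
    with hL
  set P : ℝ → V →L[ℂ] V := fun μ => (-2 * μ : ℂ) • 1 - L μ with hP
  set j : ℝ → ℝ := fun μ => (1 + μ ^ 2)⁻¹ with hj
  have hj0 : ∀ μ, 0 < j μ := fun μ => by positivity
  -- One factor `j` absorbs the linear growth of P; the other remains for integrability.
  have hj1 : ∀ μ, (3 + 3 * |μ|) * j μ ≤ 6 := fun μ => by
    rw [hj, ← div_eq_mul_inv, div_le_iff₀ (by positivity), ← sq_abs]
    nlinarith [sq_nonneg (|μ| - 1)]
  have hjj : ∀ μ h : ℝ, |h| ≤ 1 → j (μ + h) ≤ 3 * j μ := fun μ h hh => by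
    rw [hj, ← div_eq_mul_inv]
    change (1 + (μ + h) ^ 2)⁻¹ ≤ _
    rw [inv_le_comm₀ (by positivity) (by positivity), inv_div, div_le_iff₀ (by norm_num)]
    have : h ^ 2 ≤ 1 := by rw [← sq_abs]; nlinarith [abs_nonneg h]
    nlinarith [sq_nonneg (2 * μ + 3 * h), sq_nonneg (μ + h + h)]
  have hFb : ∀ μ, ‖F μ‖ ≤ C * j μ := fun μ => by simpa using hC (Complex.I * μ) (by simp)
  have hA := hD.const_nonneg
  have hgm : AEStronglyMeasurable (fun t => (-Complex.I) • t • D t)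
      (volume.restrict (Ioi (0 : ℝ))) := 
    (hD.integrableOn_smul.smul (-Complex.I)).aestronglyMeasurable
  have hgb : ∀ t, 0 < t → ‖(-Complex.I) • t • D t‖ ≤ A * wt t := fun t ht => by
    rw [norm_smul, norm_neg, Complex.norm_I, one_mul]; exact hD.norm_smul_le ht.le
  have hLh : ∀ μ ν, ‖L μ - L ν‖ ≤ 6 * A * √|μ - ν| := norm_laplace_imag_sub_le hA hgm hgb
  have hLc : Continuous L := by
    refine (continuousOn_laplace (hD.integrableOn_smul.smul (-Complex.I))).comp_continuous
      (by fun_prop) (by simp)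
  set b : ℝ := ∫ t in Ioi (0 : ℝ), ‖(-Complex.I) • t • D t‖
  have hb : ∀ μ, ‖L μ‖ ≤ b := fun μ =>
    norm_laplace_le (hD.integrableOn_smul.smul (-Complex.I)) (by simp)
  have hb0 : 0 ≤ b := integral_nonneg fun _ => norm_nonneg _
  have h1 : ‖(1 : V →L[ℂ] V)‖ ≤ 1 := ContinuousLinearMap.norm_id_le
  have hPb : ∀ μ, ‖P μ‖ ≤ (2 + b) * (1 + |μ|) := fun μ => by
    refine (norm_sub_le _ _).trans ?_
    rw [norm_smul]
    simp only [neg_mul, norm_neg, norm_mul, Complex.norm_ofNat, Complex.norm_real, Real.norm_eq_abs]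
    have h2 := hb μ
    have h3 := mul_le_mul_of_nonneg_left h1 (abs_nonneg μ)
    nlinarith [abs_nonneg μ]
  have hPh : ∀ μ ν, ‖P μ - P ν‖ ≤ 2 * |μ - ν| + 6 * A * √|μ - ν| := fun μ ν => by
    have : P μ - P ν = (-2 * ((μ - ν : ℝ) : ℂ)) • (1 : V →L[ℂ] V) - (L μ - L ν) := by
      simp only [hP]; push_cast; module
    rw [this]
    refine (norm_sub_le _ _).trans (add_le_add ?_ (hLh μ ν))
    rw [norm_smul]
    simp only [neg_mul, norm_neg, norm_mul, Complex.norm_ofNat, Complex.norm_real, Real.norm_eq_abs]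
    have h3 := mul_le_mul_of_nonneg_left h1 (abs_nonneg (μ - ν))
    nlinarith
  set F' : ℝ → V →L[ℂ] V := fun μ => -(F μ * P μ * F μ) with hF'
  have hder : ∀ μ, HasDerivAt F (F' μ) μ := hD.hasDerivAt_resolvent_imag
  have hFc : Continuous F := hD.continuous_resolvent_imag
  have hF'c : Continuous F' := by
    have : Continuous P := by
      refine Continuous.sub ?_ hLc
      fun_prop
    fun_prop
  set C₁ := 6 * C ^ 2 * (2 + b) with hC₁
  have hC₁0 : 0 ≤ C₁ := by positivity
  have hF'b : ∀ μ, ‖F' μ‖ ≤ C₁ * j μ := fun μ => by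
    have h0 := hj0 μ
    have h2 := hj1 μ
    have h4 := abs_nonneg μ
    calc ‖F' μ‖ ≤ ‖F μ‖ * ‖P μ‖ * ‖F μ‖ := by rw [hF', norm_neg]; exact norm_mul₃_le ..
      _ ≤ (C * j μ) * ((2 + b) * (1 + |μ|)) * (C * j μ) := by
          gcongr <;> first | exact hFb μ | exact hPb μ
      _ = C ^ 2 * (2 + b) * ((1 + |μ|) * j μ) * j μ := by ring
      _ ≤ C ^ 2 * (2 + b) * 6 * j μ := by gcongr; nlinarith
      _ = C₁ * j μ := by rw [hC₁]; ring
  -- Mean value inequality on the segment from μ to μ + h, along which `j` changes by at most a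
  -- factor 3.
  have hFd : ∀ μ h : ℝ, |h| ≤ 1 → ‖F μ - F (μ + h)‖ ≤ 3 * C₁ * j μ * |h| := fun μ h hh => by
    have := (convex_uIcc (μ) (μ + h)).norm_image_sub_le_of_norm_hasDerivWithin_le
      (f := F) (f' := F') (x := μ + h) (y := μ) (C := 3 * C₁ * j μ)
      (fun x _ => (hder x).hasDerivWithinAt) (fun x hx => ?_) right_mem_uIcc left_mem_uIcc
    · simpa using this
    · have hx' : |x - μ| ≤ 1 := by
        have := abs_sub_left_of_mem_uIcc hx
        simpa using this.trans (by simpa using hh)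
      calc ‖F' x‖ ≤ C₁ * j x := hF'b x
        _ ≤ C₁ * (3 * j μ) := by
            gcongr; simpa using hjj μ (x - μ) hx'
        _ = _ := by ring
  set C₂ := 6 * (3 * C₁ * (2 + b) * (3 * C)) + C * (2 + 6 * A) * (3 * C) +
    6 * (C * (2 + b) * (3 * C₁)) with hC₂
  have hC₂0 : 0 ≤ C₂ := by positivity
  have hF'd : ∀ h : ℝ, |h| ≤ 1 → ∀ μ, ‖F' μ - F' (μ + h)‖ ≤ C₂ * √|h| * j μ := fun h hh μ => by
    -- For |h| ≤ 1 the Lipschitz increments also count as Hölder increments of order 1/2.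
    have hs : |h| ≤ √|h| := by
      refine Real.le_sqrt_of_sq_le ?_
      nlinarith [abs_nonneg h]
    have hjp := hj0 μ
    have hjle : j μ ≤ 1 := inv_le_one_of_one_le₀ (by nlinarith [sq_nonneg μ])
    have hP1 : ‖P (μ + h)‖ ≤ (2 + b) * (2 + |μ|) := (hPb _).trans
      (mul_le_mul_of_nonneg_left (by linarith [abs_add_le μ h]) (by positivity))
    have hF1 : ‖F (μ + h)‖ ≤ C * (3 * j μ) := (hFb _).trans (by gcongr; exact hjj μ h hh)
    have hPd : ‖P μ - P (μ + h)‖ ≤ (2 + 6 * A) * √|h| := by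
      refine (hPh _ _).trans ?_
      simp only [sub_add_cancel_left, abs_neg]
      nlinarith
    have hFd' : ‖F μ - F (μ + h)‖ ≤ 3 * C₁ * j μ * √|h| := (hFd μ h hh).trans (by gcongr)
    have e : F' μ - F' (μ + h) = -(F μ * P μ * F μ - F (μ + h) * P (μ + h) * F (μ + h)) := by
      simp only [hF']; abel
    have a0 := abs_nonneg μ
    have s0 := Real.sqrt_nonneg |h|
    rw [e, norm_neg]
    refine (norm_mul_mul_sub_le _ _ _ _).trans ?_
    calc _ ≤ (3 * C₁ * j μ * √|h|) * ((2 + b) * (2 + |μ|)) * (C * (3 * j μ))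
          + (C * j μ) * ((2 + 6 * A) * √|h|) * (C * (3 * j μ))
          + (C * j μ) * ((2 + b) * (1 + |μ|)) * (3 * C₁ * j μ * √|h|) := by
          gcongr <;> first | exact hFb μ | exact hPb μ
      _ = (((2 + |μ|) * j μ) * (3 * C₁ * (2 + b) * (3 * C)) + j μ * (C * (2 + 6 * A) * (3 * C))
          + ((1 + |μ|) * j μ) * (C * (2 + b) * (3 * C₁))) * (√|h| * j μ) := by ring
      _ ≤ (6 * (3 * C₁ * (2 + b) * (3 * C)) + 1 * (C * (2 + 6 * A) * (3 * C))
          + 6 * (C * (2 + b) * (3 * C₁))) * (√|h| * j μ) := by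
          have := hj1 μ
          gcongr <;> nlinarith
      _ = C₂ * √|h| * j μ := by rw [hC₂]; ring
  have hF'i : Integrable F' :=
    (integrable_inv_one_add_sq.const_mul C₁).mono' hF'c.aestronglyMeasurable
      (ae_of_all _ hF'b)
  refine exists_norm_fourier_le_wt (C := C₂ * Real.pi) hder hD.integrable_resolvent_imag hF'i
    fun h hh => ?_
  calc ∫ μ, ‖F' μ - F' (μ + h)‖ ≤ ∫ μ, C₂ * √|h| * j μ :=
        integral_mono ((hF'i.sub (hF'i.comp_add_right h)).norm)
          (integrable_inv_one_add_sq.const_mul _) (hF'd h hh)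
    _ = C₂ * Real.pi * √|h| := by
        rw [integral_const_mul, hj, integral_univ_inv_one_add_sq]; ring

end AdmissibleKernel

end

/-! ### Contour shift and Laplace inversion. -/

section

variable {V : Type*} [NormedAddCommGroup V] [NormedSpace ℂ V]

/-- Vertical lines in a strip carry the same integral of a holomorphic function with quadratic
decay. -/
lemma integral_vertical_eq [CompleteSpace V] {Φ : ℂ → V} {C σ : ℝ} (hσ : 0 < σ)
    (hc : ContinuousOn Φ {z | 0 ≤ z.re}) (hd : ∀ z : ℂ, 0 < z.re → DifferentiableAt ℂ Φ z)
    (hb : ∀ z : ℂ, 0 ≤ z.re → z.re ≤ σ → ‖Φ z‖ ≤ C * (1 + z.im ^ 2)⁻¹) :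
    ∫ μ : ℝ, Φ (σ + μ * Complex.I) = ∫ μ : ℝ, Φ (μ * Complex.I) := by
  have hint : ∀ a : ℝ, 0 ≤ a → a ≤ σ → Integrable fun μ : ℝ => Φ (a + μ * Complex.I) := by
    intro a ha haσ
    refine (integrable_inv_one_add_sq.const_mul C).mono' ?_ (ae_of_all _ fun μ => ?_)
    · exact (hc.comp_continuous (by fun_prop) (by simpa using ha)).aestronglyMeasurable
    · simpa using hb (a + μ * Complex.I) (by simpa using ha) (by simpa using haσ)
  -- The horizontal sides of the rectangle, at heights s(T) = T and s(T) = -T, contribute at most Cσ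
  -- / (1 + T²).
  have htop : ∀ s : ℝ → ℝ, Tendsto (fun T => s T ^ 2) atTop atTop →
      Tendsto (fun T => ∫ x in (0 : ℝ)..σ, Φ (x + s T * Complex.I)) atTop (𝓝 0) := by
    intro s hs
    have h1 : Tendsto (fun T => C * (1 + s T ^ 2)⁻¹ * |σ - 0|) atTop (𝓝 (C * 0 * |σ - 0|)) :=
      ((tendsto_inv_atTop_zero.comp (tendsto_atTop_add_const_left _ 1 hs)).const_mul C).mul_const _
    rw [mul_zero, zero_mul] at h1
    refine squeeze_zero_norm (fun T => ?_) h1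
    refine intervalIntegral.norm_integral_le_of_norm_le_const fun x hx => ?_
    rw [uIoc_of_le hσ.le] at hx
    simpa using hb (x + s T * Complex.I) (by simpa using hx.1.le) (by simpa using hx.2)
  have hvert : ∀ a : ℝ, 0 ≤ a → a ≤ σ →
      Tendsto (fun T : ℝ => ∫ y in (-T)..T, Φ (a + y * Complex.I)) atTop
        (𝓝 (∫ μ : ℝ, Φ (a + μ * Complex.I))) := fun a ha haσ =>
    intervalIntegral_tendsto_integral (hint a ha haσ) tendsto_neg_atTop_atBot tendsto_id
  have hrect : ∀ T : ℝ, 0 < T → (∫ x in (0 : ℝ)..σ, Φ (x + (-T : ℝ) * Complex.I))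
      - (∫ x in (0 : ℝ)..σ, Φ (x + T * Complex.I))
      + Complex.I • (∫ y in (-T)..T, Φ (σ + y * Complex.I))
      - Complex.I • (∫ y in (-T)..T, Φ ((0 : ℝ) + y * Complex.I)) = 0 := by
    intro T hT
    have := Complex.integral_boundary_rect_eq_zero_of_continuousOn_of_differentiableOn Φ
      ⟨0, -T⟩ ⟨σ, T⟩ (hc.mono ?_) ?_
    · exact this
    · intro z hz
      rw [Complex.mem_reProdIm, uIcc_of_le hσ.le] at hz
      exact hz.1.1
    · intro z hz
      rw [Complex.mem_reProdIm, min_eq_left hσ.le] at hz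
      exact (hd z hz.1.1).differentiableWithinAt
  have hlim := ((((htop (fun T => -T) (by simp)).sub
    (htop (fun T => T) (tendsto_pow_atTop two_ne_zero))).add
    ((hvert σ hσ.le le_rfl).const_smul Complex.I)).sub
    ((hvert 0 le_rfl hσ.le).const_smul Complex.I))
  have h0 : Tendsto (fun T : ℝ => (∫ x in (0 : ℝ)..σ, Φ (x + (-T : ℝ) * Complex.I))
      - (∫ x in (0 : ℝ)..σ, Φ (x + T * Complex.I))
      + Complex.I • (∫ y in (-T)..T, Φ (σ + y * Complex.I))
      - Complex.I • (∫ y in (-T)..T, Φ ((0 : ℝ) + y * Complex.I))) atTop (𝓝 0) := by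
    refine tendsto_const_nhds.congr' ?_
    filter_upwards [eventually_gt_atTop 0] with T hT using (hrect T hT).symm
  have := tendsto_nhds_unique hlim h0
  simp only [sub_zero, zero_add, ← smul_sub, smul_eq_zero, Complex.I_ne_zero, false_or,
    sub_eq_zero] at this
  simpa using this

/-- Laplace inversion for continuous functions vanishing at the origin. -/
lemma laplace_inversion [CompleteSpace V] {q : ℝ → V} (hq : Continuous q) (hq0 : q 0 = 0) {σ : ℝ}
    (hi : IntegrableOn (fun t : ℝ => Complex.exp (-(σ : ℂ) * t) • q t) (Ioi 0))
    (hi' : Integrable fun μ : ℝ => laplace q (σ + μ * Complex.I)) {t : ℝ} (ht : 0 ≤ t) :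
    (2 * Real.pi) • q t =
      ∫ μ : ℝ, Complex.exp ((σ + μ * Complex.I) * t) • laplace q (σ + μ * Complex.I) := by
  -- Because q(0) = 0, extending exp(-σt) q(t) by zero gives a function continuous on the line, to
  -- which Fourier inversion applies pointwise. Its transform at ξ is the Laplace transform of q at
  -- σ + 2πiξ.
  set u : ℝ → V := (Ioi (0 : ℝ)).indicator fun t : ℝ => Complex.exp (-(σ : ℂ) * t) • q t with hu
  have hui : Integrable u := (integrable_indicator_iff measurableSet_Ioi).mpr hi
  have huc : Continuous u := by
    refine Continuous.indicator ?_ (by fun_prop)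
    intro a ha
    rw [frontier_Ioi] at ha
    rw [mem_singleton_iff.mp ha, hq0, smul_zero]
  have hF : ∀ ξ : ℝ, FourierTransform.fourier u ξ
      = laplace q (σ + (2 * Real.pi * ξ : ℝ) * Complex.I) := by
    intro ξ
    rw [Real.fourier_real_eq_integral_exp_smul, laplace, ← integral_indicator measurableSet_Ioi]
    congr 1; ext v
    by_cases hv : v ∈ Ioi (0 : ℝ)
    · rw [hu, indicator_of_mem hv, indicator_of_mem hv, smul_smul, ← Complex.exp_add]
      congr 2; push_cast; ring
    · rw [hu, indicator_of_notMem hv, indicator_of_notMem hv, smul_zero]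
  have hpi : (2 * Real.pi) ≠ 0 := by positivity
  have hFi : Integrable (FourierTransform.fourier u) := by
    have := hi'.comp_mul_left' hpi
    exact this.congr (ae_of_all _ fun ξ => (hF ξ).symm)
  have hinv := hui.fourierInv_fourier_eq hFi (v := t) huc.continuousAt
  rw [Real.fourierInv_eq_fourier_neg, Real.fourier_real_eq_integral_exp_smul] at hinv
  have hut : u t = Complex.exp (-(σ : ℂ) * t) • q t := by
    rcases ht.eq_or_lt with rfl | h
    · rw [hu, indicator_of_notMem (by simp), hq0, smul_zero]
    · rw [hu, indicator_of_mem (mem_Ioi.mpr h)]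
  have e := Measure.integral_comp_mul_left (fun μ : ℝ =>
    Complex.exp ((σ + μ * Complex.I) * t) • laplace q (σ + μ * Complex.I)) (2 * Real.pi)
  have hpi' : |(2 * Real.pi)⁻¹| = (2 * Real.pi)⁻¹ := abs_of_pos (by positivity)
  rw [hpi', eq_inv_smul_iff₀ hpi] at e
  rw [← e]
  congr 1
  have e2 : q t = Complex.exp ((σ : ℂ) * t) • u t := by
    rw [hut, smul_smul, ← Complex.exp_add]; simp
  rw [e2, ← hinv, ← integral_smul]
  congr 1; ext ξ
  rw [hF, smul_smul, ← Complex.exp_add]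
  congr 2; push_cast; ring

end

/-! ### The Volterra equation: a priori growth, Laplace transform, decay. -/

section

variable {V : Type*} [NormedAddCommGroup V] [NormedSpace ℂ V]

/-- `q` solves `q'' + ω² q = D * q + g` on the positive half-line, `p` being its derivative. -/
structure SolvesVolterra (ω : ℝ) (D : ℝ → V →L[ℂ] V) (g q p : ℝ → V) : Prop where
  hasDerivAt_pos : ∀ t, HasDerivAt q (p t) t
  hasDerivAt_mom : ∀ t, 0 ≤ t → HasDerivAt p
    (-((ω : ℂ) ^ 2 • q t) + (∫ s in (0 : ℝ)..t, D (t - s) (q s)) + g t) t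

lemma SolvesVolterra.continuous {ω : ℝ} {D : ℝ → V →L[ℂ] V} {g q p : ℝ → V}
    (h : SolvesVolterra ω D g q p) : Continuous q :=
  continuous_iff_continuousAt.mpr fun t => (h.hasDerivAt_pos t).continuousAt

namespace AdmissibleKernel

variable {ω : ℝ} {D : ℝ → V →L[ℂ] V} {A : ℝ} (hD : AdmissibleKernel ω D A)

include hD

lemma norm_convolution_le {q : ℝ → V} {t : ℝ} (ht : 0 ≤ t)
    {S : ℝ} (hS : ∀ s ∈ Icc 0 t, ‖q s‖ ≤ S) :
    ‖∫ s in (0 : ℝ)..t, D (t - s) (q s)‖ ≤ A * (∫ s, wt s) * S := by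
  have hA := hD.const_nonneg
  have hS0 : 0 ≤ S := (norm_nonneg _).trans (hS 0 ⟨le_rfl, ht⟩)
  rw [intervalIntegral.integral_of_le ht]
  calc _ ≤ ∫ s in Ioc 0 t, A * S * wt (t - s) := by
        refine norm_integral_le_of_norm_le (((integrable_wt_sub t).integrableOn).const_mul _) ?_
        filter_upwards [ae_restrict_mem measurableSet_Ioc] with s hs
        calc ‖D (t - s) (q s)‖ ≤ ‖D (t - s)‖ * ‖q s‖ := ContinuousLinearMap.le_opNorm _ _
          _ ≤ (A * wt (t - s)) * S := by
              gcongr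
              · have := wt_nonneg (t - s); positivity
              · exact hD.norm_le (by linarith [hs.2])
              · exact hS s ⟨hs.1.le, hs.2⟩
          _ = _ := by ring
    _ ≤ A * S * ∫ s, wt (t - s) := by
        rw [integral_const_mul]
        exact mul_le_mul_of_nonneg_left (setIntegral_le_integral (integrable_wt_sub t)
          (ae_of_all _ fun _ => wt_nonneg _)) (by positivity)
    _ = _ := by rw [integral_sub_left_eq_self wt]; ring

lemma norm_convolution_le_wt {q : ℝ → V} {t : ℝ} (ht : 0 ≤ t)
    {S : ℝ} (hS : ∀ s, 0 ≤ s → ‖q s‖ ≤ S * wt s) :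
    ‖∫ s in (0 : ℝ)..t, D (t - s) (q s)‖ ≤ A * (6 * ∫ s, wt s) * S * wt t := by
  have hA := hD.const_nonneg
  have hS0 : 0 ≤ S := nonneg_of_mul_nonneg_left ((norm_nonneg _).trans (hS 0 le_rfl)) (wt_pos 0)
  rw [intervalIntegral.integral_of_le ht]
  calc _ ≤ ∫ s in Ioc 0 t, A * S * (wt (t - s) * wt s) := by
        refine norm_integral_le_of_norm_le (((integrable_wt_mul t).integrableOn).const_mul _) ?_
        filter_upwards [ae_restrict_mem measurableSet_Ioc] with s hs
        calc ‖D (t - s) (q s)‖ ≤ ‖D (t - s)‖ * ‖q s‖ := ContinuousLinearMap.le_opNorm _ _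
          _ ≤ (A * wt (t - s)) * (S * wt s) := by
              gcongr
              · have := wt_nonneg (t - s); positivity
              · exact hD.norm_le (by linarith [hs.2])
              · exact hS s hs.1.le
          _ = _ := by ring
    _ ≤ A * S * ((6 * ∫ s, wt s) * wt t) := by
        rw [integral_const_mul]
        gcongr
        exact setIntegral_wt_mul_le t
    _ = _ := by ring

/-- Solutions of the Volterra equation grow at most exponentially. -/
lemma exists_exp_bound {g q p : ℝ → V} (h : SolvesVolterra ω D g q p) {B : ℝ}
    (hg : ∀ t, 0 ≤ t → ‖g t‖ ≤ B) :
    ∃ σ K : ℝ, 0 < σ ∧ ∀ t, 0 ≤ t → ‖q t‖ ≤ K * Real.exp (σ * t) := by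
  set a := A * ∫ s, wt s with ha
  have ha0 : 0 ≤ a := mul_nonneg hD.const_nonneg wt_integral_pos.le
  -- The factor 2 makes the Gronwall coefficient (1 + ω² + a)/σ equal to 1/2, so that S can be
  -- absorbed below.
  set σ := 2 * (1 + ω ^ 2 + a) with hσ
  have hσ2 : 2 ≤ σ := by nlinarith [sq_nonneg ω]
  have hσ0 : 0 < σ := by linarith
  have hB : 0 ≤ B := (norm_nonneg _).trans (hg 0 le_rfl)
  set M := ‖q 0‖ + ‖p 0‖ + B
  refine ⟨σ, 2 * M, hσ0, fun T hT => ?_⟩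
  have hqc : Continuous q := h.continuous
  have hpc : ContinuousOn p (Icc 0 T) := fun t ht =>
    (h.hasDerivAt_mom t ht.1).continuousAt.continuousWithinAt
  -- S is the maximum of the damped norm on [0, T]. The equation, evaluated at the maximum point,
  -- bounds S by 2M independently of T.
  obtain ⟨t₀, ht₀, hmax⟩ := isCompact_Icc.exists_isMaxOn (nonempty_Icc.mpr hT)
    (f := fun t => (‖q t‖ + ‖p t‖) * Real.exp (-(σ * t)))
    (ContinuousOn.mul (hqc.norm.continuousOn.add hpc.norm) (by fun_prop))
  set S := (‖q t₀‖ + ‖p t₀‖) * Real.exp (-(σ * t₀)) with hS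
  have hS0 : 0 ≤ S := by positivity
  have hle : ∀ t ∈ Icc 0 T, ‖q t‖ + ‖p t‖ ≤ S * Real.exp (σ * t) := fun t ht => by
    have h1 := hmax ht
    simp only [mem_ofPred_eq] at h1
    rwa [← hS, Real.exp_neg, ← div_eq_mul_inv, div_le_iff₀ (Real.exp_pos _)] at h1
  have hexp : ∀ c d t : ℝ, HasDerivAt (fun t => c + d * Real.exp (σ * t) / σ)
      (d * Real.exp (σ * t)) t := fun c d t => by
    have h1 : HasDerivAt (fun t : ℝ => σ * t) σ t := by simpa using (hasDerivAt_id t).const_mul σ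
    have h2 := ((h1.exp.const_mul d).div_const σ).const_add c
    convert! h2 using 1
    field_simp
  have hq : ∀ t ∈ Icc 0 T, ‖q t‖ ≤ ‖q 0‖ + S * Real.exp (σ * t) / σ := by
    refine image_norm_le_of_norm_deriv_right_le_deriv_boundary (f' := p)
      hqc.continuousOn (fun t _ => (h.hasDerivAt_pos t).hasDerivWithinAt) ?_ (hexp _ _) ?_
    · have : 0 ≤ S * Real.exp (σ * 0) / σ := by positivity
      linarith
    · intro t ht
      have := hle t ⟨ht.1, ht.2.le⟩
      linarith [norm_nonneg (q t)]
  have hp : ∀ t ∈ Icc 0 T, ‖p t‖ ≤ ‖p 0‖ + ((ω ^ 2 + a) * S + B) * Real.exp (σ * t) / σ := by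
    refine image_norm_le_of_norm_deriv_right_le_deriv_boundary
      hpc (fun t ht => (h.hasDerivAt_mom t ht.1).hasDerivWithinAt) ?_ (hexp _ _) ?_
    · have : 0 ≤ ((ω ^ 2 + a) * S + B) * Real.exp (σ * 0) / σ := by positivity
      linarith
    · intro t ht
      have h1 := hle t ⟨ht.1, ht.2.le⟩
      have h2 : ‖∫ s in (0 : ℝ)..t, D (t - s) (q s)‖ ≤ a * (S * Real.exp (σ * t)) := by
        refine hD.norm_convolution_le ht.1 fun s hs => ?_
        have h3 := hle s ⟨hs.1, hs.2.trans ht.2.le⟩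
        have h4 : Real.exp (σ * s) ≤ Real.exp (σ * t) := by gcongr; exact hs.2
        nlinarith [norm_nonneg (p s)]
      have h3 : (1 : ℝ) ≤ Real.exp (σ * t) := Real.one_le_exp (by have := ht.1; positivity)
      calc _ ≤ ‖(ω : ℂ) ^ 2 • q t‖ + ‖∫ s in (0 : ℝ)..t, D (t - s) (q s)‖ + ‖g t‖ := by
            refine (norm_add₃_le).trans ?_
            rw [norm_neg]
        _ ≤ ω ^ 2 * (S * Real.exp (σ * t)) + a * (S * Real.exp (σ * t)) + B * Real.exp (σ * t) := by
            gcongr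
            · rw [norm_smul, norm_pow, Complex.norm_real, Real.norm_eq_abs, sq_abs]
              gcongr
              linarith [norm_nonneg (p t)]
            · exact (hg t ht.1).trans (le_mul_of_one_le_right hB h3)
        _ = _ := by ring
  have hS2 : S ≤ 2 * M := by
    have h1 := hq t₀ ht₀
    have h2 := hp t₀ ht₀
    have h3 : (1 : ℝ) ≤ Real.exp (σ * t₀) := Real.one_le_exp (by have := ht₀.1; positivity)
    have h4 : (‖q t₀‖ + ‖p t₀‖) = S * Real.exp (σ * t₀) := by
      rw [hS, mul_assoc, ← Real.exp_add]; simp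
    have h5 : ‖q t₀‖ + ‖p t₀‖ ≤ ‖q 0‖ + ‖p 0‖ + (S / 2 + B / 2) * Real.exp (σ * t₀) := by
      calc ‖q t₀‖ + ‖p t₀‖
          ≤ ‖q 0‖ + ‖p 0‖ + ((1 + ω ^ 2 + a) * S + B) * Real.exp (σ * t₀) / σ := by
            refine (add_le_add h1 h2).trans (le_of_eq ?_); ring
        _ ≤ _ := by
            have : ((1 + ω ^ 2 + a) * S + B) / σ ≤ S / 2 + B / 2 := by
              rw [div_le_iff₀ hσ0, hσ]; nlinarith
            rw [mul_div_right_comm]; gcongr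
    have h6 : 0 ≤ ‖q 0‖ + ‖p 0‖ := by positivity
    by_contra hcon
    push Not at hcon
    have h7 : (M * 2) * Real.exp (σ * t₀) < S * Real.exp (σ * t₀) := by nlinarith
    have h8 : ‖q 0‖ + ‖p 0‖ ≤ (‖q 0‖ + ‖p 0‖) * Real.exp (σ * t₀) :=
      le_mul_of_one_le_right h6 h3
    nlinarith [mul_nonneg hB (Real.exp_pos (σ * t₀)).le]
  have := hle T ⟨hT, le_rfl⟩
  have h9 : S * Real.exp (σ * T) ≤ 2 * M * Real.exp (σ * T) := by gcongr
  linarith [norm_nonneg (p T)]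

end AdmissibleKernel

end

section

variable {V : Type*} [NormedAddCommGroup V] [NormedSpace ℂ V]

lemma integrableOn_laplace_of_exp_bound {q : ℝ → V} {σ K : ℝ} (hqc : ContinuousOn q (Ici 0))
    (hb : ∀ t, 0 ≤ t → ‖q t‖ ≤ K * Real.exp (σ * t)) {z : ℂ} (hz : σ < z.re) :
    IntegrableOn (fun t : ℝ => Complex.exp (-z * t) • q t) (Ioi 0) := by
  have h1 : IntegrableOn (fun t : ℝ => K * Real.exp (-(z.re - σ) * t)) (Ioi 0) :=
    (exp_neg_integrableOn_Ioi 0 (sub_pos.mpr hz)).const_mul K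
  refine h1.mono' ?_ ?_
  · refine ((ContinuousOn.smul (by fun_prop) hqc).mono
      Ioi_subset_Ici_self).aestronglyMeasurable measurableSet_Ioi
  · filter_upwards [ae_restrict_mem measurableSet_Ioi] with t ht
    rw [norm_smul, norm_cexp_neg_mul]
    calc _ ≤ Real.exp (-z.re * t) * (K * Real.exp (σ * t)) := by
          gcongr; exact hb t (le_of_lt ht)
      _ = _ := by rw [mul_left_comm, ← Real.exp_add]; ring_nf

lemma tendsto_exp_smul_of_exp_bound {q : ℝ → V} {σ K : ℝ}
    (hb : ∀ t, 0 ≤ t → ‖q t‖ ≤ K * Real.exp (σ * t)) {z : ℂ} (hz : σ < z.re) :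
    Tendsto (fun t : ℝ => Complex.exp (-z * t) • q t) atTop (𝓝 0) := by
  have h1 : Tendsto (fun t : ℝ => K * Real.exp (-((z.re - σ) * t))) atTop (𝓝 (K * 0)) :=
    (Real.tendsto_exp_neg_atTop_nhds_zero.comp
      (tendsto_id.const_mul_atTop (sub_pos.mpr hz))).const_mul K
  rw [mul_zero] at h1
  refine squeeze_zero_norm' ?_ h1
  filter_upwards [eventually_ge_atTop 0] with t ht
  rw [norm_smul, norm_cexp_neg_mul]
  calc _ ≤ Real.exp (-z.re * t) * (K * Real.exp (σ * t)) := by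
        gcongr; exact hb t ht
    _ = _ := by rw [mul_left_comm, ← Real.exp_add]; ring_nf

namespace AdmissibleKernel

variable {ω : ℝ} {D : ℝ → V →L[ℂ] V} {A : ℝ} (hD : AdmissibleKernel ω D A)

include hD

variable [CompleteSpace V]

lemma laplace_convolution {q : ℝ → V} {z : ℂ} (hz : 0 ≤ z.re)
    (hq : IntegrableOn (fun t : ℝ => Complex.exp (-z * t) • q t) (Ioi 0)) :
    IntegrableOn (fun t : ℝ => Complex.exp (-z * t) • ∫ s in (0 : ℝ)..t, D (t - s) (q s)) (Ioi 0) ∧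
    laplace (fun t => ∫ s in (0 : ℝ)..t, D (t - s) (q s)) z = laplace D z (laplace q z) := by
  -- The pairing (v, T) ↦ T v, regarded as real bilinear as the convolution theorem on the half-line
  -- requires. The exponential splits as exp(-zs) exp(-z(t - s)) between its two arguments.
  let L : V →L[ℝ] (V →L[ℂ] V) →L[ℝ] V :=
    (ContinuousLinearMap.apply ℂ V : V →L[ℂ] (V →L[ℂ] V) →L[ℂ] V).bilinearRestrictScalars ℝ
  have hDz := integrableOn_laplace hD.integrableOn hz
  have e : ∀ t : ℝ, (∫ s in (0 : ℝ)..t,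
      L (Complex.exp (-z * s) • q s) (Complex.exp (-z * (t - s : ℝ)) • D (t - s)))
      = Complex.exp (-z * t) • ∫ s in (0 : ℝ)..t, D (t - s) (q s) := by
    intro t
    rw [← intervalIntegral.integral_smul]
    congr 1; ext s
    change (Complex.exp (-z * (t - s : ℝ)) • D (t - s)) (Complex.exp (-z * s) • q s) = _
    rw [smul_apply, map_smul, smul_smul, ← Complex.exp_add]
    congr 2; push_cast; ring
  constructor
  · have := integrable_posConvolution hq hDz L
    rw [posConvolution, integrable_indicator_iff measurableSet_Ioi] at this
    exact this.congr_fun (fun t _ => e t) measurableSet_Ioi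
  · have := integral_posConvolution hq hDz L
    simp_rw [e] at this
    exact this

/-- The equation is transformed without boundary terms: those at 0 vanish by the zero data, those at
infinity because Re z exceeds the exponential rate. -/
lemma symbol_laplace {g q p : ℝ → V} (h : SolvesVolterra ω D g q p) (hq0 : q 0 = 0)
    (hp0 : p 0 = 0) (hgi : IntegrableOn g (Ioi 0)) {B σ K : ℝ}
    (hg : ∀ t, 0 ≤ t → ‖g t‖ ≤ B) (hσ : 0 < σ)
    (hK : ∀ t, 0 ≤ t → ‖q t‖ ≤ K * Real.exp (σ * t)) {z : ℂ} (hz : σ < z.re) :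
    symbol ω D z (laplace q z) = laplace g z := by
  have hqc := h.continuous
  have hz0 : 0 ≤ z.re := by linarith
  have hqi := integrableOn_laplace_of_exp_bound hqc.continuousOn hK hz
  obtain ⟨hci, hce⟩ := hD.laplace_convolution hz0 hqi
  have hgi' := integrableOn_laplace hgi hz0
  have ha : 0 ≤ A * ∫ s, wt s := mul_nonneg hD.const_nonneg wt_integral_pos.le
  have hK0 : 0 ≤ K := nonneg_of_mul_nonneg_left ((norm_nonneg _).trans (hK 0 le_rfl))
    (Real.exp_pos _)
  have hB : 0 ≤ B := (norm_nonneg _).trans (hg 0 le_rfl)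
  -- exponential bound for the momentum
  obtain ⟨K', hK'⟩ : ∃ K', ∀ t, 0 ≤ t → ‖p t‖ ≤ K' * Real.exp (σ * t) := by
    set K₂ := ω ^ 2 * K + (A * ∫ s, wt s) * K + B with hK₂
    have hK₂0 : 0 ≤ K₂ := by positivity
    refine ⟨K₂ / σ, fun T hT => ?_⟩
    have hexp : ∀ t : ℝ, HasDerivAt (fun t => K₂ / σ * Real.exp (σ * t))
        (K₂ * Real.exp (σ * t)) t := fun t => by
      have h1 : HasDerivAt (fun t : ℝ => σ * t) σ t := by simpa using (hasDerivAt_id t).const_mul σ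
      have h2 := h1.exp.const_mul (K₂ / σ)
      convert! h2 using 1
      field_simp
    refine image_norm_le_of_norm_deriv_right_le_deriv_boundary (a := 0) (b := T)
      (fun t ht => (h.hasDerivAt_mom t ht.1).continuousAt.continuousWithinAt)
      (fun t ht => (h.hasDerivAt_mom t ht.1).hasDerivWithinAt) ?_ hexp ?_ ⟨hT, le_rfl⟩
    · rw [hp0, norm_zero]; positivity
    · intro t ht
      have h2 : ‖∫ s in (0 : ℝ)..t, D (t - s) (q s)‖
          ≤ (A * ∫ s, wt s) * (K * Real.exp (σ * t)) := by
        refine hD.norm_convolution_le ht.1 fun s hs => (hK s hs.1).trans ?_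
        gcongr; exact hs.2
      have h3 : (1 : ℝ) ≤ Real.exp (σ * t) := Real.one_le_exp (by have := ht.1; positivity)
      calc _ ≤ ‖(ω : ℂ) ^ 2 • q t‖ + ‖∫ s in (0 : ℝ)..t, D (t - s) (q s)‖ + ‖g t‖ := by
            refine (norm_add₃_le).trans ?_
            rw [norm_neg]
        _ ≤ ω ^ 2 * (K * Real.exp (σ * t)) + (A * ∫ s, wt s) * (K * Real.exp (σ * t))
            + B * Real.exp (σ * t) := by
            refine add_le_add (add_le_add ?_ h2) ?_
            · rw [norm_smul, norm_pow, Complex.norm_real, Real.norm_eq_abs, sq_abs]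
              gcongr
              exact hK t ht.1
            · exact (hg t ht.1).trans (le_mul_of_one_le_right hB h3)
        _ = _ := by rw [hK₂]; ring
  -- In the derivative of exp(-zt)(p + z q) the terms in p cancel, leaving exp(-zt)(p' - z² q), into
  -- which the equation is substituted.
  have hder : ∀ t : ℝ, 0 ≤ t → HasDerivAt (fun t : ℝ => Complex.exp (-z * t) • (p t + z • q t))
      (Complex.exp (-z * t) • (∫ s in (0 : ℝ)..t, D (t - s) (q s)) + Complex.exp (-z * t) • g t
        - (z ^ 2 + (ω : ℂ) ^ 2) • Complex.exp (-z * t) • q t) t := by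
    intro t ht
    have h1 : HasDerivAt (fun t : ℝ => -z * (t : ℂ)) (-z) t := by
      simpa using (Complex.ofRealCLM.hasDerivAt (x := t)).const_mul (-z)
    have h2 := h1.cexp.smul ((h.hasDerivAt_mom t ht).add ((h.hasDerivAt_pos t).const_smul z))
    convert! h2 using 1
    simp only [Pi.add_apply, Pi.smul_apply]
    module
  have hint := integral_Ioi_of_hasDerivAt_of_tendsto' (a := 0) (m := 0)
    (fun t ht => hder t ht)
    (((hci.add hgi').sub (hqi.smul (z ^ 2 + (ω : ℂ) ^ 2)))) (by
      have h1 := tendsto_exp_smul_of_exp_bound hK' hz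
      have h2 := (tendsto_exp_smul_of_exp_bound hK hz).const_smul z
      have h3 := h1.add h2
      simp only [smul_zero, add_zero] at h3
      refine h3.congr fun t => ?_
      rw [smul_add, smul_comm])
  rw [hq0, hp0, smul_zero, add_zero, smul_zero, sub_zero] at hint
  replace hint := (integral_sub (hci.add hgi') (hqi.smul (z ^ 2 + (ω : ℂ) ^ 2))).symm.trans hint
  rw [integral_add' hci hgi', show ∫ t in Ioi (0 : ℝ), ((z ^ 2 + (ω : ℂ) ^ 2) •
    fun t : ℝ => Complex.exp (-z * t) • q t) t = (z ^ 2 + (ω : ℂ) ^ 2) • laplace q z from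
    integral_smul _ _] at hint
  change laplace _ z + laplace g z - (z ^ 2 + (ω : ℂ) ^ 2) • laplace q z = 0 at hint
  rw [hce] at hint
  rw [symbol, sub_apply, smul_apply, one_apply_eq_self,
    ← sub_eq_zero, ← neg_eq_zero, ← hint]
  abel

end AdmissibleKernel

end

section

variable {V : Type*} [NormedAddCommGroup V] [NormedSpace ℂ V] [CompleteSpace V]

namespace AdmissibleKernel

variable {ω : ℝ} {D : ℝ → V →L[ℂ] V} {A : ℝ} (hD : AdmissibleKernel ω D A)

include hD

/-- The solution with zero initial data is the convolution of the source with `greenKernel`. -/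
lemma eq_integral_greenKernel {g q p : ℝ → V} (h : SolvesVolterra ω D g q p) (hq0 : q 0 = 0)
    (hp0 : p 0 = 0) {B : ℝ} (hgc : Continuous g) (hg : ∀ t, 0 ≤ t → ‖g t‖ ≤ B * wt t)
    {t : ℝ} (ht : 0 ≤ t) :
    (2 * Real.pi) • q t = ∫ s in Ioi (0 : ℝ), greenKernel ω D (t - s) (g s) := by
  have hB : 0 ≤ B := nonneg_of_mul_nonneg_left ((norm_nonneg _).trans (hg 0 le_rfl)) (wt_pos 0)
  have hg1 : ∀ t, 0 ≤ t → ‖g t‖ ≤ B := fun t ht =>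
    (hg t ht).trans (mul_le_of_le_one_right hB (wt_le_one t))
  have hgi : IntegrableOn g (Ioi 0) := by
    refine (integrable_wt.integrableOn.const_mul B).mono' hgc.aestronglyMeasurable ?_
    filter_upwards [ae_restrict_mem measurableSet_Ioi] with t ht using hg t (le_of_lt ht)
  obtain ⟨σ₀, K, hσ₀, hK⟩ := hD.exists_exp_bound h hg1
  obtain ⟨C, hC0, hC⟩ := hD.exists_norm_resolvent_le
  set σ := σ₀ + 1 with hσ
  have hσ0 : 0 < σ := by linarith
  set G := laplace g with hG
  set b := ∫ t in Ioi (0 : ℝ), ‖g t‖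
  have hb0 : 0 ≤ b := integral_nonneg fun _ => norm_nonneg _
  have hGb : ∀ z : ℂ, 0 ≤ z.re → ‖G z‖ ≤ b := fun z hz => norm_laplace_le hgi hz
  have hQ : ∀ z : ℂ, σ₀ < z.re → laplace q z = resolvent ω D z (G z) := by
    intro z hz
    have h1 := hD.symbol_laplace h hq0 hp0 hgi hg1 hσ₀ hK hz
    rw [hG, ← h1, ← mul_apply_eq_comp, hD.resolvent_mul_symbol (by linarith),
      one_apply_eq_self]
  have hRGc : ContinuousOn (fun z => resolvent ω D z (G z)) {z | 0 ≤ z.re} :=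
    hD.continuousOn_resolvent.clm_apply (continuousOn_laplace hgi)
  have hRGb : ∀ z : ℂ, 0 ≤ z.re → ‖resolvent ω D z (G z)‖ ≤ C * b * (1 + z.im ^ 2)⁻¹ := by
    intro z hz
    have h1 : z.im ^ 2 ≤ ‖z‖ ^ 2 := by
      rw [← sq_abs]; gcongr; exact Complex.abs_im_le_norm z
    calc _ ≤ ‖resolvent ω D z‖ * ‖G z‖ := ContinuousLinearMap.le_opNorm _ _
      _ ≤ (C * (1 + z.im ^ 2)⁻¹) * b := by
          gcongr
          · refine (hC z hz).trans ?_
            gcongr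
          · exact hGb z hz
      _ = _ := by ring
  have hσre : ∀ μ : ℝ, ((σ : ℂ) + μ * Complex.I).re = σ := fun μ => by simp
  have hinv := laplace_inversion h.continuous hq0 (σ := σ)
    (integrableOn_laplace_of_exp_bound h.continuous.continuousOn hK (by simp [hσ])) ?_ ht
  swap
  · refine ((integrable_inv_one_add_sq.const_mul (C * b)).mono' (f := fun μ : ℝ =>
      resolvent ω D (σ + μ * Complex.I) (G (σ + μ * Complex.I))) ?_
      (ae_of_all _ fun μ => ?_)).congr (ae_of_all _ fun μ => ?_)
    · exact (hRGc.comp_continuous (by fun_prop) (fun μ => by simp [hσ0.le])).aestronglyMeasurable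
    · simpa using hRGb (σ + μ * Complex.I) (by simp [hσ0.le])
    · exact (hQ _ (by rw [hσre]; linarith)).symm
  rw [hinv]
  -- The inversion line can be moved to Re z = 0: the resolvent decays quadratically up to the
  -- boundary and ĝ is bounded there.
  have hshift := integral_vertical_eq (σ := σ) (C := Real.exp (σ * t) * (C * b))
    (Φ := fun z => Complex.exp (z * t) • resolvent ω D z (G z)) hσ0
    (ContinuousOn.smul (by fun_prop) hRGc) ?_ ?_
  rotate_left
  · intro z hz
    refine DifferentiableAt.fun_smul (by fun_prop) ?_
    exact (hD.differentiableAt_resolvent hz).clm_apply (differentiableAt_laplace hgi hz)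
  · intro z hz hzσ
    rw [norm_smul, Complex.norm_exp, mul_assoc]
    gcongr
    · simp only [Complex.mul_re, Complex.ofReal_re, Complex.ofReal_im, mul_zero, sub_zero]
      gcongr
    · exact hRGb z hz
  calc _ = ∫ μ : ℝ, Complex.exp ((σ + μ * Complex.I) * t) •
        resolvent ω D (σ + μ * Complex.I) (G (σ + μ * Complex.I)) := by
        congr 1; ext μ; rw [hQ _ (by rw [hσre]; linarith)]
    _ = ∫ μ : ℝ, Complex.exp (μ * Complex.I * t) •
        resolvent ω D (μ * Complex.I) (G (μ * Complex.I)) := hshift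
    _ = ∫ μ : ℝ, ∫ s in Ioi (0 : ℝ), Complex.exp (Complex.I * μ * ((t - s : ℝ) : ℂ)) •
        resolvent ω D (Complex.I * μ) (g s) := by
        congr 1; ext μ
        have hi : IntegrableOn (fun s : ℝ => Complex.exp (-(μ * Complex.I) * s) • g s) (Ioi 0) :=
          integrableOn_laplace hgi (by simp)
        rw [hG, laplace, ← ContinuousLinearMap.integral_comp_comm _ hi, ← integral_smul]
        congr 1; ext s
        rw [map_smul, smul_smul, ← Complex.exp_add, mul_comm (μ : ℂ)]
        congr 2; push_cast; ring
    _ = ∫ s in Ioi (0 : ℝ), ∫ μ : ℝ, Complex.exp (Complex.I * μ * ((t - s : ℝ) : ℂ)) •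
        resolvent ω D (Complex.I * μ) (g s) := by
        refine integral_integral_swap ?_
        have h1 := (hD.integrable_resolvent_imag.norm).mul_prod (ν := volume.restrict (Ioi 0))
          hgi.norm
        refine h1.mono' ?_ (ae_of_all _ fun x => ?_)
        · have hc : Continuous fun x : ℝ × ℝ =>
              Complex.exp (Complex.I * x.1 * ((t - x.2 : ℝ) : ℂ)) := by fun_prop
          exact (hc.smul ((hD.continuous_resolvent_imag.comp continuous_fst).clm_apply
            (hgc.comp continuous_snd))).aestronglyMeasurable
        · rw [Function.uncurry_def, norm_smul, Complex.norm_exp]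
          simp only [Complex.mul_re, Complex.I_re, Complex.ofReal_re, zero_mul, Complex.I_im,
            Complex.ofReal_im, mul_zero, sub_zero, Complex.mul_im, Real.exp_zero, one_mul]
          exact ContinuousLinearMap.le_opNorm _ _
    _ = _ := by
        congr 1; ext s
        have hi : Integrable fun μ : ℝ => Complex.exp (Complex.I * μ * ((t - s : ℝ) : ℂ)) •
            resolvent ω D (Complex.I * μ) := by
          refine hD.integrable_resolvent_imag.norm.mono' ?_ (ae_of_all _ fun μ => ?_)
          · have hc : Continuous fun μ : ℝ =>
              Complex.exp (Complex.I * μ * ((t - s : ℝ) : ℂ)) := by fun_prop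
            exact (hc.smul hD.continuous_resolvent_imag).aestronglyMeasurable
          · rw [norm_smul, Complex.norm_exp]; simp
        rw [greenKernel, ContinuousLinearMap.integral_apply hi]
        rfl

/-- The bound on `greenKernel` holds for both signs of its argument, so the part s > t of the
representation needs no causality argument. Stability of `wt` under convolution concludes. -/
lemma norm_le_of_zero_data : ∃ K, 0 < K ∧ ∀ (g q p : ℝ → V) (B : ℝ),
    SolvesVolterra ω D g q p → q 0 = 0 → p 0 = 0 → Continuous g →
    (∀ t, 0 ≤ t → ‖g t‖ ≤ B * wt t) → ∀ t, 0 ≤ t → ‖q t‖ ≤ K * B * wt t := by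
  obtain ⟨K, hK0, hK⟩ := hD.exists_norm_greenKernel_le
  have hI := wt_integral_pos
  refine ⟨K * (6 * ∫ s, wt s), by positivity, fun g q p B h hq0 hp0 hgc hg t ht => ?_⟩
  have hB : 0 ≤ B := nonneg_of_mul_nonneg_left ((norm_nonneg _).trans (hg 0 le_rfl)) (wt_pos 0)
  have h1 := hD.eq_integral_greenKernel h hq0 hp0 hgc hg ht
  have h2 : (2 * Real.pi) * ‖q t‖ = ‖∫ s in Ioi (0 : ℝ), greenKernel ω D (t - s) (g s)‖ := by
    rw [← h1, norm_smul, Real.norm_of_nonneg (by positivity)]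
  have h3 : ‖q t‖ ≤ (2 * Real.pi) * ‖q t‖ := by
    nlinarith [Real.pi_gt_three, norm_nonneg (q t)]
  refine h3.trans (h2.le.trans ?_)
  calc _ ≤ ∫ s in Ioi (0 : ℝ), K * B * (wt (t - s) * wt s) := by
        refine norm_integral_le_of_norm_le ((integrable_wt_mul t).integrableOn.const_mul _) ?_
        filter_upwards [ae_restrict_mem measurableSet_Ioi] with s hs
        calc _ ≤ ‖greenKernel ω D (t - s)‖ * ‖g s‖ := ContinuousLinearMap.le_opNorm _ _
          _ ≤ (K * wt (t - s)) * (B * wt s) := by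
              gcongr
              · have := wt_nonneg (t - s); positivity
              · exact hK _
              · exact hg s (le_of_lt hs)
          _ = _ := by ring
    _ ≤ K * B * ((6 * ∫ s, wt s) * wt t) := by
        rw [integral_const_mul]
        exact mul_le_mul_of_nonneg_left (setIntegral_wt_mul_le t) (by positivity)
    _ = _ := by ring

end AdmissibleKernel

end

/-- From (1 + t)³/3! ≤ exp(1 + t) ≤ 3 exp t, whence the constant 18. -/
lemma exp_neg_mul_le_wt {t : ℝ} (ht : 0 ≤ t) : Real.exp (-t) * (1 + t) ≤ 18 * wt t := by
  rw [wt_eq, abs_of_nonneg ht, ← div_eq_mul_inv, le_div_iff₀ (by positivity)]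
  have h1 : √(1 + t) ≤ 1 + t := by
    rw [Real.sqrt_le_left (by positivity)]; nlinarith
  have h2 := Real.pow_div_factorial_le_exp (1 + t) (by positivity) 3
  have h3 : Real.exp (1 + t) ≤ 3 * Real.exp t := by
    rw [Real.exp_add]; gcongr; exact Real.exp_one_lt_three.le
  have h4 : (1 + t) ^ 3 ≤ 18 * Real.exp t := by
    norm_num [Nat.factorial] at h2; linarith
  calc _ ≤ Real.exp (-t) * (1 + t) * ((1 + t) * (1 + t)) := by gcongr
    _ = Real.exp (-t) * (1 + t) ^ 3 := by ring
    _ ≤ Real.exp (-t) * (18 * Real.exp t) := by gcongr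
    _ = 18 := by rw [mul_left_comm, ← Real.exp_add]; simp

section

variable {V : Type*} [NormedAddCommGroup V] [NormedSpace ℂ V]

lemma hasDerivAt_exp_neg_smul (a w : V) (t : ℝ) :
    HasDerivAt (fun t : ℝ => Real.exp (-t) • (a + t • w)) (Real.exp (-t) • ((w - a) - t • w)) t := by
  have h1 : HasDerivAt (fun t : ℝ => Real.exp (-t)) (-Real.exp (-t)) t := by
    simpa using (hasDerivAt_neg t).exp
  have h2 := h1.smul (((hasDerivAt_id t).smul_const w).const_add a)
  convert! h2 using 1
  simp only [id]
  module

lemma norm_exp_neg_smul_le {a w : V} {N : ℝ} (ha : ‖a‖ ≤ N) (hw : ‖w‖ ≤ N) {t : ℝ} (ht : 0 ≤ t) :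
    ‖Real.exp (-t) • (a + t • w)‖ ≤ 18 * N * wt t := by
  have hN : 0 ≤ N := (norm_nonneg _).trans ha
  rw [norm_smul, Real.norm_of_nonneg (Real.exp_pos _).le]
  calc _ ≤ Real.exp (-t) * (N + t * N) := by
        gcongr
        refine (norm_add_le _ _).trans (add_le_add ha ?_)
        rw [norm_smul, Real.norm_of_nonneg ht]; gcongr
    _ = N * (Real.exp (-t) * (1 + t)) := by ring
    _ ≤ N * (18 * wt t) := mul_le_mul_of_nonneg_left (exp_neg_mul_le_wt ht) hN
    _ = _ := by ring

variable [CompleteSpace V]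

/-- Solutions of a Volterra equation with admissible kernel inherit the decay of the source. -/
theorem AdmissibleKernel.exists_decay {ω : ℝ} {D : ℝ → V →L[ℂ] V} {A : ℝ}
    (hD : AdmissibleKernel ω D A) : ∃ C, 0 < C ∧ ∀ (g q p : ℝ → V) (B : ℝ),
    SolvesVolterra ω D g q p → Continuous g → (∀ t, 0 ≤ t → ‖g t‖ ≤ B * wt t) →
      ∀ t, 0 ≤ t → ‖q t‖ + ‖p t‖ ≤ C * (B + ‖q 0‖ + ‖p 0‖) * wt t := by
  obtain ⟨K, hK0, hK⟩ := hD.norm_le_of_zero_data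
  set J := A * (6 * ∫ s, wt s) with hJ
  have hJ0 : 0 ≤ J := by
    have := hD.const_nonneg
    have := wt_integral_pos
    positivity
  set c := 36 * (1 + ω ^ 2 + J) with hc
  have hc0 : 0 < c := by positivity
  set Cq := K * (1 + c) + 36 with hCq
  have hCq0 : 0 < Cq := by positivity
  refine ⟨3 * Cq + ((ω ^ 2 + J) * Cq + 1), by positivity, fun g q p B h hgc hg => ?_⟩
  have hB : 0 ≤ B := nonneg_of_mul_nonneg_left ((norm_nonneg _).trans (hg 0 le_rfl)) (wt_pos 0)
  set N := ‖q 0‖ + ‖p 0‖ with hN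
  have hN0 : 0 ≤ N := by positivity
  -- With this w the function exp(-t)(q(0) + t w) has value q(0) and derivative p(0) at 0.
  -- Subtracting it produces zero data, at the price of a modified source of the same decay.
  set w := p 0 + q 0
  have hw : ‖w‖ ≤ N := (norm_add_le _ _).trans (by rw [hN, add_comm])
  set q₁ : ℝ → V := fun t => Real.exp (-t) • (q 0 + t • w) with hq₁
  set p₁ : ℝ → V := fun t => Real.exp (-t) • ((w - q 0) - t • w) with hp₁
  set r₁ : ℝ → V := fun t => Real.exp (-t) • ((q 0 - 2 • w) + t • w) with hr₁
  have hq₁d : ∀ t, HasDerivAt q₁ (p₁ t) t := hasDerivAt_exp_neg_smul _ _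
  have hp₁d : ∀ t, HasDerivAt p₁ (r₁ t) t := fun t => by
    convert! hasDerivAt_exp_neg_smul (w - q 0) (-w) t using 1
    · ext t; simp only [hp₁]; module
    · simp only [hr₁]; module
  have hq₁b : ∀ t, 0 ≤ t → ‖q₁ t‖ ≤ 36 * N * wt t := fun t ht => by
    have := norm_exp_neg_smul_le (a := q 0) (w := w) (N := N)
      (by rw [hN]; linarith [norm_nonneg (p 0)]) hw ht
    have := mul_nonneg hN0 (wt_nonneg t)
    linarith
  have hr₁b : ∀ t, 0 ≤ t → ‖r₁ t‖ ≤ 36 * N * wt t := fun t ht => by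
    have := norm_exp_neg_smul_le (a := q 0 - 2 • w) (w := w) (N := 2 * N) (by
      rw [show q 0 - 2 • w = -(p 0 + w) by simp only [w]; module, norm_neg]
      refine (norm_add_le _ _).trans ?_
      rw [two_mul]; refine add_le_add ?_ hw
      rw [hN]; linarith [norm_nonneg (q 0)]) (by linarith) ht
    linarith
  have hq₁c : Continuous q₁ := by fun_prop
  set g₂ : ℝ → V := fun t => g t - r₁ t - (ω : ℂ) ^ 2 • q₁ t +
    ∫ s in (0 : ℝ)..t, D (t - s) (q₁ s) with hg₂
  have hconv : ∀ {u : ℝ → V}, Continuous u → ∀ t, IntervalIntegrable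
      (fun s => D (t - s) (u s)) volume 0 t := fun hu t =>
    ((hD.continuous.comp (by fun_prop)).clm_apply hu).intervalIntegrable _ _
  have hg₂c : Continuous g₂ := by
    refine Continuous.add (by fun_prop) ?_
    refine intervalIntegral.continuous_parametric_intervalIntegral_of_continuous ?_ continuous_id
    exact (hD.continuous.comp (by fun_prop)).clm_apply (hq₁c.comp continuous_snd)
  have hg₂b : ∀ t, 0 ≤ t → ‖g₂ t‖ ≤ (B + c * N) * wt t := fun t ht => by
    have h1 := hD.norm_convolution_le_wt ht hq₁b
    calc _ ≤ ‖g t‖ + ‖r₁ t‖ + ‖(ω : ℂ) ^ 2 • q₁ t‖ + ‖∫ s in (0 : ℝ)..t, D (t - s) (q₁ s)‖ := by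
          refine (norm_add_le _ _).trans (add_le_add_left ?_ _)
          exact (norm_sub_le _ _).trans (add_le_add_left (norm_sub_le _ _) _)
      _ ≤ B * wt t + 36 * N * wt t + ω ^ 2 * (36 * N * wt t) + J * (36 * N) * wt t := by
          refine add_le_add (add_le_add (add_le_add (hg t ht) (hr₁b t ht)) ?_) h1
          rw [norm_smul, norm_pow, Complex.norm_real, Real.norm_eq_abs, sq_abs]
          exact mul_le_mul_of_nonneg_left (hq₁b t ht) (sq_nonneg _)
      _ = _ := by rw [hc]; ring
  have h₂ : SolvesVolterra ω D g₂ (fun t => q t - q₁ t) (fun t => p t - p₁ t) := by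
    refine ⟨fun t => (h.hasDerivAt_pos t).sub (hq₁d t), fun t ht => ?_⟩
    convert! (h.hasDerivAt_mom t ht).sub (hp₁d t) using 1
    simp only [map_sub]
    rw [intervalIntegral.integral_sub (hconv h.continuous t) (hconv hq₁c t), smul_sub]
    have e : g₂ t = g t - r₁ t - (ω : ℂ) ^ 2 • q₁ t + ∫ s in (0 : ℝ)..t, D (t - s) (q₁ s) := rfl
    rw [e]
    module
  have hq : ∀ t, 0 ≤ t → ‖q t‖ ≤ Cq * (B + N) * wt t := fun t ht => by
    have h1 := hK g₂ _ _ _ h₂ (by simp [hq₁]) (by simp [hp₁, w]) hg₂c hg₂b t ht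
    have h2 : ‖q t‖ ≤ ‖q t - q₁ t‖ + ‖q₁ t‖ := by simpa using norm_add_le (q t - q₁ t) (q₁ t)
    have h3 := hq₁b t ht
    calc ‖q t‖ ≤ (K * (B + c * N) + 36 * N) * wt t := by linarith
      _ ≤ _ := by
        refine mul_le_mul_of_nonneg_right ?_ (wt_nonneg t)
        rw [hCq]
        have := mul_nonneg hK0.le hN0
        have := mul_nonneg (mul_nonneg hK0.le hc0.le) hB
        nlinarith
  set E := ((ω ^ 2 + J) * Cq + 1) * (B + N) with hE
  have hp' : ∀ t, 0 ≤ t → ‖-((ω : ℂ) ^ 2 • q t) + (∫ s in (0 : ℝ)..t, D (t - s) (q s)) + g t‖ ≤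
      E * wt t := fun t ht => by
    have h1 := hD.norm_convolution_le_wt ht hq
    calc _ ≤ ‖(ω : ℂ) ^ 2 • q t‖ + ‖∫ s in (0 : ℝ)..t, D (t - s) (q s)‖ + ‖g t‖ := by
          refine (norm_add₃_le).trans ?_
          rw [norm_neg]
      _ ≤ ω ^ 2 * (Cq * (B + N) * wt t) + J * (Cq * (B + N)) * wt t + B * wt t := by
          refine add_le_add (add_le_add ?_ h1) (hg t ht)
          rw [norm_smul, norm_pow, Complex.norm_real, Real.norm_eq_abs, sq_abs]
          exact mul_le_mul_of_nonneg_left (hq t ht) (sq_nonneg _)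
      _ ≤ _ := by
          rw [hE]
          have := mul_nonneg hN0 (wt_nonneg t)
          linarith
  have hE0 : 0 ≤ E := by positivity
  intro t ht
  -- The momentum varies by at most E `wt t` on [t, t + 1], so it is close to the difference
  -- quotient q(t + 1) - q(t), whose decay is known.
  have hpt : ∀ θ ∈ Icc t (t + 1), ‖p θ - p t‖ ≤ E * wt t := fun θ hθ => by
    have := (convex_Icc t (t + 1)).norm_image_sub_le_of_norm_hasDerivWithin_le
      (fun x hx => (h.hasDerivAt_mom x (ht.trans hx.1)).hasDerivWithinAt) (C := E * wt t)
      (fun x hx => (hp' x (ht.trans hx.1)).trans ?_) (left_mem_Icc.mpr (by linarith)) hθ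
    · refine this.trans (mul_le_of_le_one_right (mul_nonneg hE0 (wt_nonneg t)) ?_)
      rw [Real.norm_of_nonneg (by linarith [hθ.1])]; linarith [hθ.2]
    · have : wt x ≤ wt t := wt_anti (by
        rw [abs_of_nonneg ht, abs_of_nonneg (ht.trans hx.1)]; exact hx.1)
      gcongr
  have hpq : ‖p t‖ ≤ ‖q (t + 1)‖ + ‖q t‖ + E * wt t := by
    have := (convex_Icc t (t + 1)).norm_image_sub_le_of_norm_hasDerivWithin_le
      (f := fun θ => q θ - θ • p t)
      (fun x _ => ((h.hasDerivAt_pos x).sub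
        ((hasDerivAt_id x).smul_const (p t))).hasDerivWithinAt) (C := E * wt t)
      (fun x hx => by simpa using hpt x hx) (left_mem_Icc.mpr (by linarith))
      (right_mem_Icc.mpr (by linarith))
    have e : p t = (q (t + 1) - q t) - ((q (t + 1) - (t + 1) • p t) - (q t - t • p t)) := by
      module
    rw [e]
    refine (norm_sub_le _ _).trans (add_le_add (norm_sub_le _ _) ?_)
    simpa using this
  have h1 := hq t ht
  have h2 : ‖q (t + 1)‖ ≤ Cq * (B + N) * wt t := (hq (t + 1) (by linarith)).trans (by
    gcongr
    exact wt_anti (by rw [abs_of_nonneg ht, abs_of_nonneg (by linarith)]; linarith))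
  calc _ ≤ 3 * (Cq * (B + N) * wt t) + E * wt t := by linarith
    _ = _ := by rw [hE, hN]; ring

end

/-! ### Oscillatory integrals with phase t√(r² + m²). -/

/-- The dispersion relation `√(r² + m²)`. -/
noncomputable def disp (m r : ℝ) : ℝ := √(r ^ 2 + m ^ 2)

lemma continuous_disp (m : ℝ) : Continuous (disp m) := by unfold disp; fun_prop

lemma disp_sq (m r : ℝ) : disp m r ^ 2 = r ^ 2 + m ^ 2 := Real.sq_sqrt (by positivity)

lemma disp_nonneg (m r : ℝ) : 0 ≤ disp m r := Real.sqrt_nonneg _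

lemma disp_pos (m : ℝ) {r : ℝ} (hr : 0 < r) : 0 < disp m r := Real.sqrt_pos.mpr (by positivity)

lemma le_disp (m r : ℝ) : r ≤ disp m r := Real.le_sqrt_of_sq_le (by nlinarith [sq_nonneg m])

lemma mass_le_disp (m r : ℝ) : m ≤ disp m r := Real.le_sqrt_of_sq_le (by nlinarith [sq_nonneg r])

lemma disp_le {m r : ℝ} (hm : 0 ≤ m) (hr : 0 ≤ r) : disp m r ≤ r + m := by
  rw [disp, Real.sqrt_le_left (by positivity)]; nlinarith [mul_nonneg hm hr]

lemma disp_le_mul {m r : ℝ} (hm : 0 ≤ m) (hr : 0 ≤ r) : disp m r ≤ (1 + m) * (1 + r) :=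
  (disp_le hm hr).trans (by nlinarith [mul_nonneg hm hr])

lemma hasDerivAt_disp (m : ℝ) {r : ℝ} (hr : 0 < r) : HasDerivAt (disp m) (r / disp m r) r := by
  have h1 : HasDerivAt (fun r : ℝ => r ^ 2 + m ^ 2) (2 * r) r := by
    simpa using (hasDerivAt_pow 2 r).add_const (m ^ 2)
  convert! h1.sqrt (by positivity) using 1
  rw [disp]; field_simp

/-- The oscillating factor `exp (i t √(r² + m²))`. -/
noncomputable def osc (m t r : ℝ) : ℂ := Complex.exp (Complex.I * t * disp m r)

lemma norm_osc (m t r : ℝ) : ‖osc m t r‖ = 1 := by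
  rw [osc, Complex.norm_exp]; simp

lemma continuous_osc (m t : ℝ) : Continuous (osc m t) := by
  have := continuous_disp m
  unfold osc; fun_prop

lemma hasDerivAt_osc (m t : ℝ) {r : ℝ} (hr : 0 < r) :
    HasDerivAt (osc m t) (osc m t r * (Complex.I * t * (r / disp m r : ℝ))) r :=
  (((hasDerivAt_disp m hr).ofReal_comp).const_mul (Complex.I * t)).cexp

lemma integrableOn_mul_osc {f : ℝ → ℂ} {s : Set ℝ} (hf : IntegrableOn f s) (m t : ℝ) :
    IntegrableOn (fun r => f r * osc m t r) s :=
  hf.mul_bdd (c := 1) (continuous_osc m t).aestronglyMeasurable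
    (ae_of_all _ fun r => (norm_osc m t r).le)

lemma norm_setIntegral_mul_osc_le {f : ℝ → ℂ} {g : ℝ → ℝ} {s : Set ℝ} (hs : MeasurableSet s)
    (hg : IntegrableOn g s) (h : ∀ r ∈ s, ‖f r‖ ≤ g r) (m t : ℝ) :
    ‖∫ r in s, f r * osc m t r‖ ≤ ∫ r in s, g r := by
  refine norm_integral_le_of_norm_le hg ?_
  filter_upwards [ae_restrict_mem hs] with r hr
  rw [norm_mul, norm_osc, mul_one]; exact h r hr

/-- Integration by parts in an oscillatory integral. -/
lemma integral_osc_by_parts {m t a : ℝ} (ha : 0 ≤ a) {b b' : ℝ → ℂ}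
    (hd : ∀ r, a < r → HasDerivAt b (b' r) r) (hc : ContinuousWithinAt b (Ici a) a)
    (hi' : IntegrableOn b' (Ioi a))
    (hi : IntegrableOn (fun r => ((r / disp m r : ℝ) : ℂ) * b r) (Ioi a))
    (hlim : Tendsto b atTop (𝓝 0)) :
    Complex.I * t * ∫ r in Ioi a, ((r / disp m r : ℝ) : ℂ) * b r * osc m t r =
      -(b a * osc m t a) - ∫ r in Ioi a, b' r * osc m t r := by
  have h1 := integral_Ioi_of_hasDerivAt_of_tendsto (a := a) (m := 0)
    (f := fun r => b r * osc m t r)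
    (f' := fun r => b' r * osc m t r +
      (Complex.I * t) * (((r / disp m r : ℝ) : ℂ) * b r * osc m t r))
    (hc.mul (continuous_osc m t).continuousWithinAt) (fun r hr => by
      convert! (hd r hr).mul (hasDerivAt_osc m t (ha.trans_lt hr)) using 1
      ring)
    ((integrableOn_mul_osc hi' m t).add ((integrableOn_mul_osc hi m t).const_mul _)) (by
      refine squeeze_zero_norm (fun r => ?_) (tendsto_zero_iff_norm_tendsto_zero.mp hlim)
      rw [norm_mul, norm_osc, mul_one])
  rw [integral_add (integrableOn_mul_osc hi' m t) ((integrableOn_mul_osc hi m t).const_mul _),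
    integral_const_mul] at h1
  linear_combination h1

lemma aestronglyMeasurable_of_hasDerivAt {H H' : ℝ → ℂ} {a : ℝ}
    (hd : ∀ r, a < r → HasDerivAt H (H' r) r) :
    AEStronglyMeasurable H' (volume.restrict (Ioi a)) := by
  refine (aestronglyMeasurable_deriv H _).congr ?_
  filter_upwards [ae_restrict_mem measurableSet_Ioi] with r hr using (hd r hr).deriv

lemma aestronglyMeasurable_of_hasDerivAt' {H H' : ℝ → ℂ} {a : ℝ}
    (hd : ∀ r, a < r → HasDerivAt H (H' r) r) :
    AEStronglyMeasurable H (volume.restrict (Ioi a)) :=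
  ContinuousOn.aestronglyMeasurable
    (fun r hr => (hd r hr).continuousAt.continuousWithinAt) measurableSet_Ioi

/-- The van der Corput estimate of order `t^(-1/2)`. -/
lemma norm_integral_osc_le_inv_sqrt {m t A : ℝ} (hm : 0 ≤ m) (ht : 1 ≤ |t|) {H H' : ℝ → ℂ}
    (hd : ∀ r, 0 < r → HasDerivAt H (H' r) r)
    (hb : ∀ r, 0 < r → ‖H r‖ ≤ A * (1 + r ^ 2)⁻¹)
    (hb' : ∀ r, 0 < r → ‖H' r‖ ≤ A * (1 + r ^ 2)⁻¹) :
    ‖∫ r in Ioi (0 : ℝ), H r * osc m t r‖ ≤ 7 * (1 + m) * A / √|t| := by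
  have hA : 0 ≤ A := nonneg_of_mul_nonneg_left ((norm_nonneg _).trans (hb 1 one_pos))
    (by positivity)
  have hj := integrable_inv_one_add_sq
  have hHi : IntegrableOn H (Ioi 0) := by
    refine (hj.integrableOn.const_mul A).mono' (aestronglyMeasurable_of_hasDerivAt' hd) ?_
    filter_upwards [ae_restrict_mem measurableSet_Ioi] with r hr using hb r hr
  have hH'i : IntegrableOn H' (Ioi 0) := by
    refine (hj.integrableOn.const_mul A).mono' (aestronglyMeasurable_of_hasDerivAt hd) ?_
    filter_upwards [ae_restrict_mem measurableSet_Ioi] with r hr using hb' r hr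
  have hbA : ∀ r, 0 < r → ‖H r‖ ≤ A := fun r hr => (hb r hr).trans
    (mul_le_of_le_one_right hA (inv_le_one_of_one_le₀ (by nlinarith)))
  -- This δ balances the trivial bound Aδ near the stationary point r = 0 with the bound of order
  -- 1/(|t|δ) obtained by parts beyond it.
  set δ := (√|t|)⁻¹ with hδ
  have hst : 1 ≤ √|t| := Real.one_le_sqrt.mpr ht
  have hδ0 : 0 < δ := by positivity
  have hδ1 : δ ≤ 1 := inv_le_one_of_one_le₀ hst
  have hsub : Ioi δ ⊆ Ioi 0 := Ioi_subset_Ioi hδ0.le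
  rw [← Ioc_union_Ioi_eq_Ioi hδ0.le, setIntegral_union (Ioc_disjoint_Ioi le_rfl) measurableSet_Ioi
    (integrableOn_mul_osc (hHi.mono_set Ioc_subset_Ioi_self) m t)
    (integrableOn_mul_osc (hHi.mono_set hsub) m t)]
  have h1 : ‖∫ r in Ioc 0 δ, H r * osc m t r‖ ≤ A * δ := by
    refine (norm_setIntegral_mul_osc_le (g := fun _ => A) measurableSet_Ioc
      (by simp) (fun r hr => hbA r hr.1) m t).trans (le_of_eq ?_)
    simp [hδ0.le, mul_comm]
  have h2 : |t| * ‖∫ r in Ioi δ, H r * osc m t r‖ ≤ (1 + m) * A * (2 + Real.pi) / δ := by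
    -- The amplitude divided by the phase derivative r / disp, which is bounded below by a multiple
    -- of δ on r ≥ δ.
    set b : ℝ → ℂ := fun r => ((disp m r / r : ℝ) : ℂ) * H r with hbdef
    set b' : ℝ → ℂ := fun r => ((-(m ^ 2 / (disp m r * r ^ 2)) : ℝ) : ℂ) * H r +
      ((disp m r / r : ℝ) : ℂ) * H' r with hb'def
    have hbd : ∀ r, 0 < r → HasDerivAt b (b' r) r := fun r hr => by
      have h0 := disp_pos m hr
      have h3 : HasDerivAt (fun r => disp m r / r) (-(m ^ 2 / (disp m r * r ^ 2))) r := by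
        convert! (hasDerivAt_disp m hr).div (hasDerivAt_id r) hr.ne' using 1
        simp only [id]
        field_simp
        rw [disp_sq]; ring
      exact h3.ofReal_comp.mul (hd r hr)
    have hrat : ∀ r, δ ≤ r → disp m r / r ≤ (1 + m) / δ := fun r hr => by
      have hr0 := hδ0.trans_le hr
      rw [div_le_div_iff₀ hr0 hδ0]
      calc disp m r * δ ≤ (r + m) * δ := by gcongr; exact disp_le hm hr0.le
        _ ≤ _ := by nlinarith [mul_le_mul_of_nonneg_left hr hm, mul_le_mul_of_nonneg_left hδ1 hr0.le]
    have hrat0 : ∀ r, 0 < r → 0 ≤ disp m r / r := fun r hr => div_nonneg (disp_nonneg _ _) hr.le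
    have hbb : ∀ r, δ ≤ r → ‖b r‖ ≤ (1 + m) / δ * ‖H r‖ := fun r hr => by
      rw [hbdef, norm_mul, Complex.norm_real, Real.norm_of_nonneg (hrat0 r (hδ0.trans_le hr))]
      exact mul_le_mul_of_nonneg_right (hrat r hr) (norm_nonneg _)
    have hr2 : IntegrableOn (fun r : ℝ => r ^ (-2 : ℝ)) (Ioi δ) :=
      integrableOn_Ioi_rpow_of_lt (by norm_num) hδ0
    have hb'b : ∀ r ∈ Ioi δ, ‖b' r‖ ≤ A * m * r ^ (-2 : ℝ) + (1 + m) / δ * A * (1 + r ^ 2)⁻¹ := by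
      intro r hr
      have hr0 : 0 < r := hδ0.trans hr
      have hd0 := disp_pos m hr0
      refine (norm_add_le _ _).trans (add_le_add ?_ ?_)
      · rw [norm_mul, Complex.norm_real, norm_neg, Real.norm_of_nonneg (by positivity), mul_assoc,
          mul_comm, Real.rpow_neg hr0.le, Real.rpow_two]
        refine mul_le_mul (hbA r hr0) ?_ (by positivity) hA
        rw [← div_eq_mul_inv, div_le_div_iff₀ (by positivity) (by positivity)]
        have := mul_le_mul_of_nonneg_left (mass_le_disp m r) hm
        nlinarith [mul_le_mul_of_nonneg_right this (sq_nonneg r)]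
      · rw [norm_mul, Complex.norm_real, Real.norm_of_nonneg (hrat0 r hr0), mul_assoc]
        exact mul_le_mul (hrat r (le_of_lt hr)) (hb' r hr0) (norm_nonneg _) (by positivity)
    have hgi : IntegrableOn (fun r : ℝ => A * m * r ^ (-2 : ℝ) +
        (1 + m) / δ * A * (1 + r ^ 2)⁻¹) (Ioi δ) :=
      (hr2.const_mul _).add (hj.integrableOn.const_mul _)
    have hb'i : IntegrableOn b' (Ioi δ) := by
      refine hgi.mono' (aestronglyMeasurable_of_hasDerivAt fun r hr => hbd r (hδ0.trans hr)) ?_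
      filter_upwards [ae_restrict_mem measurableSet_Ioi] with r hr using hb'b r hr
    have hcancel : ∀ r, 0 < r → ((r / disp m r : ℝ) : ℂ) * b r = H r := fun r hr => by
      have h0 := disp_pos m hr
      rw [hbdef, ← mul_assoc, ← Complex.ofReal_mul]
      rw [show r / disp m r * (disp m r / r) = 1 by field_simp]; simp
    have hlim : Tendsto b atTop (𝓝 0) := by
      have h4 : Tendsto (fun r : ℝ => (1 + m) / δ * (A * (1 + r ^ 2)⁻¹)) atTop
          (𝓝 ((1 + m) / δ * (A * 0))) :=
        ((tendsto_inv_atTop_zero.comp (tendsto_atTop_add_const_left _ 1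
          (tendsto_pow_atTop two_ne_zero))).const_mul A).const_mul _
      rw [mul_zero, mul_zero] at h4
      refine squeeze_zero_norm' ?_ h4
      filter_upwards [eventually_ge_atTop δ] with r hr
      refine (hbb r hr).trans ?_
      gcongr
      exact hb r (hδ0.trans_le hr)
    have hip := integral_osc_by_parts (m := m) (t := t) hδ0.le (fun r hr => hbd r (hδ0.trans hr))
      (hbd δ hδ0).continuousAt.continuousWithinAt hb'i
      ((hHi.mono_set hsub).congr_fun (fun r hr => (hcancel r (hδ0.trans hr)).symm)
        measurableSet_Ioi) hlim
    have hlhs : ∫ r in Ioi δ, ((r / disp m r : ℝ) : ℂ) * b r * osc m t r =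
        ∫ r in Ioi δ, H r * osc m t r :=
      setIntegral_congr_fun measurableSet_Ioi fun r hr =>
        congrArg (· * osc m t r) (hcancel r (hδ0.trans hr))
    rw [hlhs] at hip
    have h5 := congrArg norm hip
    rw [norm_mul, norm_mul, Complex.norm_I, one_mul, Complex.norm_real, Real.norm_eq_abs] at h5
    rw [h5]
    have h6 : ‖b δ‖ ≤ (1 + m) * A / δ := (hbb δ le_rfl).trans (by
      rw [div_mul_eq_mul_div]; gcongr; exact hbA δ hδ0)
    have h7 : ‖∫ r in Ioi δ, b' r * osc m t r‖ ≤ A * m * δ⁻¹ + (1 + m) / δ * A * Real.pi := by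
      refine (norm_setIntegral_mul_osc_le measurableSet_Ioi hgi hb'b m t).trans ?_
      rw [integral_add (hr2.const_mul _) (hj.integrableOn.const_mul _), integral_const_mul,
        integral_const_mul, integral_Ioi_rpow_of_lt (by norm_num) hδ0]
      refine add_le_add (le_of_eq ?_) ?_
      · norm_num [Real.rpow_neg_one]
      · rw [← integral_univ_inv_one_add_sq]
        refine mul_le_mul_of_nonneg_left (setIntegral_le_integral hj (ae_of_all _ fun r => ?_))
          (by positivity)
        change 0 ≤ (1 + r ^ 2)⁻¹
        positivity
    calc _ ≤ ‖b δ‖ + ‖∫ r in Ioi δ, b' r * osc m t r‖ := by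
          refine (norm_sub_le _ _).trans (le_of_eq ?_)
          rw [norm_neg, norm_mul, norm_osc, mul_one]
      _ ≤ (1 + m) * A / δ + (A * m * δ⁻¹ + (1 + m) / δ * A * Real.pi) := add_le_add h6 h7
      _ ≤ (1 + m) * A / δ + (A * (1 + m) * δ⁻¹ + (1 + m) / δ * A * Real.pi) := by
          gcongr; linarith
      _ = _ := by field_simp; ring
  have hts : √|t| * √|t| = |t| := Real.mul_self_sqrt (abs_nonneg t)
  have h3 : ‖∫ r in Ioi δ, H r * osc m t r‖ ≤ (1 + m) * A * (2 + Real.pi) / √|t| := by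
    rw [le_div_iff₀ (by positivity)]
    refine le_of_mul_le_mul_right ?_ (show 0 < √|t| by positivity)
    have h4 : (1 + m) * A * (2 + Real.pi) / δ = (1 + m) * A * (2 + Real.pi) * √|t| := by
      rw [hδ, div_inv_eq_mul]
    rw [mul_assoc, hts, mul_comm, ← h4]
    exact h2
  refine (norm_add_le _ _).trans ((add_le_add h1 h3).trans ?_)
  rw [hδ, ← div_eq_mul_inv, ← add_div]
  gcongr
  have := Real.pi_lt_four
  nlinarith [mul_nonneg hm hA, mul_nonneg (mul_nonneg hm hA) (sub_nonneg.mpr this.le),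
    mul_nonneg hA (sub_nonneg.mpr this.le)]

lemma div_disp_le_one (m r : ℝ) : r / disp m r ≤ 1 :=
  div_le_one_of_le₀ (le_disp m r) (disp_nonneg m r)

lemma div_disp_nonneg (m : ℝ) {r : ℝ} (hr : 0 < r) : 0 ≤ r / disp m r :=
  div_nonneg hr.le (disp_nonneg m r)

lemma one_third_le_wt {t : ℝ} (ht : |t| ≤ 1) : 1 / 3 ≤ wt t := by
  rw [wt_eq, one_div]
  refine inv_anti₀ (by positivity) ?_
  have h : √(1 + |t|) ≤ 3 / 2 := by rw [Real.sqrt_le_left (by norm_num)]; linarith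
  nlinarith [abs_nonneg t, Real.sqrt_nonneg (1 + |t|)]

lemma inv_mul_sqrt_le_wt {t : ℝ} (ht : 1 ≤ |t|) : (|t| * √|t|)⁻¹ ≤ 3 * wt t := by
  have h0 : 0 < |t| := one_pos.trans_le ht
  rw [wt_eq, ← div_eq_mul_inv, le_div_iff₀ (by positivity), inv_mul_le_iff₀ (by positivity)]
  have h : √(1 + |t|) ≤ 3 / 2 * √|t| := by
    rw [Real.sqrt_le_left (by positivity), mul_pow, Real.sq_sqrt h0.le]; linarith
  calc (1 + |t|) * √(1 + |t|) ≤ (2 * |t|) * (3 / 2 * √|t|) := by gcongr; linarith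
    _ = _ := by ring

lemma integrableOn_div_disp_mul {m A : ℝ} {b : ℝ → ℂ}
    (hm : AEStronglyMeasurable b (volume.restrict (Ioi 0)))
    (hb : ∀ r, 0 < r → ‖b r‖ ≤ A * (1 + r ^ 2)⁻¹) :
    IntegrableOn (fun r => ((r / disp m r : ℝ) : ℂ) * b r) (Ioi 0) := by
  refine (integrable_inv_one_add_sq.integrableOn.const_mul A).mono' ?_ ?_
  · refine AEStronglyMeasurable.mul ?_ hm
    refine ContinuousOn.aestronglyMeasurable ?_ measurableSet_Ioi
    refine Complex.continuous_ofReal.comp_continuousOn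
      (continuousOn_id.div (continuous_disp m).continuousOn fun r hr => (disp_pos m hr).ne')
  · filter_upwards [ae_restrict_mem measurableSet_Ioi] with r hr
    rw [norm_mul, Complex.norm_real, Real.norm_of_nonneg (div_disp_nonneg m hr)]
    exact (mul_le_of_le_one_left (norm_nonneg _) (div_disp_le_one m r)).trans (hb r hr)

lemma tendsto_zero_of_le_inv_one_add_sq {A : ℝ} {b : ℝ → ℂ}
    (hb : ∀ r, 0 < r → ‖b r‖ ≤ A * (1 + r ^ 2)⁻¹) : Tendsto b atTop (𝓝 0) := by
  have h4 : Tendsto (fun r : ℝ => A * (1 + r ^ 2)⁻¹) atTop (𝓝 (A * 0)) :=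
    (tendsto_inv_atTop_zero.comp (tendsto_atTop_add_const_left _ 1
      (tendsto_pow_atTop two_ne_zero))).const_mul A
  rw [mul_zero] at h4
  refine squeeze_zero_norm' ?_ h4
  filter_upwards [eventually_gt_atTop 0] with r hr using hb r hr

lemma norm_integral_div_disp_le_pi {m A : ℝ} {b : ℝ → ℂ} (hA : 0 ≤ A)
    (hb : ∀ r, 0 < r → ‖b r‖ ≤ A * (1 + r ^ 2)⁻¹) (t : ℝ) :
    ‖∫ r in Ioi (0 : ℝ), ((r / disp m r : ℝ) : ℂ) * b r * osc m t r‖ ≤ 4 * A := by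
  refine (norm_setIntegral_mul_osc_le (g := fun r => A * (1 + r ^ 2)⁻¹) measurableSet_Ioi
    (integrable_inv_one_add_sq.integrableOn.const_mul A) (fun r hr => ?_) m t).trans ?_
  · rw [norm_mul, Complex.norm_real, Real.norm_of_nonneg (div_disp_nonneg m hr)]
    exact (mul_le_of_le_one_left (norm_nonneg _) (div_disp_le_one m r)).trans (hb r hr)
  · rw [integral_const_mul, mul_comm]
    refine mul_le_mul_of_nonneg_right (le_trans (setIntegral_le_integral integrable_inv_one_add_sq
      (ae_of_all _ fun r => ?_)) ?_) hA
    · change 0 ≤ (1 + r ^ 2)⁻¹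
      positivity
    · rw [integral_univ_inv_one_add_sq]; exact Real.pi_lt_four.le

/-- Since b(0) = 0 the boundary term disappears, and the factor r / disp is exactly the phase
derivative: a full power of t is gained. -/
lemma norm_integral_osc_by_parts {m t A : ℝ} {b H : ℝ → ℂ}
    (hd : ∀ r, 0 < r → HasDerivAt b (H r) r) (hc : ContinuousWithinAt b (Ici 0) 0) (h0 : b 0 = 0)
    (hb : ∀ r, 0 < r → ‖b r‖ ≤ A * (1 + r ^ 2)⁻¹)
    (hbH : ∀ r, 0 < r → ‖H r‖ ≤ A * (1 + r ^ 2)⁻¹) :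
    |t| * ‖∫ r in Ioi (0 : ℝ), ((r / disp m r : ℝ) : ℂ) * b r * osc m t r‖ =
      ‖∫ r in Ioi (0 : ℝ), H r * osc m t r‖ := by
  have hHi : IntegrableOn H (Ioi 0) := by
    refine (integrable_inv_one_add_sq.integrableOn.const_mul A).mono'
      (aestronglyMeasurable_of_hasDerivAt hd) ?_
    filter_upwards [ae_restrict_mem measurableSet_Ioi] with r hr using hbH r hr
  have hip := integral_osc_by_parts (m := m) (t := t) le_rfl hd hc hHi
    (integrableOn_div_disp_mul (aestronglyMeasurable_of_hasDerivAt' hd) hb)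
    (tendsto_zero_of_le_inv_one_add_sq hb)
  have h5 := congrArg norm hip
  rwa [norm_mul, norm_mul, Complex.norm_I, one_mul, Complex.norm_real, Real.norm_eq_abs, h0,
    zero_mul, neg_zero, zero_sub, norm_neg] at h5

/-- One integration by parts gains |t|⁻¹ and van der Corput for the remaining amplitude gains
|t|^(-1/2). For |t| ≤ 1 the integral is bounded trivially. -/
lemma norm_integral_osc_le_wt {m t A : ℝ} (hm : 0 ≤ m) {b H H' : ℝ → ℂ}
    (hd : ∀ r, 0 < r → HasDerivAt b (H r) r) (hd' : ∀ r, 0 < r → HasDerivAt H (H' r) r)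
    (hc : ContinuousWithinAt b (Ici 0) 0) (h0 : b 0 = 0)
    (hb : ∀ r, 0 < r → ‖b r‖ ≤ A * (1 + r ^ 2)⁻¹)
    (hbH : ∀ r, 0 < r → ‖H r‖ ≤ A * (1 + r ^ 2)⁻¹)
    (hbH' : ∀ r, 0 < r → ‖H' r‖ ≤ A * (1 + r ^ 2)⁻¹) :
    ‖∫ r in Ioi (0 : ℝ), ((r / disp m r : ℝ) : ℂ) * b r * osc m t r‖ ≤
      21 * (1 + m) * A * wt t := by
  have hA : 0 ≤ A := nonneg_of_mul_nonneg_left ((norm_nonneg _).trans (hb 1 one_pos))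
    (by positivity)
  rcases le_total |t| 1 with ht | ht
  · have h1 := norm_integral_div_disp_le_pi (m := m) hA hb t
    have h2 := one_third_le_wt ht
    nlinarith [mul_nonneg hm hA, mul_nonneg (mul_nonneg hm hA) (wt_nonneg t),
      mul_le_mul_of_nonneg_left h2 hA]
  · have h1 := norm_integral_osc_by_parts (m := m) (t := t) hd hc h0 hb hbH
    have h2 := norm_integral_osc_le_inv_sqrt hm ht hd' hbH hbH'
    have ht0 : 0 < |t| := one_pos.trans_le ht
    rw [← h1] at h2
    have h3 : ‖∫ r in Ioi (0 : ℝ), ((r / disp m r : ℝ) : ℂ) * b r * osc m t r‖ ≤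
        7 * (1 + m) * A * (|t| * √|t|)⁻¹ := by
      rw [← div_eq_mul_inv, le_div_iff₀ (by positivity)]
      rw [le_div_iff₀ (by positivity)] at h2
      linarith
    refine h3.trans ?_
    calc _ ≤ 7 * (1 + m) * A * (3 * wt t) := by gcongr; exact inv_mul_sqrt_le_wt ht
      _ = _ := by ring

/-- Decay of order 4 pays for a prefactor of quadratic growth and leaves an integrable majorant. -/
lemma mul_norm_le_of_decay {z : ℂ} {A P c r : ℝ} (hr : 0 < r) (hz : (1 + r) ^ 4 * ‖z‖ ≤ A)
    (hc : 0 ≤ c) (hP : P ≤ c * (1 + r) ^ 2) : P * ‖z‖ ≤ c * A * (1 + r ^ 2)⁻¹ := by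
  rw [← div_eq_mul_inv, le_div_iff₀ (by positivity)]
  calc P * ‖z‖ * (1 + r ^ 2) ≤ c * (1 + r) ^ 2 * ‖z‖ * (1 + r) ^ 2 := by
        have : 1 + r ^ 2 ≤ (1 + r) ^ 2 := by nlinarith
        gcongr
    _ = c * ((1 + r) ^ 4 * ‖z‖) := by ring
    _ ≤ c * A := by gcongr

/-- Write r² = (r / disp) · (r disp), so that the amplitude r disp g₀ vanishes at 0. Its derivatives
involve r only through disp and the bounded quotient r / disp, hence remain controlled when m = 0.
-/
lemma norm_integral_sq_mul_osc_le {m t A : ℝ} (hm : 0 ≤ m) {g₀ g₁ g₂ : ℝ → ℂ}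
    (hd₀ : ∀ r, HasDerivAt g₀ (g₁ r) r) (hd₁ : ∀ r, HasDerivAt g₁ (g₂ r) r)
    (hb₀ : ∀ r, 0 < r → (1 + r) ^ 4 * ‖g₀ r‖ ≤ A) (hb₁ : ∀ r, 0 < r → (1 + r) ^ 4 * ‖g₁ r‖ ≤ A)
    (hb₂ : ∀ r, 0 < r → (1 + r) ^ 4 * ‖g₂ r‖ ≤ A) :
    ‖∫ r in Ioi (0 : ℝ), ((r ^ 2 : ℝ) : ℂ) * g₀ r * osc m t r‖ ≤
      168 * (1 + m) ^ 2 * A * wt t := by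
  have hA : 0 ≤ A := le_trans (by positivity) (hb₀ 1 one_pos)
  set b : ℝ → ℂ := fun r => ((r * disp m r : ℝ) : ℂ) * g₀ r with hb
  set H : ℝ → ℂ := fun r => ((disp m r + r ^ 2 / disp m r : ℝ) : ℂ) * g₀ r +
    ((r * disp m r : ℝ) : ℂ) * g₁ r with hH
  set H' : ℝ → ℂ := fun r => ((3 * (r / disp m r) - (r / disp m r) ^ 3 : ℝ) : ℂ) * g₀ r +
    ((2 * (disp m r + r ^ 2 / disp m r) : ℝ) : ℂ) * g₁ r + ((r * disp m r : ℝ) : ℂ) * g₂ r with hH'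
  have hd1 : ∀ r, 0 < r →
      HasDerivAt (fun r => r * disp m r) (disp m r + r ^ 2 / disp m r) r := fun r hr => by
    convert! (hasDerivAt_id r).mul (hasDerivAt_disp m hr) using 1
    simp only [id]; ring
  have hd2 : ∀ r, 0 < r → HasDerivAt (fun r => disp m r + r ^ 2 / disp m r)
      (3 * (r / disp m r) - (r / disp m r) ^ 3) r := fun r hr => by
    have h0 := disp_pos m hr
    convert! (hasDerivAt_disp m hr).add
      ((hasDerivAt_pow 2 r).div (hasDerivAt_disp m hr) h0.ne') using 1
    field_simp
    push_cast
    ring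
  -- The 8 is 3 + 4 + 1, the coefficients of the three terms in the bound for H'.
  have hmul : (8 * (1 + m) * A) * (21 * (1 + m)) = 168 * (1 + m) ^ 2 * A := by ring
  have key := norm_integral_osc_le_wt (m := m) (t := t) (A := 8 * (1 + m) * A) hm
    (b := b) (H := H) (H' := H') (fun r hr => (hd1 r hr).ofReal_comp.mul (hd₀ r)) (fun r hr => ?_)
    ?_ (by simp [hb]) (fun r hr => ?_) (fun r hr => ?_) (fun r hr => ?_)
  · have e : ∫ r in Ioi (0 : ℝ), ((r / disp m r : ℝ) : ℂ) * b r * osc m t r =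
        ∫ r in Ioi (0 : ℝ), ((r ^ 2 : ℝ) : ℂ) * g₀ r * osc m t r := by
      refine setIntegral_congr_fun measurableSet_Ioi fun r hr => ?_
      have h0 := disp_pos m (show 0 < r from hr)
      change _ * (_ * _) * _ = _
      rw [← mul_assoc, ← Complex.ofReal_mul]
      congr 3
      field_simp
    rw [e] at key
    refine key.trans (le_of_eq ?_)
    rw [← hmul]; ring
  · convert! ((hd2 r hr).ofReal_comp.mul (hd₀ r)).add ((hd1 r hr).ofReal_comp.mul (hd₁ r)) using 1
    simp only [hH']
    push_cast
    ring
  · have : Continuous b := by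
      have h1 := continuous_disp m
      have h2 : Continuous g₀ := continuous_iff_continuousAt.mpr fun r => (hd₀ r).continuousAt
      fun_prop
    exact this.continuousWithinAt
  all_goals
    have hl := disp_le_mul hm hr.le
    have hl0 := disp_nonneg m r
    have hr2 : r ^ 2 / disp m r ≤ 1 + r := by
      rw [sq, mul_div_assoc]
      nlinarith [div_disp_le_one m r]
    have hr20 : 0 ≤ r ^ 2 / disp m r := by positivity
    have hmr := mul_nonneg hm hr.le
    have hP1 : r * disp m r ≤ (1 + m) * (1 + r) ^ 2 := by nlinarith
    have hP2 : disp m r + r ^ 2 / disp m r ≤ 2 * (1 + m) * (1 + r) ^ 2 := by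
      have : (1 + m) * (1 + r) ≤ (1 + m) * (1 + r) ^ 2 := by gcongr; nlinarith
      have : 1 + r ≤ (1 + m) * (1 + r) := by nlinarith
      linarith
    have hm0 : 0 ≤ 1 + m := by linarith
    have hj : 0 ≤ A * (1 + r ^ 2)⁻¹ := by positivity
    have hmj := mul_nonneg hm hj
    have e1 : ∀ x : ℝ, 0 ≤ x → ∀ z : ℂ, ‖(x : ℂ) * z‖ = x * ‖z‖ := fun x hx z => by
      rw [norm_mul, Complex.norm_real, Real.norm_of_nonneg hx]
  · rw [hb, e1 _ (by positivity)]
    refine (mul_norm_le_of_decay hr (hb₀ r hr) hm0 hP1).trans ?_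
    nlinarith
  · refine (norm_add_le _ _).trans ?_
    rw [e1 _ (by positivity), e1 _ (by positivity)]
    have i1 := mul_norm_le_of_decay hr (hb₀ r hr) (by positivity) hP2
    have i2 := mul_norm_le_of_decay hr (hb₁ r hr) hm0 hP1
    nlinarith
  · have hq0 := div_disp_nonneg m hr
    have hq1 := div_disp_le_one m r
    have hq : 0 ≤ 3 * (r / disp m r) - (r / disp m r) ^ 3 := by
      nlinarith [mul_le_mul_of_nonneg_left hq1 hq0, mul_nonneg hq0 hq0, pow_nonneg hq0 2]
    have hq3 : 3 * (r / disp m r) - (r / disp m r) ^ 3 ≤ 3 * (1 + m) * (1 + r) ^ 2 := by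
      have : 1 ≤ (1 + m) * (1 + r) ^ 2 := by nlinarith [mul_nonneg hm (sq_nonneg (1 + r))]
      nlinarith [pow_nonneg hq0 3]
    refine (norm_add₃_le).trans ?_
    rw [e1 _ hq, e1 _ (by positivity), e1 _ (by positivity)]
    have i1 := mul_norm_le_of_decay hr (hb₀ r hr) (by positivity) hq3
    have i2 := mul_norm_le_of_decay hr (hb₁ r hr) (by positivity)
      (show 2 * (disp m r + r ^ 2 / disp m r) ≤ (4 * (1 + m)) * (1 + r) ^ 2 by linarith)
    have i3 := mul_norm_le_of_decay hr (hb₂ r hr) hm0 hP1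
    nlinarith

/-- Here the amplitude is r g₀, which vanishes at 0; the factor 3 is the cost of its second
derivative 2g₁ + r g₂. -/
lemma norm_integral_sq_div_disp_mul_osc_le {m t A : ℝ} (hm : 0 ≤ m) {g₀ g₁ g₂ : ℝ → ℂ}
    (hd₀ : ∀ r, HasDerivAt g₀ (g₁ r) r) (hd₁ : ∀ r, HasDerivAt g₁ (g₂ r) r)
    (hb₀ : ∀ r, 0 < r → (1 + r) ^ 4 * ‖g₀ r‖ ≤ A) (hb₁ : ∀ r, 0 < r → (1 + r) ^ 4 * ‖g₁ r‖ ≤ A)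
    (hb₂ : ∀ r, 0 < r → (1 + r) ^ 4 * ‖g₂ r‖ ≤ A) :
    ‖∫ r in Ioi (0 : ℝ), ((r ^ 2 / disp m r : ℝ) : ℂ) * g₀ r * osc m t r‖ ≤
      63 * (1 + m) * A * wt t := by
  have hA : 0 ≤ A := le_trans (by positivity) (hb₀ 1 one_pos)
  have key := norm_integral_osc_le_wt (m := m) (t := t) (A := 3 * A) hm
    (b := fun r => (r : ℂ) * g₀ r) (H := fun r => g₀ r + (r : ℂ) * g₁ r)
    (H' := fun r => 2 * g₁ r + (r : ℂ) * g₂ r) (fun r hr => ?_) (fun r hr => ?_)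
    ?_ (by simp) (fun r hr => ?_) (fun r hr => ?_) (fun r hr => ?_)
  · have e : ∫ r in Ioi (0 : ℝ), ((r / disp m r : ℝ) : ℂ) * ((r : ℂ) * g₀ r) * osc m t r =
        ∫ r in Ioi (0 : ℝ), ((r ^ 2 / disp m r : ℝ) : ℂ) * g₀ r * osc m t r := by
      congr 1; ext r
      push_cast; ring
    rw [e] at key
    refine key.trans (le_of_eq (by ring))
  · convert! (Complex.ofRealCLM.hasDerivAt (x := r)).mul (hd₀ r) using 1
    simp
  · convert! (hd₀ r).add ((Complex.ofRealCLM.hasDerivAt (x := r)).mul (hd₁ r)) using 1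
    simp only [Complex.ofRealCLM_apply, Complex.ofReal_one]; ring
  · have : Continuous fun r : ℝ => (r : ℂ) * g₀ r := by
      have h2 : Continuous g₀ := continuous_iff_continuousAt.mpr fun r => (hd₀ r).continuousAt
      fun_prop
    exact this.continuousWithinAt
  all_goals
    have hj : 0 ≤ A * (1 + r ^ 2)⁻¹ := by positivity
    have hP0 : (1 : ℝ) ≤ 1 * (1 + r) ^ 2 := by nlinarith
    have hP1 : r ≤ 1 * (1 + r) ^ 2 := by nlinarith
    have e1 : ∀ z : ℂ, ‖(r : ℂ) * z‖ = r * ‖z‖ := fun z => by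
      rw [norm_mul, Complex.norm_real, Real.norm_of_nonneg hr.le]
  · rw [e1]
    refine (mul_norm_le_of_decay hr (hb₀ r hr) zero_le_one hP1).trans (by nlinarith)
  · refine (norm_add_le _ _).trans ?_
    rw [e1]
    have i1 := mul_norm_le_of_decay hr (hb₀ r hr) zero_le_one hP0
    have i2 := mul_norm_le_of_decay hr (hb₁ r hr) zero_le_one hP1
    nlinarith
  · refine (norm_add_le _ _).trans ?_
    rw [e1, norm_mul, Complex.norm_ofNat]
    have i1 := mul_norm_le_of_decay hr (hb₁ r hr) zero_le_one hP0
    have i2 := mul_norm_le_of_decay hr (hb₂ r hr) zero_le_one hP1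
    nlinarith

/-- With amplitude r³ g₀ a first integration by parts gives r² (3g₀ + r g₁), which is again of the
form treated in `norm_integral_sq_mul_osc_le`. The total gain is of order |t|^(-5/2). -/
lemma norm_integral_pow_four_div_disp_mul_osc_le {m t A : ℝ} (hm : 0 ≤ m) {g₀ g₁ g₂ g₃ : ℝ → ℂ}
    (hd₀ : ∀ r, HasDerivAt g₀ (g₁ r) r) (hd₁ : ∀ r, HasDerivAt g₁ (g₂ r) r)
    (hd₂ : ∀ r, HasDerivAt g₂ (g₃ r) r)
    (hb₀ : ∀ r, 0 < r → (1 + r) ^ 5 * ‖g₀ r‖ ≤ A) (hb₁ : ∀ r, 0 < r → (1 + r) ^ 5 * ‖g₁ r‖ ≤ A)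
    (hb₂ : ∀ r, 0 < r → (1 + r) ^ 5 * ‖g₂ r‖ ≤ A) (hb₃ : ∀ r, 0 < r → (1 + r) ^ 5 * ‖g₃ r‖ ≤ A) :
    (1 + |t|) * ‖∫ r in Ioi (0 : ℝ), ((r ^ 4 / disp m r : ℝ) : ℂ) * g₀ r * osc m t r‖ ≤
      2016 * (1 + m) ^ 2 * A * wt t := by
  have hA : 0 ≤ A := le_trans (by positivity) (hb₀ 1 one_pos)
  set G₀ : ℝ → ℂ := fun r => 3 * g₀ r + (r : ℂ) * g₁ r with hG₀
  set G₁ : ℝ → ℂ := fun r => 4 * g₁ r + (r : ℂ) * g₂ r with hG₁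
  set G₂ : ℝ → ℂ := fun r => 5 * g₂ r + (r : ℂ) * g₃ r with hG₂
  have hdr : ∀ r : ℝ, HasDerivAt (fun r : ℝ => (r : ℂ)) 1 r := fun r => by
    convert! Complex.ofRealCLM.hasDerivAt (x := r) using 1
  have hD₀ : ∀ r, HasDerivAt G₀ (G₁ r) r := fun r => by
    convert! ((hd₀ r).const_mul 3).add ((hdr r).mul (hd₁ r)) using 1
    simp only [hG₁]; ring
  have hD₁ : ∀ r, HasDerivAt G₁ (G₂ r) r := fun r => by
    convert! ((hd₁ r).const_mul 4).add ((hdr r).mul (hd₂ r)) using 1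
    simp only [hG₂]; ring
  have hGb : ∀ (k : ℕ) (x y : ℂ) (r : ℝ), k ≤ 5 → 0 < r → (1 + r) ^ 5 * ‖x‖ ≤ A →
      (1 + r) ^ 5 * ‖y‖ ≤ A → (1 + r) ^ 4 * ‖(k : ℂ) * x + (r : ℂ) * y‖ ≤ 6 * A := by
    intro k x y r hk hr hx hy
    have h1 : (1 + r) ^ 4 * ‖x‖ ≤ A := by
      refine le_trans ?_ hx
      gcongr <;> linarith
    have h2 : (1 + r) ^ 4 * (r * ‖y‖) ≤ A := by
      refine le_trans ?_ hy
      rw [pow_succ (1 + r) 4, mul_assoc ((1 + r) ^ 4)]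
      gcongr; linarith
    calc _ ≤ (1 + r) ^ 4 * (k * ‖x‖ + r * ‖y‖) := by
          gcongr
          refine (norm_add_le _ _).trans (le_of_eq ?_)
          rw [norm_mul, norm_mul, Complex.norm_natCast, Complex.norm_real,
            Real.norm_of_nonneg hr.le]
      _ = k * ((1 + r) ^ 4 * ‖x‖) + (1 + r) ^ 4 * (r * ‖y‖) := by ring
      _ ≤ 5 * A + A := by
          have : (k : ℝ) ≤ 5 := by exact_mod_cast hk
          gcongr
      _ = _ := by ring
  have h1 := norm_integral_sq_mul_osc_le (m := m) (t := t) (A := 6 * A) hm hD₀ hD₁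
    (fun r hr => by simpa using hGb 3 _ _ r (by norm_num) hr (hb₀ r hr) (hb₁ r hr))
    (fun r hr => by simpa using hGb 4 _ _ r (by norm_num) hr (hb₁ r hr) (hb₂ r hr))
    (fun r hr => by simpa using hGb 5 _ _ r (by norm_num) hr (hb₂ r hr) (hb₃ r hr))
  set b : ℝ → ℂ := fun r => ((r ^ 3 : ℝ) : ℂ) * g₀ r with hb
  have hbb : ∀ r, 0 < r → ‖b r‖ ≤ 6 * A * (1 + r ^ 2)⁻¹ := fun r hr => by
    rw [hb, norm_mul, Complex.norm_real, Real.norm_of_nonneg (by positivity), ← div_eq_mul_inv,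
      le_div_iff₀ (by positivity)]
    calc r ^ 3 * ‖g₀ r‖ * (1 + r ^ 2) ≤ (1 + r) ^ 3 * ‖g₀ r‖ * (1 + r) ^ 2 := by
          gcongr
          · linarith
          · nlinarith
      _ = (1 + r) ^ 5 * ‖g₀ r‖ := by ring
      _ ≤ 6 * A := by linarith [hb₀ r hr]
  have e : ∫ r in Ioi (0 : ℝ), ((r / disp m r : ℝ) : ℂ) * b r * osc m t r =
      ∫ r in Ioi (0 : ℝ), ((r ^ 4 / disp m r : ℝ) : ℂ) * g₀ r * osc m t r := by
    congr 1; ext r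
    simp only [hb]
    push_cast; ring
  have h2 := norm_integral_osc_by_parts (m := m) (t := t) (A := 6 * A) (b := b)
    (H := fun r => ((r ^ 2 : ℝ) : ℂ) * G₀ r) (fun r hr => ?_) ?_ (by simp [hb]) hbb (fun r hr => ?_)
  · rw [e] at h2
    have hw := wt_nonneg t
    rcases le_total |t| 1 with ht | ht
    · have h3 := norm_integral_div_disp_le_pi (m := m) (by positivity) hbb t
      rw [e] at h3
      have h4 := one_third_le_wt ht
      have h5 : (1 + |t|) * ‖∫ r in Ioi (0 : ℝ), ((r ^ 4 / disp m r : ℝ) : ℂ) * g₀ r * osc m t r‖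
          ≤ 2 * (4 * (6 * A)) := by gcongr; linarith
      have h6 : A ≤ (1 + m) ^ 2 * A := le_mul_of_one_le_left hA (by nlinarith)
      have h7 : 0 ≤ (1 + m) ^ 2 * A := by positivity
      nlinarith
    · have h3 : (1 + |t|) * ‖∫ r in Ioi (0 : ℝ), ((r ^ 4 / disp m r : ℝ) : ℂ) * g₀ r * osc m t r‖
          ≤ 2 * (|t| * ‖∫ r in Ioi (0 : ℝ), ((r ^ 4 / disp m r : ℝ) : ℂ) * g₀ r * osc m t r‖) := by
        rw [← mul_assoc]
        gcongr
        linarith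
      rw [h2] at h3
      linarith
  · have hp : HasDerivAt (fun r : ℝ => ((r ^ 3 : ℝ) : ℂ)) ((3 * r ^ 2 : ℝ) : ℂ) r := by
      have := (hasDerivAt_pow 3 r).ofReal_comp
      convert! this using 1
    convert! hp.mul (hd₀ r) using 1
    simp only [hG₀]; push_cast; ring
  · have : Continuous b := by
      have h2 : Continuous g₀ := continuous_iff_continuousAt.mpr fun r => (hd₀ r).continuousAt
      fun_prop
    exact this.continuousWithinAt
  · rw [norm_mul, Complex.norm_real, Real.norm_of_nonneg (by positivity)]
    have := mul_norm_le_of_decay (P := r ^ 2) (c := 1) hr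
      (by simpa using hGb 3 _ _ r (by norm_num) hr (hb₀ r hr) (hb₁ r hr)) zero_le_one (by nlinarith)
    simpa [hG₀] using this

/-! ### Polar coordinates and decay of Klein–Gordon waves in space. -/

lemma integral_volumeIoiPow_two (f : ℝ → ℂ) :
    ∫ r : Ioi (0 : ℝ), f r ∂(Measure.volumeIoiPow 2) = ∫ r in Ioi (0 : ℝ), (r ^ 2 : ℝ) • f r := by
  simp only [Measure.volumeIoiPow, ENNReal.ofReal]
  rw [integral_withDensity_eq_integral_smul,
    integral_subtype_comap measurableSet_Ioi fun a ↦ Real.toNNReal (a ^ 2) • f a,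
    setIntegral_congr_fun measurableSet_Ioi fun x hx ↦ ?_]
  · simp only [NNReal.smul_def]
    rw [Real.coe_toNNReal _ (by positivity)]
  · exact (measurable_subtype_coe.pow_const _).real_toNNReal

/-- An integral over space is controlled by the integrals along rays. -/
lemma norm_integral_le_of_polar {F : E3 → ℂ} {C : ℝ} (hC : 0 ≤ C)
    (h : ∀ θ : E3, ‖θ‖ = 1 → ‖∫ r in Ioi (0 : ℝ), (r ^ 2 : ℝ) • F (r • θ)‖ ≤ C) :
    ‖∫ k, F k‖ ≤ C * (volume : Measure E3).toSphere.real univ := by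
  -- The Bochner integral of a non-integrable function is 0, so the bound needs no integrability
  -- assumption.
  by_cases hF : Integrable F
  swap
  · rw [integral_undef hF, norm_zero]; positivity
  have hdim : Module.finrank ℝ E3 - 1 = 2 := by simp
  have hmp := (volume : Measure E3).measurePreserving_homeomorphUnitSphereProd
  have hemb := (homeomorphUnitSphereProd E3).measurableEmbedding
  rw [hdim] at hmp
  set G : Metric.sphere (0 : E3) 1 × Ioi (0 : ℝ) → ℂ := fun x => F ((x.2 : ℝ) • (x.1 : E3)) with hG
  have hGF : ∀ x : ({(0)}ᶜ : Set E3), G (homeomorphUnitSphereProd E3 x) = F x := fun x => by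
    have hx : ‖(x : E3)‖ ≠ 0 := norm_ne_zero_iff.mpr x.2
    simp [hG, homeomorphUnitSphereProd, smul_smul, hx]
  have e1 : ∫ k, F k = ∫ x, G x ∂((volume : Measure E3).toSphere.prod (Measure.volumeIoiPow 2)) := by
    rw [← hmp.integral_comp hemb]
    simp_rw [hGF]
    rw [integral_subtype_comap (measurableSet_singleton (0 : E3)).compl fun x ↦ F x,
      restrict_compl_singleton]
  have hGi : Integrable G ((volume : Measure E3).toSphere.prod (Measure.volumeIoiPow 2)) := by
    rw [← hmp.integrable_comp_emb hemb]
    have : G ∘ homeomorphUnitSphereProd E3 = F ∘ (fun x : ({(0)}ᶜ : Set E3) => (x : E3)) := by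
      ext x; exact hGF x
    rw [this, ← integrableOn_iff_comap_subtypeVal (measurableSet_singleton (0 : E3)).compl]
    exact hF.integrableOn
  rw [e1, integral_prod _ hGi]
  refine norm_integral_le_of_norm_le_const (ae_of_all _ fun θ => ?_)
  rw [hG, integral_volumeIoiPow_two fun r => F (r • (θ : E3))]
  exact h θ (by simp)

open SchwartzMap LineDeriv FourierTransform

lemma hasDerivAt_schwartz_ray (s : 𝓢(E3, ℂ)) (θ : E3) (n : ℕ) (r : ℝ) :
    HasDerivAt (fun r : ℝ => (∂^{fun _ : Fin n => θ} s) (r • θ))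
      ((∂^{fun _ : Fin (n + 1) => θ} s) (r • θ)) r := by
  rw [iteratedLineDerivOp_succ_left]
  have h1 := ((∂^{fun _ : Fin n => θ} s).hasFDerivAt (r • θ)).comp_hasDerivAt r
    ((hasDerivAt_id r).smul_const θ)
  rw [one_smul] at h1
  rw [lineDerivOp_apply_eq_fderiv]
  exact h1

/-- Schwartz seminorms bound all directional derivatives uniformly over unit directions; order 3 is
the highest needed. -/
lemma exists_schwartz_ray_bound (s : 𝓢(E3, ℂ)) (N : ℕ) : ∃ A, 0 ≤ A ∧ ∀ n ≤ 3, ∀ θ : E3, ‖θ‖ = 1 →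
    ∀ r : ℝ, 0 < r → (1 + r) ^ N * ‖(∂^{fun _ : Fin n => θ} s) (r • θ)‖ ≤ A := by
  refine ⟨2 ^ N * (Finset.Iic (N, 3)).sup (fun m => SchwartzMap.seminorm ℝ m.1 m.2) s,
    by positivity, fun n hn θ hθ r hr => ?_⟩
  have h1 := one_add_le_sup_seminorm_apply (𝕜 := ℝ) (m := (N, 3)) (k := N) (n := n) le_rfl hn s
    (r • θ)
  refine le_trans ?_ h1
  rw [norm_smul, hθ, mul_one, Real.norm_of_nonneg hr.le, iteratedLineDerivOp_eq_iteratedFDeriv]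
  gcongr
  refine (ContinuousMultilinearMap.le_opNorm _ _).trans (le_of_eq ?_)
  simp [hθ]

/-- The frequency `√((2π|k|)² + m²)` of the mode with wave vector `2πk`. -/
noncomputable def lam (m : ℝ) (k : E3) : ℝ := √((2 * Real.pi * ‖k‖) ^ 2 + m ^ 2)

/-- The 2π of the Fourier convention is moved into a rescaled mass m/(2π) and, in `cexp_lam`, a
rescaled time 2πt, which brings in the phase `disp`. -/
lemma lam_eq (m : ℝ) (k : E3) : lam m k = 2 * Real.pi * disp (m / (2 * Real.pi)) ‖k‖ := by
  have hpi := Real.pi_pos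
  rw [lam, disp]
  rw [show (2 * Real.pi * ‖k‖) ^ 2 + m ^ 2 =
    (2 * Real.pi) ^ 2 * (‖k‖ ^ 2 + (m / (2 * Real.pi)) ^ 2) by field_simp,
    Real.sqrt_mul (by positivity), Real.sqrt_sq (by positivity)]

lemma cexp_lam (m t : ℝ) (k : E3) : Complex.exp (Complex.I * t * lam m k) =
    osc (m / (2 * Real.pi)) (2 * Real.pi * t) ‖k‖ := by
  rw [osc, lam_eq]; congr 1; push_cast; ring

lemma wt_two_pi_mul_le (t : ℝ) : wt (2 * Real.pi * t) ≤ wt t := by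
  refine wt_anti ?_
  rw [abs_mul, abs_of_pos Real.two_pi_pos]
  nlinarith [Real.pi_gt_three, abs_nonneg t]

section Plane

variable (s : 𝓢(E3, ℂ)) (θ : E3) (c : ℝ)

/-- A Schwartz function along a ray, modulated by a plane wave. -/
noncomputable def ray₀ (r : ℝ) : ℂ := Complex.exp (Complex.I * c * r) * s (r • θ)

/-- The first derivative of `ray₀`. -/
noncomputable def ray₁ (r : ℝ) : ℂ := Complex.exp (Complex.I * c * r) *
  (Complex.I * c * s (r • θ) + (∂^{fun _ : Fin 1 => θ} s) (r • θ))

/-- The second derivative of `ray₀`. -/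
noncomputable def ray₂ (r : ℝ) : ℂ := Complex.exp (Complex.I * c * r) *
  ((Complex.I * c) ^ 2 * s (r • θ) + 2 * (Complex.I * c) * (∂^{fun _ : Fin 1 => θ} s) (r • θ) +
    (∂^{fun _ : Fin 2 => θ} s) (r • θ))

lemma hasDerivAt_cexp_I_mul (r : ℝ) : HasDerivAt (fun r : ℝ => Complex.exp (Complex.I * c * r))
    (Complex.exp (Complex.I * c * r) * (Complex.I * c)) r := by
  have := (((Complex.ofRealCLM.hasDerivAt (x := r)).const_mul (Complex.I * c))).cexp
  simpa using this

lemma hasDerivAt_schwartz_ray_zero (r : ℝ) :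
    HasDerivAt (fun r : ℝ => s (r • θ)) ((∂^{fun _ : Fin 1 => θ} s) (r • θ)) r := by
  simpa using hasDerivAt_schwartz_ray s θ 0 r

lemma hasDerivAt_ray₀ (r : ℝ) : HasDerivAt (ray₀ s θ c) (ray₁ s θ c r) r := by
  convert! (hasDerivAt_cexp_I_mul c r).mul (hasDerivAt_schwartz_ray_zero s θ r) using 1
  rw [ray₁]; ring

lemma hasDerivAt_ray₁ (r : ℝ) : HasDerivAt (ray₁ s θ c) (ray₂ s θ c r) r := by
  convert! (hasDerivAt_cexp_I_mul c r).mul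
    (((hasDerivAt_schwartz_ray_zero s θ r).const_mul (Complex.I * c)).add
      (hasDerivAt_schwartz_ray s θ 1 r)) using 1
  simp only [Pi.add_apply]
  rw [ray₂]; ring

variable {s θ c}

lemma norm_cexp_I_mul_mul (c r : ℝ) : ‖Complex.exp (Complex.I * c * r)‖ = 1 := by
  rw [Complex.norm_exp]; simp

lemma norm_ray₀_le {A r w : ℝ} (hw : 0 ≤ w) (h₀ : w * ‖s (r • θ)‖ ≤ A) :
    w * ‖ray₀ s θ c r‖ ≤ (1 + |c|) ^ 2 * A := by
  have hA : 0 ≤ A := le_trans (by positivity) h₀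
  rw [ray₀, norm_mul, norm_cexp_I_mul_mul, one_mul]
  refine h₀.trans (le_mul_of_one_le_left hA ?_)
  nlinarith [abs_nonneg c]

lemma norm_ray₁_le {A r w : ℝ} (hw : 0 ≤ w) (h₀ : w * ‖s (r • θ)‖ ≤ A)
    (h₁ : w * ‖(∂^{fun _ : Fin 1 => θ} s) (r • θ)‖ ≤ A) :
    w * ‖ray₁ s θ c r‖ ≤ (1 + |c|) ^ 2 * A := by
  have hA : 0 ≤ A := le_trans (by positivity) h₀
  have hc := abs_nonneg c
  rw [ray₁, norm_mul, norm_cexp_I_mul_mul, one_mul]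
  calc _ ≤ w * (|c| * ‖s (r • θ)‖ + ‖(∂^{fun _ : Fin 1 => θ} s) (r • θ)‖) := by
        gcongr
        refine (norm_add_le _ _).trans (le_of_eq ?_)
        simp
    _ ≤ |c| * A + A := by nlinarith
    _ ≤ _ := by nlinarith [mul_nonneg hc hA, mul_nonneg (mul_nonneg hc hc) hA]

/-- The Leibniz coefficients |c|², 2|c|, 1 add up to (1 + |c|)², which also covers the two lower
derivatives. -/
lemma norm_ray₂_le {A r w : ℝ} (hw : 0 ≤ w) (h₀ : w * ‖s (r • θ)‖ ≤ A)
    (h₁ : w * ‖(∂^{fun _ : Fin 1 => θ} s) (r • θ)‖ ≤ A)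
    (h₂ : w * ‖(∂^{fun _ : Fin 2 => θ} s) (r • θ)‖ ≤ A) :
    w * ‖ray₂ s θ c r‖ ≤ (1 + |c|) ^ 2 * A := by
  have hA : 0 ≤ A := le_trans (by positivity) h₀
  have hc := abs_nonneg c
  rw [ray₂, norm_mul, norm_cexp_I_mul_mul, one_mul]
  calc _ ≤ w * (|c| ^ 2 * ‖s (r • θ)‖ + 2 * |c| * ‖(∂^{fun _ : Fin 1 => θ} s) (r • θ)‖ +
        ‖(∂^{fun _ : Fin 2 => θ} s) (r • θ)‖) := by
        gcongr
        refine (norm_add₃_le).trans (le_of_eq ?_)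
        simp
    _ = |c| ^ 2 * (w * ‖s (r • θ)‖) + 2 * |c| * (w * ‖(∂^{fun _ : Fin 1 => θ} s) (r • θ)‖) +
        w * ‖(∂^{fun _ : Fin 2 => θ} s) (r • θ)‖ := by ring
    _ ≤ |c| ^ 2 * A + 2 * |c| * A + A := by gcongr
    _ = _ := by ring

end Plane

/-- Decay in time of the free evolution `exp (i t √(-Δ + m²))` of a Schwartz function, uniformly
on balls. -/
lemma exists_norm_integral_cexp_lam_le (s : 𝓢(E3, ℂ)) {m : ℝ} (hm : 0 ≤ m) {R : ℝ} (hR : 0 ≤ R) :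
    ∃ C, 0 ≤ C ∧ ∀ x : E3, ‖x‖ ≤ R → ∀ t : ℝ,
      ‖∫ k, Complex.exp (Complex.I * ((2 * Real.pi * inner ℝ x k : ℝ) : ℂ)) * s k *
        Complex.exp (Complex.I * t * lam m k)‖ ≤ C * wt t ∧
      ‖∫ k, Complex.exp (Complex.I * ((2 * Real.pi * inner ℝ x k : ℝ) : ℂ)) * s k *
        (Complex.exp (Complex.I * t * lam m k) / lam m k)‖ ≤ C * wt t := by
  obtain ⟨A, hA0, hA⟩ := exists_schwartz_ray_bound s 4
  set m' := m / (2 * Real.pi) with hm'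
  have hm'0 : 0 ≤ m' := by positivity
  -- For ‖x‖ ≤ R the plane wave along a ray has frequency at most 2πR, so all constants are uniform
  -- in x and in the direction.
  set A' := (1 + 2 * Real.pi * R) ^ 2 * A with hA'
  have hA'0 : 0 ≤ A' := by positivity
  set S := (volume : Measure E3).toSphere.real univ with hS
  have hS0 : 0 ≤ S := measureReal_nonneg
  refine ⟨168 * (1 + m') ^ 2 * A' * S, by positivity, fun x hx t => ?_⟩
  have hcθ : ∀ θ : E3, ‖θ‖ = 1 → (1 + |2 * Real.pi * inner ℝ x θ|) ^ 2 * A ≤ A' := fun θ hθ => by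
    rw [hA', abs_mul, abs_of_pos Real.two_pi_pos]
    have : |inner ℝ x θ| ≤ R := (abs_real_inner_le_norm x θ).trans (by rw [hθ, mul_one]; exact hx)
    gcongr
  have hwt := wt_nonneg (2 * Real.pi * t)
  have b₀ : ∀ θ : E3, ‖θ‖ = 1 → ∀ r, 0 < r → (1 + r) ^ 4 * ‖s (r • θ)‖ ≤ A :=
    fun θ hθ r hr => by simpa using hA 0 (by norm_num) θ hθ r hr
  have b₁ : ∀ θ : E3, ‖θ‖ = 1 → ∀ r, 0 < r →
      (1 + r) ^ 4 * ‖(∂^{fun _ : Fin 1 => θ} s) (r • θ)‖ ≤ A := hA 1 (by norm_num)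
  have b₂ : ∀ θ : E3, ‖θ‖ = 1 → ∀ r, 0 < r →
      (1 + r) ^ 4 * ‖(∂^{fun _ : Fin 2 => θ} s) (r • θ)‖ ≤ A := hA 2 (by norm_num)
  have hray : ∀ (θ : E3) (r : ℝ), Complex.exp (Complex.I * ((2 * Real.pi * inner ℝ x (r • θ) : ℝ) : ℂ))
      * s (r • θ) = ray₀ s θ (2 * Real.pi * inner ℝ x θ) r := fun θ r => by
    rw [ray₀, inner_smul_right]; congr 2; push_cast; ring
  have hn : ∀ θ : E3, ‖θ‖ = 1 → ∀ r, 0 < r → ‖r • θ‖ = r := fun θ hθ r hr => by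
    rw [norm_smul, hθ, mul_one, Real.norm_of_nonneg hr.le]
  constructor
  · refine (norm_integral_le_of_polar (C := 168 * (1 + m') ^ 2 * A' * wt (2 * Real.pi * t))
      (by positivity) fun θ hθ => ?_).trans ?_
    · have key := norm_integral_sq_mul_osc_le (m := m') (t := 2 * Real.pi * t) (A := A') hm'0
        (hasDerivAt_ray₀ s θ (2 * Real.pi * inner ℝ x θ))
        (hasDerivAt_ray₁ s θ (2 * Real.pi * inner ℝ x θ))
        (fun r hr => (norm_ray₀_le (by positivity) (b₀ θ hθ r hr)).trans (hcθ θ hθ))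
        (fun r hr => (norm_ray₁_le (by positivity) (b₀ θ hθ r hr) (b₁ θ hθ r hr)).trans (hcθ θ hθ))
        (fun r hr => (norm_ray₂_le (by positivity) (b₀ θ hθ r hr) (b₁ θ hθ r hr)
          (b₂ θ hθ r hr)).trans (hcθ θ hθ))
      refine (le_of_eq ?_).trans key
      congr 1
      refine setIntegral_congr_fun measurableSet_Ioi fun r hr => ?_
      simp only [hray, cexp_lam]
      rw [hn θ hθ r hr, Complex.real_smul]; ring
    · rw [mul_right_comm]
      exact mul_le_mul_of_nonneg_left (wt_two_pi_mul_le t) (by positivity)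
  · refine (norm_integral_le_of_polar (C := 168 * (1 + m') ^ 2 * A' * wt (2 * Real.pi * t))
      (by positivity) fun θ hθ => ?_).trans ?_
    · have key := norm_integral_sq_div_disp_mul_osc_le (m := m') (t := 2 * Real.pi * t) (A := A')
        hm'0
        (hasDerivAt_ray₀ s θ (2 * Real.pi * inner ℝ x θ))
        (hasDerivAt_ray₁ s θ (2 * Real.pi * inner ℝ x θ))
        (fun r hr => (norm_ray₀_le (by positivity) (b₀ θ hθ r hr)).trans (hcθ θ hθ))
        (fun r hr => (norm_ray₁_le (by positivity) (b₀ θ hθ r hr) (b₁ θ hθ r hr)).trans (hcθ θ hθ))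
        (fun r hr => (norm_ray₂_le (by positivity) (b₀ θ hθ r hr) (b₁ θ hθ r hr)
          (b₂ θ hθ r hr)).trans (hcθ θ hθ))
      have e : ∫ r in Ioi (0 : ℝ), (r ^ 2 : ℝ) •
          (Complex.exp (Complex.I * ((2 * Real.pi * inner ℝ x (r • θ) : ℝ) : ℂ)) * s (r • θ) *
            (Complex.exp (Complex.I * t * lam m (r • θ)) / lam m (r • θ))) =
          ((2 * Real.pi : ℝ) : ℂ)⁻¹ * ∫ r in Ioi (0 : ℝ), ((r ^ 2 / disp m' r : ℝ) : ℂ) *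
            ray₀ s θ (2 * Real.pi * inner ℝ x θ) r * osc m' (2 * Real.pi * t) r := by
        rw [← integral_const_mul]
        refine setIntegral_congr_fun measurableSet_Ioi fun r hr => ?_
        simp only [hray, cexp_lam]
        rw [lam_eq, hn θ hθ r hr, Complex.real_smul]
        push_cast
        rw [div_eq_mul_inv, mul_inv, mul_inv]
        ring
      rw [e, norm_mul, norm_inv, Complex.norm_real, Real.norm_of_nonneg Real.two_pi_pos.le]
      calc _ ≤ 1 * (63 * (1 + m') * A' * wt (2 * Real.pi * t)) := by
            gcongr
            exact inv_le_one_of_one_le₀ (by linarith [Real.pi_gt_three])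
        _ ≤ _ := by
            rw [one_mul]
            gcongr ?_ * A' * _
            nlinarith
    · rw [mul_right_comm]
      exact mul_le_mul_of_nonneg_left (wt_two_pi_mul_le t) (by positivity)

/-- A Schwartz amplitude with a double zero at the origin gains one power of decay. -/
lemma exists_norm_integral_inner_mul_cexp_lam_le (s : 𝓢(E3, ℂ)) {m : ℝ} (hm : 0 ≤ m) (i j : Fin 3) :
    ∃ C, 0 ≤ C ∧ ∀ t : ℝ,
      (1 + |t|) * ‖∫ k : E3, ((k i * k j : ℝ) : ℂ) * s k *
        (Complex.exp (Complex.I * t * lam m k) / lam m k)‖ ≤ C * wt t := by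
  obtain ⟨A, hA0, hA⟩ := exists_schwartz_ray_bound s 5
  set m' := m / (2 * Real.pi) with hm'
  have hm'0 : 0 ≤ m' := by positivity
  set S := (volume : Measure E3).toSphere.real univ with hS
  have hS0 : 0 ≤ S := measureReal_nonneg
  refine ⟨2016 * (1 + m') ^ 2 * A * S, by positivity, fun t => ?_⟩
  have ht0 : 0 < 1 + |2 * Real.pi * t| := by positivity
  have hwt := wt_nonneg (2 * Real.pi * t)
  have hn : ∀ θ : E3, ‖θ‖ = 1 → ∀ r, 0 < r → ‖r • θ‖ = r := fun θ hθ r hr => by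
    rw [norm_smul, hθ, mul_one, Real.norm_of_nonneg hr.le]
  have h1 : ‖∫ k : E3, ((k i * k j : ℝ) : ℂ) * s k *
        (Complex.exp (Complex.I * t * lam m k) / lam m k)‖ ≤
      2016 * (1 + m') ^ 2 * A * wt (2 * Real.pi * t) / (1 + |2 * Real.pi * t|) * S := by
    refine norm_integral_le_of_polar (by positivity) fun θ hθ => ?_
    have key := norm_integral_pow_four_div_disp_mul_osc_le (m := m') (t := 2 * Real.pi * t)
      (A := A) hm'0 (hasDerivAt_schwartz_ray s θ 0) (hasDerivAt_schwartz_ray s θ 1)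
      (hasDerivAt_schwartz_ray s θ 2) (hA 0 (by norm_num) θ hθ) (hA 1 (by norm_num) θ hθ)
      (hA 2 (by norm_num) θ hθ) (hA 3 le_rfl θ hθ)
    rw [le_div_iff₀ ht0, mul_comm]
    refine le_trans ?_ key
    gcongr
    have e : ∫ r in Ioi (0 : ℝ), (r ^ 2 : ℝ) • ((((r • θ : E3) i * (r • θ : E3) j : ℝ) : ℂ) *
          s (r • θ) * (Complex.exp (Complex.I * t * lam m (r • θ)) / lam m (r • θ))) =
        (((2 * Real.pi : ℝ) : ℂ)⁻¹ * ((θ i * θ j : ℝ) : ℂ)) * ∫ r in Ioi (0 : ℝ),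
          ((r ^ 4 / disp m' r : ℝ) : ℂ) * (∂^{fun _ : Fin 0 => θ} s) (r • θ) *
            osc m' (2 * Real.pi * t) r := by
      rw [← integral_const_mul]
      refine setIntegral_congr_fun measurableSet_Ioi fun r hr => ?_
      simp only [cexp_lam]
      rw [lam_eq, hn θ hθ r hr, Complex.real_smul]
      simp only [PiLp.smul_apply, smul_eq_mul, iteratedLineDerivOp_fin_zero]
      push_cast
      rw [div_eq_mul_inv, mul_inv]
      ring
    rw [e, norm_mul]
    refine mul_le_of_le_one_left (norm_nonneg _) ?_
    rw [norm_mul, norm_inv, Complex.norm_real, Complex.norm_real,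
      Real.norm_of_nonneg Real.two_pi_pos.le, norm_mul]
    have hi : ‖θ i‖ ≤ 1 := hθ ▸ PiLp.norm_apply_le θ i
    have hj : ‖θ j‖ ≤ 1 := hθ ▸ PiLp.norm_apply_le θ j
    have hp : (2 * Real.pi)⁻¹ ≤ 1 := inv_le_one_of_one_le₀ (by linarith [Real.pi_gt_three])
    have hp0 : 0 ≤ (2 * Real.pi)⁻¹ := by positivity
    calc _ ≤ 1 * (1 * (1 : ℝ)) := by gcongr
      _ = 1 := by norm_num
  have h2 : 1 + |t| ≤ 1 + |2 * Real.pi * t| := by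
    rw [abs_mul, abs_of_pos Real.two_pi_pos]
    nlinarith [Real.pi_gt_three, abs_nonneg t]
  calc _ ≤ (1 + |2 * Real.pi * t|) *
        (2016 * (1 + m') ^ 2 * A * wt (2 * Real.pi * t) / (1 + |2 * Real.pi * t|) * S) := by gcongr
    _ = 2016 * (1 + m') ^ 2 * A * S * wt (2 * Real.pi * t) := by field_simp
    _ ≤ _ := mul_le_mul_of_nonneg_left (wt_two_pi_mul_le t) (by positivity)

lemma lam_nonneg (m : ℝ) (k : E3) : 0 ≤ lam m k := Real.sqrt_nonneg _

lemma continuous_lam (m : ℝ) : Continuous (lam m) := by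
  unfold lam; fun_prop

lemma lam_sq (m : ℝ) (k : E3) : lam m k ^ 2 = (2 * Real.pi * ‖k‖) ^ 2 + m ^ 2 :=
  Real.sq_sqrt (by positivity)

lemma two_pi_norm_le_lam (m : ℝ) (k : E3) : 2 * Real.pi * ‖k‖ ≤ lam m k :=
  Real.le_sqrt_of_sq_le (by nlinarith [sq_nonneg m])

lemma norm_le_lam (m : ℝ) (k : E3) : ‖k‖ ≤ lam m k :=
  le_trans (by nlinarith [Real.pi_gt_three, norm_nonneg k]) (two_pi_norm_le_lam m k)

lemma lam_pos (m : ℝ) {k : E3} (hk : k ≠ 0) : 0 < lam m k :=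
  (norm_pos_iff.mpr hk).trans_le (norm_le_lam m k)

lemma abs_mul_apply_le (k : E3) (i j : Fin 3) : |k i * k j| ≤ ‖k‖ ^ 2 := by
  rw [abs_mul, sq]
  exact mul_le_mul (PiLp.norm_apply_le k i) (PiLp.norm_apply_le k j) (abs_nonneg _) (norm_nonneg _)

/-- As λ ≥ |k| and |k_i k_j| ≤ |k|², the zero of the numerator cancels the possible singularity of
1/λ, even for mass zero. -/
lemma norm_mul_apply_mul_sin_le (s : 𝓢(E3, ℂ)) (m : ℝ) (i j : Fin 3) (t : ℝ) (k : E3) :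
    ‖((k i * k j : ℝ) : ℂ) * s k * ((Real.sin (t * lam m k) / lam m k : ℝ) : ℂ)‖ ≤
      ‖k‖ ^ 1 * ‖s k‖ := by
  rcases eq_or_ne k 0 with rfl | hk
  · simp
  have hl := lam_pos m hk
  rw [norm_mul, norm_mul, Complex.norm_real, Complex.norm_real, Real.norm_eq_abs, Real.norm_eq_abs,
    abs_div, abs_of_pos hl]
  have h1 : |Real.sin (t * lam m k)| / lam m k ≤ 1 / ‖k‖ :=
    div_le_div₀ zero_le_one (Real.abs_sin_le_one _) (norm_pos_iff.mpr hk) (norm_le_lam m k)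
  calc _ ≤ ‖k‖ ^ 2 * ‖s k‖ * (1 / ‖k‖) := by
        gcongr
        exact abs_mul_apply_le k i j
    _ = _ := by have := norm_ne_zero_iff.mpr hk; field_simp

lemma integrable_mul_apply_mul_sin (s : 𝓢(E3, ℂ)) (m : ℝ) (i j : Fin 3) (t : ℝ) :
    Integrable fun k : E3 =>
      ((k i * k j : ℝ) : ℂ) * s k * ((Real.sin (t * lam m k) / lam m k : ℝ) : ℂ) := by
  refine (s.integrable_pow_mul volume 1).mono' ?_
    (ae_of_all _ (norm_mul_apply_mul_sin_le s m i j t))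
  have := (continuous_lam m).measurable
  have := s.continuous.measurable
  refine Measurable.aestronglyMeasurable ?_
  fun_prop

/-- The retarded response `∫ kᵢ kⱼ s(k) sin(t λ(k)) / λ(k) dk`. -/
noncomputable def retarded (m : ℝ) (s : 𝓢(E3, ℂ)) (i j : Fin 3) (t : ℝ) : ℂ :=
  ∫ k : E3, ((k i * k j : ℝ) : ℂ) * s k * ((Real.sin (t * lam m k) / lam m k : ℝ) : ℂ)

lemma continuous_retarded (m : ℝ) (s : 𝓢(E3, ℂ)) (i j : Fin 3) : Continuous (retarded m s i j) := by
  refine continuous_of_dominated (fun t => (integrable_mul_apply_mul_sin s m i j t).1)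
    (fun t => ae_of_all _ (norm_mul_apply_mul_sin_le s m i j t)) (s.integrable_pow_mul volume 1)
    (ae_of_all _ fun k => ?_)
  fun_prop

/-- The sine is half the difference of the exponentials at times t and -t, divided by i. -/
lemma exists_norm_retarded_le (s : 𝓢(E3, ℂ)) {m : ℝ} (hm : 0 ≤ m) (i j : Fin 3) :
    ∃ C, 0 ≤ C ∧ ∀ t : ℝ, (1 + |t|) * ‖retarded m s i j t‖ ≤ C * wt t := by
  obtain ⟨C, hC, h⟩ := exists_norm_integral_inner_mul_cexp_lam_le s hm i j
  refine ⟨C, hC, fun t => ?_⟩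
  set f : ℝ → E3 → ℂ := fun t k => ((k i * k j : ℝ) : ℂ) * s k *
    (Complex.exp (Complex.I * t * lam m k) / lam m k) with hf
  have hfi : ∀ t, Integrable (f t) := fun t => by
    refine (s.integrable_pow_mul volume 1).mono' ?_ (ae_of_all _ fun k => ?_)
    · have := (continuous_lam m).measurable
      have := s.continuous.measurable
      refine Measurable.aestronglyMeasurable ?_
      fun_prop
    · rcases eq_or_ne k 0 with rfl | hk
      · simp [hf]
      have hl := lam_pos m hk
      have he : ‖Complex.exp (Complex.I * t * lam m k)‖ = 1 := by rw [Complex.norm_exp]; simp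
      rw [hf, norm_mul, norm_mul, norm_div, he, Complex.norm_real, Complex.norm_real,
        Real.norm_eq_abs, Real.norm_of_nonneg hl.le]
      have h1 : 1 / lam m k ≤ 1 / ‖k‖ :=
        div_le_div₀ zero_le_one le_rfl (norm_pos_iff.mpr hk) (norm_le_lam m k)
      calc _ ≤ ‖k‖ ^ 2 * ‖s k‖ * (1 / ‖k‖) := by
            gcongr
            exact abs_mul_apply_le k i j
        _ = _ := by have := norm_ne_zero_iff.mpr hk; field_simp
  have e : retarded m s i j t = (2 * Complex.I)⁻¹ * ((∫ k, f t k) - ∫ k, f (-t) k) := by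
    rw [← integral_sub (hfi t) (hfi (-t)), ← integral_const_mul, retarded]
    congr 1 with k
    simp only [hf]
    push_cast
    rw [Complex.sin]
    have e1 : Complex.I * (t : ℂ) * lam m k = t * lam m k * Complex.I := by ring
    have e2 : Complex.I * (-t : ℂ) * lam m k = -(t * lam m k) * Complex.I := by ring
    rw [e1, e2, mul_inv, Complex.inv_I]
    ring
  have h1 := h t
  have h2 := h (-t)
  rw [abs_neg, wt_neg] at h2
  change _ * ‖∫ k, f t k‖ ≤ _ at h1
  change _ * ‖∫ k, f (-t) k‖ ≤ _ at h2
  rw [e, norm_mul, norm_inv, norm_mul, Complex.norm_I]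
  have h3 := norm_sub_le (∫ k, f t k) (∫ k, f (-t) k)
  have h4 := mul_le_mul_of_nonneg_left h3 (show 0 ≤ 1 + |t| by positivity)
  norm_num
  nlinarith

/-! ### The memory kernel. -/

/-- The complexified configuration space of the particle. -/
abbrev V3 : Type := EuclideanSpace ℂ (Fin 3)

/-- The matrix unit `v ↦ v j • eᵢ`. -/
noncomputable def matUnit (i j : Fin 3) : V3 →L[ℂ] V3 :=
  (EuclideanSpace.proj j : V3 →L[ℂ] ℂ).smulRight (EuclideanSpace.single i 1)

lemma matUnit_apply (i j i' : Fin 3) (v : V3) : matUnit i j v i' = if i' = i then v j else 0 := by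
  simp [matUnit]

/-- The memory kernel of the particle generated by the fields. -/
noncomputable def memoryKernel {d : ℕ} (m : Fin d → ℝ) (s : Fin d → 𝓢(E3, ℂ)) (t : ℝ) :
    V3 →L[ℂ] V3 :=
  ∑ n, ∑ i, ∑ j, (4 * (Real.pi : ℂ) ^ 2 * retarded (m n) (s n) i j t) • matUnit i j

lemma memoryKernel_apply {d : ℕ} (m : Fin d → ℝ) (s : Fin d → 𝓢(E3, ℂ)) (t : ℝ) (v : V3)
    (i : Fin 3) : memoryKernel m s t v i =
      ∑ n, ∑ j, 4 * (Real.pi : ℂ) ^ 2 * retarded (m n) (s n) i j t * v j := by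
  simp only [memoryKernel, Finset.sum_apply, WithLp.ofLp_sum,
    sum_apply, smul_apply, PiLp.smul_apply, matUnit_apply, smul_eq_mul]
  refine Finset.sum_congr rfl fun n _ => ?_
  rw [Finset.sum_comm]
  refine Finset.sum_congr rfl fun j _ => ?_
  simp

lemma continuous_memoryKernel {d : ℕ} (m : Fin d → ℝ) (s : Fin d → 𝓢(E3, ℂ)) :
    Continuous (memoryKernel m s) := by
  unfold memoryKernel
  have := fun n i j => continuous_retarded (m n) (s n) i j
  fun_prop

lemma exists_norm_memoryKernel_le {d : ℕ} {m : Fin d → ℝ} (hm : ∀ n, 0 ≤ m n)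
    (s : Fin d → 𝓢(E3, ℂ)) :
    ∃ A, ∀ t, 0 ≤ t → (1 + t) * ‖memoryKernel m s t‖ ≤ A * wt t := by
  choose C hC h using fun n i j => exists_norm_retarded_le (s n) (hm n) i j
  refine ⟨∑ n, ∑ i, ∑ j, 4 * Real.pi ^ 2 * C n i j * ‖matUnit i j‖, fun t ht => ?_⟩
  simp only [Finset.sum_mul]
  have h1 : ‖memoryKernel m s t‖ ≤
      ∑ n, ∑ i, ∑ j, 4 * Real.pi ^ 2 * ‖retarded (m n) (s n) i j t‖ * ‖matUnit i j‖ := by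
    refine (norm_sum_le _ _).trans (Finset.sum_le_sum fun n _ => (norm_sum_le _ _).trans
      (Finset.sum_le_sum fun i _ => (norm_sum_le _ _).trans (Finset.sum_le_sum fun j _ => ?_)))
    rw [norm_smul, norm_mul]
    simp [abs_of_pos Real.pi_pos]
  refine (mul_le_mul_of_nonneg_left h1 (by positivity)).trans ?_
  simp only [Finset.mul_sum]
  refine Finset.sum_le_sum fun n _ => Finset.sum_le_sum fun i _ => Finset.sum_le_sum fun j _ => ?_
  have h2 := h n i j t
  rw [abs_of_nonneg ht] at h2
  calc _ = 4 * Real.pi ^ 2 * ((1 + t) * ‖retarded (m n) (s n) i j t‖) * ‖matUnit i j‖ := by ring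
    _ ≤ 4 * Real.pi ^ 2 * (C n i j * wt t) * ‖matUnit i j‖ := by gcongr
    _ = _ := by ring

/-! ### The dispersion relation has no root in the closed right half-plane. -/

lemma add_sq_ne_zero (a : ℝ) {z : ℂ} (hz : 0 < z.re) : (a : ℂ) ^ 2 + z ^ 2 ≠ 0 := by
  have e : (a : ℂ) ^ 2 + z ^ 2 = (z + a * Complex.I) * (z - a * Complex.I) := by
    ring_nf; rw [Complex.I_sq]; ring
  rw [e]
  refine mul_ne_zero (fun h => ?_) (fun h => ?_)
  · have := congrArg Complex.re h; simp at this; linarith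
  · have := congrArg Complex.re h; simp at this; linarith

lemma integral_cexp_neg_mul_sin (a : ℝ) {z : ℂ} (hz : 0 < z.re) :
    ∫ t in Ioi (0 : ℝ), Complex.exp (-z * t) * Complex.sin (t * a) = a / (a ^ 2 + z ^ 2) := by
  have h1 : (-z - a * Complex.I).re < 0 := by simpa using hz
  have h2 : (-z + a * Complex.I).re < 0 := by simpa using hz
  have e : ∀ t : ℝ, Complex.exp (-z * t) * Complex.sin (t * a) =
      (Complex.exp ((-z - a * Complex.I) * t) - Complex.exp ((-z + a * Complex.I) * t)) *
        (Complex.I / 2) := fun t => by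
    rw [Complex.sin, mul_div_assoc', ← mul_div_assoc, ← mul_assoc, mul_sub, ← Complex.exp_add,
      ← Complex.exp_add]
    congr 4 <;> ring_nf
  simp_rw [e]
  rw [integral_mul_const, integral_sub (integrableOn_exp_mul_complex_Ioi h1 0)
    (integrableOn_exp_mul_complex_Ioi h2 0), integral_exp_mul_complex_Ioi h1,
    integral_exp_mul_complex_Ioi h2]
  have h3 : -z - a * Complex.I ≠ 0 := fun h => by rw [h] at h1; simp at h1
  have h4 : -z + a * Complex.I ≠ 0 := fun h => by rw [h] at h2; simp at h2
  have h5 := add_sq_ne_zero a hz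
  have e5 : (a : ℂ) ^ 2 + z ^ 2 = (-z - a * Complex.I) * (-z + a * Complex.I) := by
    ring_nf; rw [Complex.I_sq]; ring
  simp only [Complex.ofReal_zero, mul_zero, Complex.exp_zero]
  rw [e5]
  field_simp
  ring_nf
  rw [Complex.I_sq]; ring

/-- Fubini with majorant exp(-t Re z) |w| / λ, followed by the Laplace transform of the sine for
each k. The point k = 0, where λ may vanish, is negligible. -/
lemma laplace_integral_mul_sin {w : E3 → ℝ} {m : ℝ} (hw : Integrable fun k => w k / lam m k)
    {z : ℂ} (hz : 0 < z.re) :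
    laplace (fun t => ∫ k, ((w k * (Real.sin (t * lam m k) / lam m k) : ℝ) : ℂ)) z =
      ∫ k, (w k : ℂ) / (lam m k ^ 2 + z ^ 2) := by
  have hlm := (continuous_lam m).measurable
  have hexp : Integrable (fun t : ℝ => Real.exp (-z.re * t)) (volume.restrict (Ioi 0)) :=
    integrableOn_exp_mul_Ioi (by linarith) 0
  have hint : Integrable (fun p : ℝ × E3 => Complex.exp (-z * p.1) •
      ((w p.2 * (Real.sin (p.1 * lam m p.2) / lam m p.2) : ℝ) : ℂ))
      ((volume.restrict (Ioi 0)).prod volume) := by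
    refine (hexp.mul_prod hw).norm.mono' ?_ (ae_of_all _ fun p => ?_)
    · have e : ∀ p : ℝ × E3, Complex.exp (-z * p.1) •
          ((w p.2 * (Real.sin (p.1 * lam m p.2) / lam m p.2) : ℝ) : ℂ) =
          (Complex.exp (-z * p.1) * Complex.sin (p.1 * lam m p.2)) *
            ((w p.2 / lam m p.2 : ℝ) : ℂ) := fun p => by push_cast; rw [smul_eq_mul]; ring
      simp_rw [e]
      refine AEStronglyMeasurable.mul (Measurable.aestronglyMeasurable (by fun_prop)) ?_
      exact Complex.continuous_ofReal.comp_aestronglyMeasurable hw.1.comp_snd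
    · have h1 : ‖Complex.exp (-z * p.1)‖ = Real.exp (-z.re * p.1) := by
        rw [Complex.norm_exp]; simp
      rw [norm_smul, h1, Complex.norm_real, norm_mul, norm_mul, norm_div, norm_div,
        Real.norm_of_nonneg (Real.exp_pos _).le]
      have h2 : ‖Real.sin (p.1 * lam m p.2)‖ ≤ 1 := Real.abs_sin_le_one _
      gcongr ?_ * ?_
      rw [mul_div_assoc']
      gcongr
      exact mul_le_of_le_one_right (norm_nonneg _) h2
  have h0 : ∀ᵐ k : E3, k ≠ 0 := by simp [ae_iff, measure_singleton]
  rw [laplace]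
  simp_rw [← integral_smul]
  rw [integral_integral_swap hint]
  refine integral_congr_ae (h0.mono fun k hk => ?_)
  have hl : (lam m k : ℂ) ≠ 0 := by exact_mod_cast (lam_pos m hk).ne'
  have e : ∀ t : ℝ, Complex.exp (-z * t) •
      ((w k * (Real.sin (t * lam m k) / lam m k) : ℝ) : ℂ) =
      ((w k : ℂ) / lam m k) * (Complex.exp (-z * t) * Complex.sin (t * lam m k)) := fun t => by
    push_cast; rw [smul_eq_mul]; ring
  simp only [e]
  rw [integral_const_mul, integral_cexp_neg_mul_sin _ hz, div_mul_div_comm, mul_comm (lam m k : ℂ),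
    mul_div_mul_right _ _ hl]

/-- For `z = σ + iμ` in the right half plane, the real part of `1 / (λ² + z²)` is dominated. -/
lemma re_inv_add_sq_le {l σ μ c : ℝ} (hμ : μ ^ 2 ≤ c) (hl : c ≤ l ^ 2) (hc : c ≠ l ^ 2) :
    (((l : ℂ) ^ 2 + (σ + μ * Complex.I) ^ 2)⁻¹).re ≤ (l ^ 2 - c)⁻¹ := by
  have h1 : ((l : ℂ) ^ 2 + (σ + μ * Complex.I) ^ 2).re = l ^ 2 + σ ^ 2 - μ ^ 2 := by
    simp [sq]; ring
  have hpos : 0 < l ^ 2 - c := sub_pos.mpr (lt_of_le_of_ne hl hc)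
  refine (Complex.re_le_norm _).trans ?_
  rw [norm_inv]
  gcongr
  refine le_trans ?_ (Complex.re_le_norm _)
  rw [h1]; nlinarith

lemma im_inv_add_sq {l σ μ : ℝ} :
    (((l : ℂ) ^ 2 + (σ + μ * Complex.I) ^ 2)⁻¹).im =
      -(2 * σ * μ) / ((l ^ 2 + σ ^ 2 - μ ^ 2) ^ 2 + (2 * σ * μ) ^ 2) := by
  have h1 : ((l : ℂ) ^ 2 + (σ + μ * Complex.I) ^ 2).re = l ^ 2 + σ ^ 2 - μ ^ 2 := by
    simp [sq]; ring
  have h2 : ((l : ℂ) ^ 2 + (σ + μ * Complex.I) ^ 2).im = 2 * σ * μ := by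
    simp [sq]; ring
  rw [Complex.inv_im, Complex.normSq_apply, h1, h2]
  congr 1; ring

open scoped Pointwise

/-- Both factors z + il and z - il have modulus at least |Re z|. -/
lemma re_sq_le_norm_add_sq (l : ℝ) (z : ℂ) : z.re ^ 2 ≤ ‖(l : ℂ) ^ 2 + z ^ 2‖ := by
  have e : (l : ℂ) ^ 2 + z ^ 2 = (z + l * Complex.I) * (z - l * Complex.I) := by
    ring_nf; rw [Complex.I_sq]; ring
  have h1 := Complex.abs_re_le_norm (z + l * Complex.I)
  have h2 := Complex.abs_re_le_norm (z - l * Complex.I)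
  simp at h1 h2
  rw [e, norm_mul, ← sq_abs, sq]
  exact mul_le_mul h1 h2 (abs_nonneg _) (norm_nonneg _)

section Weight

variable {w : E3 → ℝ} {m : ℝ}

lemma integrable_weight_div (hw : Integrable w) {z : ℂ} (hz : 0 < z.re) :
    Integrable fun k => (w k : ℂ) / (lam m k ^ 2 + z ^ 2) := by
  have hlm := (continuous_lam m).measurable
  refine (hw.norm.mul_const (z.re ^ 2)⁻¹).mono' ?_ (ae_of_all _ fun k => ?_)
  · simp_rw [div_eq_mul_inv]
    refine AEStronglyMeasurable.mul ?_ (Measurable.aestronglyMeasurable (by fun_prop))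
    exact Complex.continuous_ofReal.comp_aestronglyMeasurable hw.1
  · rw [norm_div, Complex.norm_real, div_eq_mul_inv]
    gcongr
    exact re_sq_le_norm_add_sq _ z

lemma re_integral_weight_div_le (hw : Integrable w) (h0 : ∀ k, 0 ≤ w k) {c σ μ : ℝ} (hσ : 0 < σ)
    (hμ : μ ^ 2 ≤ c) (hc : ∀ k ≠ 0, c < lam m k ^ 2)
    (hi : Integrable fun k => w k / (lam m k ^ 2 - c)) :
    (∫ k, (w k : ℂ) / (lam m k ^ 2 + (σ + μ * Complex.I) ^ 2)).re ≤
      ∫ k, w k / (lam m k ^ 2 - c) := by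
  have hz : 0 < (σ + μ * Complex.I : ℂ).re := by simpa using hσ
  have hint := integrable_weight_div (m := m) hw hz
  have e := Complex.reCLM.integral_comp_comm hint
  simp only [Complex.reCLM_apply] at e
  rw [← e]
  have hk0 : ∀ᵐ k : E3, k ≠ 0 := by simp [ae_iff, measure_singleton]
  refine integral_mono_ae hint.re hi (hk0.mono fun k hk => ?_)
  change (_ / _ : ℂ).re ≤ w k / (lam m k ^ 2 - c)
  rw [div_eq_mul_inv, Complex.re_ofReal_mul, div_eq_mul_inv]
  exact mul_le_mul_of_nonneg_left (re_inv_add_sq_le hμ (hc k hk).le (hc k hk).ne) (h0 k)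

/-- The density in the imaginary part of `w / (λ² + (σ + iμ)²)`. -/
noncomputable def absorption (w : E3 → ℝ) (m σ μ : ℝ) (k : E3) : ℝ :=
  w k / ((lam m k ^ 2 + σ ^ 2 - μ ^ 2) ^ 2 + (2 * σ * μ) ^ 2)

lemma absorption_nonneg (h0 : ∀ k, 0 ≤ w k) (σ μ : ℝ) (k : E3) : 0 ≤ absorption w m σ μ k :=
  div_nonneg (h0 k) (by positivity)

lemma im_weight_div (σ μ : ℝ) (k : E3) :
    ((w k : ℂ) / (lam m k ^ 2 + (σ + μ * Complex.I) ^ 2)).im =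
      -(2 * σ * μ) * absorption w m σ μ k := by
  rw [div_eq_mul_inv, Complex.im_ofReal_mul, im_inv_add_sq, absorption]; ring

lemma integrable_absorption (hw : Integrable w) {σ μ : ℝ} (hσ : 0 < σ) (hμ : μ ≠ 0) :
    Integrable (absorption w m σ μ) := by
  have hz : 0 < (σ + μ * Complex.I : ℂ).re := by simpa using hσ
  have h := (integrable_weight_div (m := m) hw hz).im.const_mul (-(2 * σ * μ))⁻¹
  refine h.congr (ae_of_all _ fun k => ?_)
  change _ * Complex.im _ = _
  rw [im_weight_div, inv_mul_cancel_left₀]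
  simp [hσ.ne', hμ]

lemma im_integral_weight_div (hw : Integrable w) {σ : ℝ} (μ : ℝ) (hσ : 0 < σ) :
    (∫ k, (w k : ℂ) / (lam m k ^ 2 + (σ + μ * Complex.I) ^ 2)).im =
      -(2 * σ * μ) * ∫ k, absorption w m σ μ k := by
  have hz : 0 < (σ + μ * Complex.I : ℂ).re := by simpa using hσ
  have hint := integrable_weight_div (m := m) hw hz
  have e := Complex.imCLM.integral_comp_comm hint
  simp only [Complex.imCLM_apply, im_weight_div] at e
  rw [← e, integral_const_mul]

end Weight

section Shell

/-- The open cone of directions close to `a`. -/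
def cone (a : E3) : Set E3 := {k | ‖a‖ * ‖k‖ / 2 < inner ℝ a k}

lemma isOpen_cone (a : E3) : IsOpen (cone a) := isOpen_lt (by fun_prop) (by fun_prop)

/-- The cone is dilation invariant, so its part in a ball of radius r has volume proportional to r³.
-/
lemma smul_cone_inter_ball (a : E3) {r : ℝ} (hr : 0 < r) :
    r • (cone a ∩ Metric.ball 0 1) = cone a ∩ Metric.ball 0 r := by
  ext k
  rw [mem_smul_set_iff_inv_smul_mem₀ hr.ne']
  simp only [cone, mem_inter_iff, mem_ofPred_eq, mem_ball_zero_iff, norm_smul, norm_inv,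
    Real.norm_of_nonneg hr.le, inner_smul_right]
  refine and_congr ?_ ?_
  · have e : ‖a‖ * (r⁻¹ * ‖k‖) / 2 = r⁻¹ * (‖a‖ * ‖k‖ / 2) := by ring
    rw [e]
    exact mul_lt_mul_iff_right₀ (inv_pos.mpr hr)
  · rw [inv_mul_lt_iff₀ hr, mul_one]

lemma measureReal_cone_inter_ball (a : E3) {r : ℝ} (hr : 0 < r) :
    volume.real (cone a ∩ Metric.ball 0 r) = r ^ 3 * volume.real (cone a ∩ Metric.ball 0 1) := by
  rw [← smul_cone_inter_ball a hr, Measure.real, Measure.addHaar_smul_of_nonneg _ hr.le,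
    ENNReal.toReal_mul, ENNReal.toReal_ofReal (by positivity)]
  simp [Measure.real]

lemma measureReal_cone_inter_ball_pos {a : E3} (ha : a ≠ 0) :
    0 < volume.real (cone a ∩ Metric.ball 0 1) := by
  have hfin : volume (cone a ∩ Metric.ball (0 : E3) 1) ≠ ⊤ :=
    (measure_mono inter_subset_right).trans_lt measure_ball_lt_top |>.ne
  refine ENNReal.toReal_pos (IsOpen.measure_ne_zero _ ((isOpen_cone a).inter Metric.isOpen_ball)
    ?_) hfin
  have han : 0 < ‖a‖ := norm_pos_iff.mpr ha
  refine ⟨(2 * ‖a‖)⁻¹ • a, ?_, ?_⟩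
  · simp only [cone, mem_ofPred_eq, norm_smul, inner_smul_right, real_inner_self_eq_norm_sq]
    rw [Real.norm_of_nonneg (by positivity)]
    field_simp
    norm_num
  · rw [mem_ball_zero_iff, norm_smul, Real.norm_of_nonneg (by positivity)]
    field_simp
    norm_num

/-- The part of a thin spherical shell in a cone. -/
def shell (a : E3) (r σ : ℝ) : Set E3 :=
  (cone a ∩ Metric.ball 0 (r + σ)) \ (cone a ∩ Metric.ball 0 r)

lemma measurableSet_shell (a : E3) (r σ : ℝ) : MeasurableSet (shell a r σ) :=
  ((isOpen_cone a).inter Metric.isOpen_ball).measurableSet.diff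
    ((isOpen_cone a).inter Metric.isOpen_ball).measurableSet

lemma measure_shell_lt_top (a : E3) (r σ : ℝ) : volume (shell a r σ) < ⊤ :=
  (measure_mono (sdiff_subset.trans inter_subset_right)).trans_lt measure_ball_lt_top

/-- (r + σ)³ - r³ ≥ 3r²σ. -/
lemma le_measureReal_shell (a : E3) {r σ : ℝ} (hr : 0 < r) (hσ : 0 < σ) :
    3 * r ^ 2 * σ * volume.real (cone a ∩ Metric.ball 0 1) ≤ volume.real (shell a r σ) := by
  have hfin : volume (cone a ∩ Metric.ball (0 : E3) r) ≠ ⊤ :=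
    (measure_mono inter_subset_right).trans_lt measure_ball_lt_top |>.ne
  have hfin' : volume (cone a ∩ Metric.ball (0 : E3) (r + σ)) ≠ ⊤ :=
    (measure_mono inter_subset_right).trans_lt measure_ball_lt_top |>.ne
  rw [shell, measureReal_sdiff (inter_subset_inter_right _ (Metric.ball_subset_ball (by linarith)))
    ((isOpen_cone a).inter Metric.isOpen_ball).measurableSet hfin',
    measureReal_cone_inter_ball a hr, measureReal_cone_inter_ball a (add_pos hr hσ), ← sub_mul]
  refine mul_le_mul_of_nonneg_right ?_ measureReal_nonneg
  have : 0 ≤ 3 * r * σ ^ 2 + σ ^ 3 := by positivity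
  nlinarith

lemma norm_mem_shell {a k : E3} {r σ : ℝ} (hk : k ∈ shell a r σ) :
    r ≤ ‖k‖ ∧ ‖k‖ ≤ r + σ ∧ k ∈ cone a := by
  obtain ⟨⟨h1, h2⟩, h3⟩ := hk
  rw [mem_ball_zero_iff] at h2
  refine ⟨?_, h2.le, h1⟩
  by_contra! h
  exact h3 ⟨h1, mem_ball_zero_iff.mpr h⟩

/-- Absorption blows up like `1 / σ` above the threshold. -/
lemma exists_le_integral_absorption {w : E3 → ℝ} {m : ℝ} (hw : Integrable w) (h0 : ∀ k, 0 ≤ w k)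
    {a : E3} (ha : a ≠ 0)
    {μ : ℝ} (hμ : m ^ 2 < μ ^ 2) {w₀ : ℝ} (hw₀ : 0 < w₀)
    (hlow : ∀ k, 2 * Real.pi * ‖k‖ ≥ √(μ ^ 2 - m ^ 2) →
      2 * Real.pi * (‖k‖ - 1) ≤ √(μ ^ 2 - m ^ 2) → k ∈ cone a → w₀ ≤ w k) :
    ∃ κ, 0 < κ ∧ ∀ σ, 0 < σ → σ ≤ 1 → κ ≤ σ * ∫ k, absorption w m σ μ k := by
  have hpi := Real.pi_pos
  set r := √(μ ^ 2 - m ^ 2) / (2 * Real.pi) with hr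
  have hs : 0 < √(μ ^ 2 - m ^ 2) := Real.sqrt_pos.mpr (by linarith)
  have hr0 : 0 < r := by positivity
  have hrs : 2 * Real.pi * r = √(μ ^ 2 - m ^ 2) := by rw [hr]; field_simp
  have hrsq : (2 * Real.pi * r) ^ 2 = μ ^ 2 - m ^ 2 := by rw [hrs, Real.sq_sqrt (by linarith)]
  have hμ0 : μ ≠ 0 := by rintro rfl; nlinarith [sq_nonneg m]
  -- On the shell r ≤ |k| ≤ r + σ the detuning λ² + σ² - μ² lies between 0 and Bσ, so the
  -- denominator is at most Dσ². The shell has volume of order σ, and the integral is therefore at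
  -- least of order 1/σ.
  set B := (2 * Real.pi) ^ 2 * (2 * r + 1) + 1 with hB
  set D := B ^ 2 + (2 * μ) ^ 2 with hD
  have hD0 : 0 < D := by positivity
  set v := volume.real (cone a ∩ Metric.ball (0 : E3) 1) with hv
  have hv0 : 0 < v := measureReal_cone_inter_ball_pos ha
  refine ⟨3 * r ^ 2 * v * (w₀ / D), by positivity, fun σ hσ hσ1 => ?_⟩
  have hint := integrable_absorption (m := m) hw hσ hμ0
  have hset : w₀ / (D * σ ^ 2) * volume.real (shell a r σ) ≤ ∫ k, absorption w m σ μ k := by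
    calc _ = ∫ _ in shell a r σ, w₀ / (D * σ ^ 2) := by
          rw [setIntegral_const, smul_eq_mul, mul_comm]
      _ ≤ ∫ k in shell a r σ, absorption w m σ μ k := by
          refine setIntegral_mono_on (integrableOn_const (measure_shell_lt_top a r σ).ne)
            hint.integrableOn (measurableSet_shell a r σ) fun k hk => ?_
          obtain ⟨h1, h2, h3⟩ := norm_mem_shell hk
          have hwk : w₀ ≤ w k := hlow k (by rw [← hrs]; gcongr)
            (by rw [← hrs]; gcongr; linarith) h3
          have hl : lam m k ^ 2 - μ ^ 2 = (2 * Real.pi) ^ 2 * (‖k‖ ^ 2 - r ^ 2) := by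
            rw [lam_sq]; nlinarith
          have hkr : ‖k‖ ^ 2 - r ^ 2 ≤ σ * (2 * r + 1) := by nlinarith
          have hkr0 : 0 ≤ ‖k‖ ^ 2 - r ^ 2 := by nlinarith
          have hb : lam m k ^ 2 + σ ^ 2 - μ ^ 2 ≤ B * σ := by
            have : (2 * Real.pi) ^ 2 * (‖k‖ ^ 2 - r ^ 2) ≤
                (2 * Real.pi) ^ 2 * (σ * (2 * r + 1)) := by gcongr
            nlinarith
          have hb0 : 0 ≤ lam m k ^ 2 + σ ^ 2 - μ ^ 2 := by
            have : 0 ≤ (2 * Real.pi) ^ 2 * (‖k‖ ^ 2 - r ^ 2) := by positivity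
            nlinarith
          rw [absorption]
          refine div_le_div₀ (h0 k) hwk (by positivity) ?_
          have : (lam m k ^ 2 + σ ^ 2 - μ ^ 2) ^ 2 ≤ (B * σ) ^ 2 := by gcongr
          rw [hD]; nlinarith
      _ ≤ _ := setIntegral_le_integral hint (ae_of_all _ (absorption_nonneg h0 σ μ))
  have hm := le_measureReal_shell a hr0 hσ
  calc 3 * r ^ 2 * v * (w₀ / D) = σ * (w₀ / (D * σ ^ 2) * (3 * r ^ 2 * σ * v)) := by
        field_simp
    _ ≤ σ * (w₀ / (D * σ ^ 2) * volume.real (shell a r σ)) := by gcongr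
    _ ≤ _ := by gcongr

end Shell

lemma laplace_sum {d : ℕ} {h : Fin d → ℝ → ℂ} (hh : ∀ n, IntegrableOn (h n) (Ioi 0)) {z : ℂ}
    (hz : 0 ≤ z.re) : laplace (fun t => ∑ n, h n t) z = ∑ n, laplace (h n) z := by
  simp only [laplace]
  rw [← integral_finsetSum _ fun n _ => integrableOn_laplace (hh n) hz]
  simp_rw [Finset.smul_sum]

/-- The dispersion relation has no root in the closed right half plane, provided the static
coupling is weak and the field of lowest mass absorbs above its threshold. -/
lemma dispersion_ne_zero {d : ℕ} {m : Fin d → ℝ} {w : Fin d → E3 → ℝ}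
    (hw : ∀ n, Integrable (w n)) (h0 : ∀ n k, 0 ≤ w n k)
    (hwl : ∀ n, Integrable fun k => w n k / lam (m n) k) {a c ω : ℝ} (ha : 0 < a)
    (hc : ∀ n, ∀ k ≠ 0, c < lam (m n) k ^ 2)
    (hi : ∀ n, Integrable fun k => w n k / (lam (m n) k ^ 2 - c))
    (hA : ∑ n, ∫ k, w n k / (lam (m n) k ^ 2 - c) < (ω ^ 2 - c) * a) (hc0 : 0 ≤ c) (n₀ : Fin d)
    (hκ : ∀ μ : ℝ, c < μ ^ 2 → ∃ κ, 0 < κ ∧ ∀ σ, 0 < σ → σ ≤ 1 →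
      κ ≤ σ * ∫ k, absorption (w n₀) (m n₀) σ μ k)
    (hint : ∀ n, IntegrableOn (fun t : ℝ =>
      ∫ k, ((w n k * (Real.sin (t * lam (m n) k) / lam (m n) k) : ℝ) : ℂ)) (Ioi 0))
    {z : ℂ} (hz : 0 ≤ z.re) :
    (z ^ 2 + (ω : ℂ) ^ 2) * a - laplace (fun t : ℝ =>
      ∑ n, ∫ k, ((w n k * (Real.sin (t * lam (m n) k) / lam (m n) k) : ℝ) : ℂ)) z ≠ 0 := by
  set h : ℝ → ℂ := fun t => ∑ n, ∫ k,
    ((w n k * (Real.sin (t * lam (m n) k) / lam (m n) k) : ℝ) : ℂ) with hh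
  set G : ℂ → ℂ := fun z => (z ^ 2 + (ω : ℂ) ^ 2) * a - laplace h z with hG
  change G z ≠ 0
  have hhi : IntegrableOn h (Ioi 0) := integrable_finsetSum _ fun n _ => hint n
  have hGc : ContinuousOn G {z | 0 ≤ z.re} :=
    ContinuousOn.sub (by fun_prop) (continuousOn_laplace hhi)
  have hGe : ∀ σ μ : ℝ, 0 < σ → G (σ + μ * Complex.I) =
      ((σ + μ * Complex.I) ^ 2 + (ω : ℂ) ^ 2) * a -
        ∑ n, ∫ k, (w n k : ℂ) / (lam (m n) k ^ 2 + (σ + μ * Complex.I) ^ 2) := fun σ μ hσ => by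
    have hz' : 0 < (σ + μ * Complex.I : ℂ).re := by simpa using hσ
    simp only [hG, hh]
    rw [laplace_sum hint hz'.le]
    congr 1
    exact Finset.sum_congr rfl fun n _ => laplace_integral_mul_sin (hwl n) hz'
  have hzμ : z = z.re + z.im * Complex.I := (Complex.re_add_im z).symm
  set μ := z.im with hμ
  -- The formula `hGe` holds only for positive real part, so a boundary point is approached from the
  -- right and lower bounds uniform in σ are passed to the limit.
  have hlim : Tendsto (fun σ : ℝ => G (((z.re + σ : ℝ) : ℂ) + μ * Complex.I)) (𝓝[>] 0) (𝓝 (G z)) := by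
    have h1 : ContinuousWithinAt G {z | 0 ≤ z.re} z := hGc z hz
    have h2 : Tendsto (fun σ : ℝ => (((z.re + σ : ℝ) : ℂ) + μ * Complex.I)) (𝓝[>] 0)
        (𝓝[{z | 0 ≤ z.re}] z) := by
      refine tendsto_nhdsWithin_iff.mpr ⟨?_, ?_⟩
      · have h3 : Continuous fun σ : ℝ => (((z.re + σ : ℝ) : ℂ) + μ * Complex.I) := by fun_prop
        have h4 := h3.tendsto 0
        rw [add_zero, ← hzμ] at h4
        exact h4.mono_left nhdsWithin_le_nhds
      · filter_upwards [self_mem_nhdsWithin] with σ hσ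
        have : (0 : ℝ) < σ := hσ
        simp only [Complex.add_re, Complex.ofReal_re, Complex.mul_re,
          Complex.I_re, Complex.I_im, Complex.ofReal_im]
        linarith
    exact h1.tendsto.comp h2
  rcases le_or_gt (μ ^ 2) c with hle | hgt
  -- At or below the threshold: the real part is at least the static gap, whatever σ.
  · have hre : ∀ σ : ℝ, 0 < σ →
        (ω ^ 2 - c) * a - ∑ n, ∫ k, w n k / (lam (m n) k ^ 2 - c) ≤
          (G (((z.re + σ : ℝ) : ℂ) + μ * Complex.I)).re := fun σ hσ => by
      have hp : 0 < z.re + σ := by linarith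
      rw [hGe _ _ hp, Complex.sub_re, Complex.re_sum, Complex.re_mul_ofReal]
      have h1 : ((((z.re + σ : ℝ) : ℂ) + μ * Complex.I) ^ 2 + (ω : ℂ) ^ 2).re =
          (z.re + σ) ^ 2 - μ ^ 2 + ω ^ 2 := by simp [sq]
      rw [h1]
      refine sub_le_sub ?_ (Finset.sum_le_sum fun n _ =>
        re_integral_weight_div_le (hw n) (h0 n) hp hle (hc n) (hi n))
      refine mul_le_mul_of_nonneg_right ?_ ha.le
      nlinarith [sq_nonneg (z.re + σ)]
    have := ge_of_tendsto ((Complex.continuous_re.tendsto _).comp hlim)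
      (eventually_nhdsWithin_of_forall hre)
    intro h
    rw [h] at this
    simp at this
    linarith
  · have hμ0 : μ ≠ 0 := by
      intro h; rw [h] at hgt; simp at hgt; linarith
    have him : ∀ σ : ℝ, 0 < σ → (G ((σ : ℂ) + μ * Complex.I)).im =
        2 * σ * μ * (a + ∑ n, ∫ k, absorption (w n) (m n) σ μ k) := fun σ hσ => by
      rw [hGe _ _ hσ, Complex.sub_im, Complex.im_sum, Complex.im_mul_ofReal]
      have h1 : (((σ : ℂ) + μ * Complex.I) ^ 2 + (ω : ℂ) ^ 2).im = 2 * σ * μ := by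
        simp [sq]; ring
      simp_rw [h1, im_integral_weight_div (hw _) μ hσ]
      rw [← Finset.mul_sum]; ring
    have hnn : ∀ σ n, 0 ≤ ∫ k, absorption (w n) (m n) σ μ k := fun σ n =>
      integral_nonneg (absorption_nonneg (h0 n) σ μ)
    -- Above the threshold: in the interior the imaginary part is visibly nonzero. On the axis the
    -- factor σ is compensated by the blow-up of the absorption of the field n₀.
    rcases hz.lt_or_eq with hpos | hzero
    · intro h
      have h1 := him z.re hpos
      rw [← hzμ, h, Complex.zero_im] at h1
      have h2 : 0 < a + ∑ n, ∫ k, absorption (w n) (m n) z.re μ k :=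
        add_pos_of_pos_of_nonneg ha (Finset.sum_nonneg fun n _ => hnn _ n)
      simp [hpos.ne', hμ0, h2.ne'] at h1
    · obtain ⟨κ, hκ0, hκ⟩ := hκ μ hgt
      have hbd : ∀ᶠ σ : ℝ in 𝓝[>] 0,
          2 * |μ| * κ ≤ |(G (((z.re + σ : ℝ) : ℂ) + μ * Complex.I)).im| := by
        filter_upwards [self_mem_nhdsWithin, Ioo_mem_nhdsGT (zero_lt_one' ℝ)] with σ hσ hσ1
        have hσ0 : (0 : ℝ) < σ := hσ
        rw [← hzero, zero_add, him σ hσ0, abs_mul, abs_mul, abs_mul, abs_of_pos hσ0, abs_two]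
        have h3 : ∫ k, absorption (w n₀) (m n₀) σ μ k ≤
            ∑ n, ∫ k, absorption (w n) (m n) σ μ k :=
          Finset.single_le_sum (f := fun n => ∫ k, absorption (w n) (m n) σ μ k)
            (fun n _ => hnn σ n) (Finset.mem_univ n₀)
        have h4 : σ * ∫ k, absorption (w n₀) (m n₀) σ μ k ≤
            σ * |a + ∑ n, ∫ k, absorption (w n) (m n) σ μ k| := by
          refine mul_le_mul_of_nonneg_left (le_trans ?_ (le_abs_self _)) hσ0.le
          linarith
        calc 2 * |μ| * κ ≤ 2 * |μ| * (σ * |a + ∑ n, ∫ k, absorption (w n) (m n) σ μ k|) := by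
              gcongr
              exact (hκ σ hσ0 hσ1.2.le).trans h4
          _ = _ := by ring
      have := ge_of_tendsto ((continuous_abs.tendsto _).comp ((Complex.continuous_im.tendsto _).comp
        hlim)) hbd
      intro h
      rw [h] at this
      simp at this
      have hμ1 : 0 < |μ| := abs_pos.mpr hμ0
      have : 0 < 2 * |μ| * κ := by positivity
      linarith

/-! ### Spectral weights and admissibility of the memory kernel. -/

/-- The form `|∑ vⱼ kⱼ|²`. -/
noncomputable def quad (v : V3) (k : E3) : ℝ := ‖∑ j, v j * (k j : ℂ)‖ ^ 2

lemma quad_nonneg (v : V3) (k : E3) : 0 ≤ quad v k := by unfold quad; positivity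

lemma continuous_quad (v : V3) : Continuous (quad v) := by unfold quad; fun_prop

lemma quad_eq_sum (v : V3) (k : E3) :
    (quad v k : ℂ) = ∑ i, ∑ j, starRingEnd ℂ (v i) * v j * ((k i * k j : ℝ) : ℂ) := by
  rw [quad, Complex.ofReal_pow, ← Complex.conj_mul', map_sum, Finset.sum_mul_sum]
  refine Finset.sum_congr rfl fun i _ => Finset.sum_congr rfl fun j _ => ?_
  rw [map_mul, Complex.conj_ofReal]; push_cast; ring

lemma quad_le (v : V3) (k : E3) : quad v k ≤ 9 * ‖v‖ ^ 2 * ‖k‖ ^ 2 := by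
  have h : ‖∑ j, v j * (k j : ℂ)‖ ≤ 3 * (‖v‖ * ‖k‖) := by
    refine (norm_sum_le _ _).trans ?_
    refine (Finset.sum_le_card_nsmul _ _ (‖v‖ * ‖k‖) fun j _ => ?_).trans (by simp)
    rw [norm_mul, Complex.norm_real]
    exact mul_le_mul (PiLp.norm_apply_le v j) (PiLp.norm_apply_le k j) (norm_nonneg _)
      (norm_nonneg _)
  rw [quad]
  calc _ ≤ (3 * (‖v‖ * ‖k‖)) ^ 2 := by gcongr
    _ = _ := by ring

/-- For v = x + iy with x, y real, `quad v k` is (x·k)² + (y·k)², and one of x, y is nonzero. A real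
direction a is what the cone argument uses. -/
lemma exists_sq_inner_le_quad {v : V3} (hv : v ≠ 0) :
    ∃ a : E3, a ≠ 0 ∧ ∀ k, inner ℝ a k ^ 2 ≤ quad v k := by
  set x : E3 := WithLp.toLp 2 fun j => (v j).re with hx
  set y : E3 := WithLp.toLp 2 fun j => (v j).im with hy
  have hre : ∀ k : E3, (∑ j, v j * (k j : ℂ)).re = inner ℝ x k := fun k => by
    rw [Complex.re_sum, PiLp.inner_apply]
    refine Finset.sum_congr rfl fun j _ => ?_
    simp [hx, mul_comm]
  have him : ∀ k : E3, (∑ j, v j * (k j : ℂ)).im = inner ℝ y k := fun k => by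
    rw [Complex.im_sum, PiLp.inner_apply]
    refine Finset.sum_congr rfl fun j _ => ?_
    simp [hy, mul_comm]
  have hq : ∀ k, quad v k = inner ℝ x k ^ 2 + inner ℝ y k ^ 2 := fun k => by
    rw [quad, Complex.sq_norm, Complex.normSq_apply, hre, him]; ring
  by_cases h0 : x = 0
  · refine ⟨y, fun h1 => hv ?_, fun k => by rw [hq]; nlinarith [sq_nonneg (inner ℝ x k)]⟩
    ext j
    refine Complex.ext ?_ ?_
    · simpa [hx] using congrFun (congrArg WithLp.ofLp h0) j
    · simpa [hy] using congrFun (congrArg WithLp.ofLp h1) j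
  · exact ⟨x, h0, fun k => by rw [hq]; nlinarith [sq_nonneg (inner ℝ y k)]⟩

/-- The spectral weight of a form factor in the direction `v`. -/
noncomputable def weight (f : E3 → ℝ) (v : V3) (k : E3) : ℝ := 4 * Real.pi ^ 2 * f k * quad v k

section

variable {f : E3 → ℝ} {W : 𝓢(E3, ℂ)} (hf : ∀ k, 0 ≤ f k) (hW : ∀ k, W k = (f k : ℂ))

include hf in
lemma weight_nonneg (v : V3) (k : E3) : 0 ≤ weight f v k :=
  mul_nonneg (mul_nonneg (by positivity) (hf k)) (quad_nonneg v k)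

include hW in
lemma continuous_form : Continuous f := by
  have : f = fun k => (W k).re := by ext k; simp [hW]
  rw [this]
  exact Complex.continuous_re.comp W.continuous

include hW in
lemma continuous_weight (v : V3) : Continuous (weight f v) := by
  have := continuous_form hW
  have := continuous_quad v
  unfold weight
  fun_prop

include hf hW in
lemma norm_weight_le (v : V3) (k : E3) :
    weight f v k ≤ 36 * Real.pi ^ 2 * ‖v‖ ^ 2 * (‖k‖ ^ 2 * ‖W k‖) := by
  have h1 : ‖W k‖ = f k := by rw [hW, Complex.norm_real, Real.norm_of_nonneg (hf k)]
  rw [h1, weight]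
  calc _ ≤ 4 * Real.pi ^ 2 * f k * (9 * ‖v‖ ^ 2 * ‖k‖ ^ 2) :=
        mul_le_mul_of_nonneg_left (quad_le v k) (mul_nonneg (by positivity) (hf k))
    _ = _ := by ring

include hf hW in
lemma integrable_weight (v : V3) : Integrable (weight f v) := by
  refine ((W.integrable_pow_mul volume 2).const_mul (36 * Real.pi ^ 2 * ‖v‖ ^ 2)).mono'
    (continuous_weight hW v).aestronglyMeasurable (ae_of_all _ fun k => ?_)
  rw [Real.norm_of_nonneg (weight_nonneg hf v k)]
  exact norm_weight_le hf hW v k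

include hf hW in
lemma integrable_weight_div_lam (v : V3) (m : ℝ) : Integrable fun k => weight f v k / lam m k := by
  have h1 := (continuous_weight hW v).measurable
  have h2 := (continuous_lam m).measurable
  refine ((W.integrable_pow_mul volume 1).const_mul (36 * Real.pi ^ 2 * ‖v‖ ^ 2)).mono'
    (h1.div h2).aestronglyMeasurable (ae_of_all _ fun k => ?_)
  rw [Real.norm_of_nonneg (div_nonneg (weight_nonneg hf v k) (lam_nonneg m k))]
  refine div_le_of_le_mul₀ (lam_nonneg m k) (by positivity) ((norm_weight_le hf hW v k).trans ?_)
  have := norm_le_lam m k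
  calc 36 * Real.pi ^ 2 * ‖v‖ ^ 2 * (‖k‖ ^ 2 * ‖W k‖)
      = 36 * Real.pi ^ 2 * ‖v‖ ^ 2 * (‖k‖ ^ 1 * ‖W k‖) * ‖k‖ := by ring
    _ ≤ _ := by gcongr

lemma sq_norm_le_lam_sq_sub {m c : ℝ} (hc : c ≤ m ^ 2) (k : E3) : ‖k‖ ^ 2 ≤ lam m k ^ 2 - c := by
  rw [lam_sq]
  have : 1 ≤ (2 * Real.pi) ^ 2 := by nlinarith [Real.pi_gt_three]
  nlinarith [sq_nonneg ‖k‖]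

lemma lt_lam_sq {m c : ℝ} (hc : c ≤ m ^ 2) {k : E3} (hk : k ≠ 0) : c < lam m k ^ 2 := by
  have h1 := sq_norm_le_lam_sq_sub hc k
  have h2 : 0 < ‖k‖ ^ 2 := by positivity
  linarith

include hf hW in
-- In the critical case c = m² the denominator vanishes like |k|² at the origin; the quadratic form
-- in the weight compensates this.
lemma integrable_weight_div_lam_sq (v : V3) {m c : ℝ} (hc : c ≤ m ^ 2) :
    Integrable fun k => weight f v k / (lam m k ^ 2 - c) := by
  have h1 := (continuous_weight hW v).measurable
  have h2 := (continuous_lam m).measurable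
  refine ((W.integrable_pow_mul volume 0).const_mul (36 * Real.pi ^ 2 * ‖v‖ ^ 2)).mono'
    (h1.div ((h2.pow_const 2).sub_const c)).aestronglyMeasurable (ae_of_all _ fun k => ?_)
  have h3 := sq_norm_le_lam_sq_sub hc k
  have h4 : 0 ≤ lam m k ^ 2 - c := (sq_nonneg _).trans h3
  rw [Real.norm_of_nonneg (div_nonneg (weight_nonneg hf v k) h4)]
  refine div_le_of_le_mul₀ h4 (by positivity) ((norm_weight_le hf hW v k).trans ?_)
  calc 36 * Real.pi ^ 2 * ‖v‖ ^ 2 * (‖k‖ ^ 2 * ‖W k‖)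
      = 36 * Real.pi ^ 2 * ‖v‖ ^ 2 * (‖k‖ ^ 0 * ‖W k‖) * ‖k‖ ^ 2 := by ring
    _ ≤ _ := by gcongr

include hf hW in
-- The resonant sphere has positive radius, so just outside it f is bounded below; restricting to a
-- cone keeps k away from the plane a·k = 0, where the quadratic form may vanish.
lemma exists_absorption_weight (hpos : ∀ k ≠ 0, 0 < f k) {v : V3} (hv : v ≠ 0) {m μ : ℝ}
    (hμ : m ^ 2 < μ ^ 2) : ∃ κ, 0 < κ ∧ ∀ σ, 0 < σ → σ ≤ 1 →
      κ ≤ σ * ∫ k, absorption (weight f v) m σ μ k := by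
  have hpi := Real.pi_pos
  obtain ⟨a, ha, hav⟩ := exists_sq_inner_le_quad hv
  set S := √(μ ^ 2 - m ^ 2) with hS
  have hS0 : 0 < S := Real.sqrt_pos.mpr (by linarith)
  set r := S / (2 * Real.pi) with hr
  have hr0 : 0 < r := by positivity
  set Z : Set E3 := Metric.closedBall 0 (r + 1) \ Metric.ball 0 r with hZ
  have hZc : IsCompact Z := (isCompact_closedBall 0 (r + 1)).diff Metric.isOpen_ball
  have hfc := continuous_form hW
  obtain ⟨f₀, hf₀, hfZ⟩ : ∃ f₀, 0 < f₀ ∧ ∀ k ∈ Z, f₀ ≤ f k := by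
    -- The annulus is compact and avoids the origin, so f attains a positive minimum on it. The
    -- empty case is settled without excluding it.
    rcases Z.eq_empty_or_nonempty with h | h
    · exact ⟨1, one_pos, by simp [h]⟩
    · obtain ⟨k₀, hk₀, hmin⟩ := hZc.exists_isMinOn h hfc.continuousOn
      refine ⟨f k₀, hpos k₀ fun h0 => hk₀.2 ?_, fun k hk => hmin hk⟩
      rw [h0]; exact Metric.mem_ball_self hr0
  have han : 0 < ‖a‖ := norm_pos_iff.mpr ha
  refine exists_le_integral_absorption (integrable_weight hf hW v) (weight_nonneg hf v) ha hμ
    (w₀ := 4 * Real.pi ^ 2 * f₀ * (‖a‖ * r / 2) ^ 2) (by positivity) fun k h1 h2 hk => ?_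
  have h3 : r ≤ ‖k‖ := by
    rw [hr, div_le_iff₀ (by positivity)]; linarith
  have h4 : ‖k‖ ≤ r + 1 := by
    have : ‖k‖ - 1 ≤ r := by rw [hr, le_div_iff₀ (by positivity)]; linarith
    linarith
  have hkZ : k ∈ Z := ⟨by simpa using h4, by simpa using h3⟩
  rw [weight]
  have h5 : (‖a‖ * r / 2) ^ 2 ≤ quad v k := by
    refine le_trans ?_ (hav k)
    have : ‖a‖ * r / 2 ≤ inner ℝ a k := le_trans (by gcongr) (le_of_lt hk)
    gcongr
  have := hfZ k hkZ
  have := hf k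
  gcongr

end

/-- The quadratic form of the operator kernel is a scalar kernel with nonnegative weights, the form
to which `dispersion_ne_zero` applies. -/
lemma inner_memoryKernel {d : ℕ} {m : Fin d → ℝ} {W : Fin d → 𝓢(E3, ℂ)} {f : Fin d → E3 → ℝ}
    (hW : ∀ n k, W n k = (f n k : ℂ)) (v : V3) (t : ℝ) :
    inner ℂ v (memoryKernel m W t v) = ∑ n, ∫ k,
      ((weight (f n) v k * (Real.sin (t * lam (m n) k) / lam (m n) k) : ℝ) : ℂ) := by
  have h1 : ∀ n, ∫ k, ((weight (f n) v k * (Real.sin (t * lam (m n) k) / lam (m n) k) : ℝ) : ℂ) =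
      ∑ i, ∑ j, (starRingEnd ℂ (v i) * v j * (4 * (Real.pi : ℂ) ^ 2)) *
        retarded (m n) (W n) i j t := fun n => by
    simp only [retarded]
    simp_rw [← integral_const_mul]
    have hin := fun i j => (integrable_mul_apply_mul_sin (W n) (m n) i j t).const_mul
      (starRingEnd ℂ (v i) * v j * (4 * (Real.pi : ℂ) ^ 2))
    simp_rw [← integral_finsetSum _ fun j (_ : j ∈ Finset.univ) => hin _ j]
    rw [← integral_finsetSum _ fun i _ => integrable_finsetSum _ fun j _ => hin i j]
    congr 1 with k
    simp only [weight]
    push_cast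
    rw [quad_eq_sum, Finset.mul_sum, Finset.sum_mul]
    refine Finset.sum_congr rfl fun i _ => ?_
    rw [Finset.mul_sum, Finset.sum_mul]
    refine Finset.sum_congr rfl fun j _ => ?_
    rw [hW]; push_cast; ring
  simp_rw [h1]
  rw [PiLp.inner_apply]
  simp_rw [memoryKernel_apply]
  rw [Finset.sum_comm]
  refine Finset.sum_congr rfl fun i _ => ?_
  rw [RCLike.inner_apply, Finset.sum_mul]
  refine Finset.sum_congr rfl fun n _ => ?_
  rw [Finset.sum_mul]
  refine Finset.sum_congr rfl fun j _ => ?_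
  ring

lemma integrableOn_memoryKernel {d : ℕ} {m : Fin d → ℝ} (hm : ∀ n, 0 ≤ m n)
    (W : Fin d → 𝓢(E3, ℂ)) : IntegrableOn (memoryKernel m W) (Ioi 0) := by
  obtain ⟨A, hA⟩ := exists_norm_memoryKernel_le hm W
  refine (integrable_wt.const_mul A).integrableOn.mono'
    (continuous_memoryKernel m W).aestronglyMeasurable ?_
  filter_upwards [ae_restrict_mem measurableSet_Ioi] with t ht
  have ht0 : (0 : ℝ) < t := ht
  refine le_trans ?_ (hA t ht0.le)
  exact le_mul_of_one_le_left (norm_nonneg _) (by linarith)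

/-- The quadratic form of an operator at `v`. -/
noncomputable def quadForm (v : V3) : (V3 →L[ℂ] V3) →L[ℂ] ℂ :=
  (innerSL ℂ v).comp (ContinuousLinearMap.apply ℂ V3 v)

lemma quadForm_apply (v : V3) (T : V3 →L[ℂ] V3) : quadForm v T = inner ℂ v (T v) := rfl

lemma laplace_inner {D : ℝ → V3 →L[ℂ] V3} (hD : IntegrableOn D (Ioi 0)) {z : ℂ} (hz : 0 ≤ z.re)
    (v : V3) : laplace (fun t => inner ℂ v (D t v)) z = inner ℂ v (laplace D z v) := by
  have h3 := (quadForm v).integral_comp_comm (integrableOn_laplace hD hz)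
  simp only [map_smul, quadForm_apply] at h3
  exact h3

lemma inner_symbol (ω : ℝ) {D : ℝ → V3 →L[ℂ] V3} (hD : IntegrableOn D (Ioi 0)) {z : ℂ}
    (hz : 0 ≤ z.re) (v : V3) : inner ℂ v (symbol ω D z v) =
      (z ^ 2 + (ω : ℂ) ^ 2) * (‖v‖ ^ 2 : ℝ) - laplace (fun t => inner ℂ v (D t v)) z := by
  rw [laplace_inner hD hz, symbol, sub_apply, smul_apply, one_apply_eq_self, inner_sub_right,
    inner_smul_right, inner_self_eq_norm_sq_to_K]
  simp

lemma integrableOn_integral_weight {m : ℝ} (hm : 0 ≤ m) {W : 𝓢(E3, ℂ)} {f : E3 → ℝ}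
    (hW : ∀ k, W k = (f k : ℂ)) (v : V3) : IntegrableOn (fun t : ℝ => ∫ k,
      ((weight f v k * (Real.sin (t * lam m k) / lam m k) : ℝ) : ℂ)) (Ioi 0) := by
  -- The bound for the memory kernel is reused for a system with a single field.
  have h1 := (quadForm v).integrable_comp
    (integrableOn_memoryKernel (m := fun _ : Fin 1 => m) (fun _ => hm) (fun _ => W))
  refine h1.congr (ae_of_all _ fun t => ?_)
  simp only [quadForm_apply]
  rw [inner_memoryKernel (f := fun _ => f) (fun _ => hW)]
  simp

/-- The memory kernel is admissible as soon as the static coupling is weak. -/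
theorem exists_admissibleKernel {d : ℕ} {m : Fin d → ℝ} (hm : ∀ n, 0 ≤ m n)
    {W : Fin d → 𝓢(E3, ℂ)} {f : Fin d → E3 → ℝ} (hf : ∀ n k, 0 ≤ f n k)
    (hW : ∀ n k, W n k = (f n k : ℂ)) (hpos : ∀ n, ∀ k ≠ 0, 0 < f n k) {n₀ : Fin d}
    (hn₀ : ∀ n, m n₀ ≤ m n) {ω : ℝ} (hA : ∀ v : V3, v ≠ 0 →
      ∑ n, ∫ k, weight (f n) v k / (lam (m n) k ^ 2 - m n₀ ^ 2) < (ω ^ 2 - m n₀ ^ 2) * ‖v‖ ^ 2) :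
    ∃ A, AdmissibleKernel ω (memoryKernel m W) A := by
  obtain ⟨A, hA'⟩ := exists_norm_memoryKernel_le hm W
  have hcm : ∀ n, m n₀ ^ 2 ≤ m n ^ 2 := fun n => pow_le_pow_left₀ (hm n₀) (hn₀ n) 2
  refine ⟨A, continuous_memoryKernel m W, hA', fun z hz => ?_⟩
  rw [ContinuousLinearMap.isUnit_iff_bijective]
  -- In finite dimension injectivity suffices, and a null vector v would make ⟨v, S(z)v⟩ vanish.
  have hinj : Function.Injective (symbol ω (memoryKernel m W) z) := by
    rw [injective_iff_map_eq_zero]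
    intro v hv
    by_contra hv0
    have key := dispersion_ne_zero (ω := ω) (fun n => integrable_weight (hf n) (hW n) v)
      (fun n => weight_nonneg (hf n) v) (fun n => integrable_weight_div_lam (hf n) (hW n) v (m n))
      (a := ‖v‖ ^ 2) (c := m n₀ ^ 2) (by positivity) (fun n k hk => lt_lam_sq (hcm n) hk)
      (fun n => integrable_weight_div_lam_sq (hf n) (hW n) v (hcm n)) (hA v hv0) (sq_nonneg _) n₀
      (fun μ hμ => exists_absorption_weight (hf n₀) (hW n₀) (hpos n₀) hv0 hμ)
      (fun n => integrableOn_integral_weight (hm n) (hW n) v) hz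
    simp_rw [← inner_memoryKernel hW v] at key
    rw [← inner_symbol ω (integrableOn_memoryKernel hm W) hz, hv, inner_zero_right] at key
    exact key rfl
  exact ⟨hinj, LinearMap.surjective_of_injective
    (f := (symbol ω (memoryKernel m W) z : V3 →ₗ[ℂ] V3)) hinj⟩

/-! ### Condition A1 in terms of Mathlib's Fourier transform. -/

lemma rhoHat_neg_two_pi_smul {ρ : E3 → ℝ} {s : 𝓢(E3, ℂ)} (hs : ∀ x, s x = (ρ x : ℂ)) (k : E3) :
    rhoHat ρ ((-(2 * Real.pi)) • k) = 𝓕 s k := by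
  rw [SchwartzMap.fourier_coe, Real.fourier_eq', rhoHat]
  congr 1 with x
  rw [hs, smul_eq_mul, inner_smul_left, real_inner_comm]
  congr 2
  simp only [conj_trivial]
  push_cast; ring

/-- The square modulus of the Fourier transform of a Schwartz function. -/
noncomputable def formFactor (s : 𝓢(E3, ℂ)) (k : E3) : ℝ := ‖𝓕 s k‖ ^ 2

/-- The square modulus of the Fourier transform, as a Schwartz function. -/
noncomputable def formFactorSchwartz (s : 𝓢(E3, ℂ)) : 𝓢(E3, ℂ) :=
  SchwartzMap.pairing (ContinuousLinearMap.mul ℝ ℂ)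
    (SchwartzMap.postcompCLM Complex.conjCLE.toContinuousLinearMap (𝓕 s)) (𝓕 s)

lemma formFactorSchwartz_apply (s : 𝓢(E3, ℂ)) (k : E3) :
    formFactorSchwartz s k = (formFactor s k : ℂ) := by
  rw [formFactorSchwartz, SchwartzMap.pairing_apply_apply, SchwartzMap.postcompCLM_apply,
    formFactor, Complex.ofReal_pow, ← Complex.conj_mul']
  rfl

/-- The substitution k ↦ -2πk passes from the exponential exp(ik·x) to exp(-2πik·x). Its Jacobian is
the prefactor (2π)⁻³, and k_i k_j supplies 4π². -/
lemma couplingMatrix_eq {d : ℕ} {m : Fin d → ℝ} {ρ : Fin d → E3 → ℝ} {s : Fin d → 𝓢(E3, ℂ)}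
    (hs : ∀ n x, s n x = (ρ n x : ℂ)) (i j : Fin 3) : couplingMatrix m ρ i j =
      ∑ n, ∫ k : E3, 4 * Real.pi ^ 2 * formFactor (s n) k * (k i * k j) /
        (lam (m n) k ^ 2 - mStar m ^ 2) := by
  rw [couplingMatrix, Matrix.of_apply]
  refine Finset.sum_congr rfl fun n _ => ?_
  have h := Measure.integral_comp_smul (volume : Measure E3) (fun k : E3 =>
    k i * k j * ‖rhoHat (ρ n) k‖ ^ 2 / (‖k‖ ^ 2 + m n ^ 2 - mStar m ^ 2)) (-(2 * Real.pi))
  have e : |((-(2 * Real.pi)) ^ Module.finrank ℝ E3)⁻¹| = 1 / (2 * Real.pi) ^ 3 := by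
    rw [finrank_euclideanSpace_fin, abs_inv, abs_pow, abs_neg, abs_of_pos Real.two_pi_pos, one_div]
  rw [e, smul_eq_mul] at h
  rw [← h]
  congr 1 with k
  rw [rhoHat_neg_two_pi_smul (hs n), norm_smul, norm_neg, Real.norm_of_nonneg Real.two_pi_pos.le,
    lam_sq, formFactor]
  simp only [PiLp.smul_apply, smul_eq_mul]
  congr 1
  ring

lemma re_conj_mul_sum (K : Matrix (Fin 3) (Fin 3) ℝ) (v : V3) :
    ∑ i, ∑ j, (starRingEnd ℂ (v i) * v j).re * K i j =
      (fun i => (v i).re) ⬝ᵥ (K.mulVec fun i => (v i).re) +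
        (fun i => (v i).im) ⬝ᵥ (K.mulVec fun i => (v i).im) := by
  simp only [dotProduct, Matrix.mulVec, Finset.mul_sum, ← Finset.sum_add_distrib]
  refine Finset.sum_congr rfl fun i _ => Finset.sum_congr rfl fun j _ => ?_
  simp
  ring

lemma quad_eq_sum_re (v : V3) (k : E3) :
    quad v k = ∑ i, ∑ j, (starRingEnd ℂ (v i) * v j).re * (k i * k j) := by
  have h := congrArg Complex.re (quad_eq_sum v k)
  rw [Complex.ofReal_re] at h
  rw [h, Complex.re_sum]
  refine Finset.sum_congr rfl fun i _ => ?_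
  rw [Complex.re_sum]
  exact Finset.sum_congr rfl fun j _ => Complex.re_mul_ofReal _ _

lemma sum_integral_weight_eq {d : ℕ} {m : Fin d → ℝ} {ρ : Fin d → E3 → ℝ} {s : Fin d → 𝓢(E3, ℂ)}
    (hs : ∀ n x, s n x = (ρ n x : ℂ)) (hc : ∀ n, mStar m ^ 2 ≤ m n ^ 2) (v : V3) :
    ∑ n, ∫ k, weight (formFactor (s n)) v k / (lam (m n) k ^ 2 - mStar m ^ 2) =
      ∑ i, ∑ j, (starRingEnd ℂ (v i) * v j).re * couplingMatrix m ρ i j := by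
  simp_rw [couplingMatrix_eq hs, Finset.mul_sum]
  have e : ∀ n, ∫ k, weight (formFactor (s n)) v k / (lam (m n) k ^ 2 - mStar m ^ 2) =
      ∑ i, ∑ j, (starRingEnd ℂ (v i) * v j).re * ∫ k : E3, 4 * Real.pi ^ 2 * formFactor (s n) k *
        (k i * k j) / (lam (m n) k ^ 2 - mStar m ^ 2) := fun n => by
    have hW := formFactorSchwartz_apply (s n)
    have hin : ∀ i j : Fin 3, Integrable fun k : E3 => 4 * Real.pi ^ 2 * formFactor (s n) k *
        (k i * k j) / (lam (m n) k ^ 2 - mStar m ^ 2) := fun i j => by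
      have h1 := (continuous_form hW).measurable
      have h2 := (continuous_lam (m n)).measurable
      refine ((formFactorSchwartz (s n)).integrable.norm.const_mul (4 * Real.pi ^ 2)).mono'
        (Measurable.aestronglyMeasurable (by fun_prop)) (ae_of_all _ fun k => ?_)
      have h3 := sq_norm_le_lam_sq_sub (hc n) k
      have h4 : 0 ≤ lam (m n) k ^ 2 - mStar m ^ 2 := (sq_nonneg _).trans h3
      have h5 : 0 ≤ formFactor (s n) k := sq_nonneg _
      rw [norm_div, norm_mul, Real.norm_of_nonneg h4, Real.norm_of_nonneg (by positivity), hW,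
        Complex.norm_real, Real.norm_of_nonneg h5]
      refine div_le_of_le_mul₀ h4 (by positivity) ?_
      refine mul_le_mul_of_nonneg_left ?_ (by positivity)
      exact (abs_mul_apply_le k i j).trans h3
    simp_rw [← integral_const_mul]
    simp_rw [← integral_finsetSum _ fun j (_ : j ∈ Finset.univ) => (hin _ j).const_mul _]
    rw [← integral_finsetSum _ fun i _ => integrable_finsetSum _ fun j _ => (hin i j).const_mul _]
    congr 1 with k
    rw [weight, quad_eq_sum_re]
    simp only [Finset.mul_sum, Finset.sum_div]
    refine Finset.sum_congr rfl fun i _ => Finset.sum_congr rfl fun j _ => ?_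
    ring
  simp_rw [e]
  rw [Finset.sum_comm]
  refine Finset.sum_congr rfl fun i _ => ?_
  rw [Finset.sum_comm]

/-- The weights sum to the form of K at the complex vector v, which splits into the forms at its
real and imaginary parts. A1 is applied to each, strictly to one that is nonzero. -/
lemma sum_integral_weight_lt {d : ℕ} {m : Fin d → ℝ} {ω : ℝ} {ρ : Fin d → E3 → ℝ}
    {s : Fin d → 𝓢(E3, ℂ)} (hs : ∀ n x, s n x = (ρ n x : ℂ)) (hA1 : ConditionA1 m ω ρ)
    (hc : ∀ n, mStar m ^ 2 ≤ m n ^ 2) {v : V3} (hv : v ≠ 0) :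
    ∑ n, ∫ k, weight (formFactor (s n)) v k / (lam (m n) k ^ 2 - mStar m ^ 2) <
      (ω ^ 2 - mStar m ^ 2) * ‖v‖ ^ 2 := by
  rw [sum_integral_weight_eq hs hc, re_conj_mul_sum]
  set x : Fin 3 → ℝ := fun i => (v i).re with hx
  set y : Fin 3 → ℝ := fun i => (v i).im with hy
  have hform : ∀ u : Fin 3 → ℝ, u ⬝ᵥ (((ω ^ 2 - mStar m ^ 2) • (1 : Matrix (Fin 3) (Fin 3) ℝ) -
      couplingMatrix m ρ).mulVec u) =
      (ω ^ 2 - mStar m ^ 2) * (u ⬝ᵥ u) - u ⬝ᵥ ((couplingMatrix m ρ).mulVec u) := fun u => by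
    rw [Matrix.sub_mulVec, dotProduct_sub, Matrix.smul_mulVec, Matrix.one_mulVec, dotProduct_smul,
      smul_eq_mul]
  have hnn : ∀ u : Fin 3 → ℝ, 0 ≤ (ω ^ 2 - mStar m ^ 2) * (u ⬝ᵥ u) -
      u ⬝ᵥ ((couplingMatrix m ρ).mulVec u) := fun u => by
    rw [← hform]; simpa using hA1.posSemidef.dotProduct_mulVec_nonneg u
  have hp : ∀ u : Fin 3 → ℝ, u ≠ 0 → 0 < (ω ^ 2 - mStar m ^ 2) * (u ⬝ᵥ u) -
      u ⬝ᵥ ((couplingMatrix m ρ).mulVec u) := fun u hu => by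
    rw [← hform]; simpa using hA1.dotProduct_mulVec_pos hu
  have hnorm : ‖v‖ ^ 2 = x ⬝ᵥ x + y ⬝ᵥ y := by
    rw [EuclideanSpace.norm_sq_eq]
    simp only [dotProduct, ← Finset.sum_add_distrib]
    refine Finset.sum_congr rfl fun i _ => ?_
    rw [Complex.sq_norm, Complex.normSq_apply]
  rw [hnorm]
  by_cases h0 : x = 0
  · have hy0 : y ≠ 0 := fun h1 => hv <| by
      ext j
      exact Complex.ext (by simpa [hx] using congrFun h0 j) (by simpa [hy] using congrFun h1 j)
    linarith [hnn x, hp y hy0]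
  · linarith [hp x h0, hnn y]

/-! ### The weak Laplacian and the Fourier transform on L². -/

open scoped Laplacian

/-- The complex space `L²(ℝ³)`. -/
abbrev L2C : Type := Lp ℂ 2 (volume : Measure E3)

/-- The inclusion of the real into the complex square integrable functions. -/
noncomputable def toComplex : L2 →L[ℝ] L2C := Complex.ofRealCLM.compLpL 2 volume

lemma coeFn_toComplex (a : L2) : toComplex a =ᵐ[volume] fun x => (a x : ℂ) :=
  Complex.ofRealCLM.coeFn_compLpL a

/-- The pairing `g ↦ ∫ a g` of a square integrable function with Schwartz functions. -/
noncomputable def pair (a : L2) : 𝓢(E3, ℂ) →L[ℂ] ℂ :=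
  (innerSL ℂ (toComplex a)).comp (SchwartzMap.toLpCLM ℂ ℂ 2 volume)

lemma pair_eq_inner (a : L2) (g : 𝓢(E3, ℂ)) :
    pair a g = inner ℂ (toComplex a) (g.toLp 2 volume) := rfl

lemma pair_apply (a : L2) (g : 𝓢(E3, ℂ)) : pair a g = ∫ x, (a x : ℂ) * g x := by
  rw [pair_eq_inner, L2.inner_def]
  refine integral_congr_ae ?_
  filter_upwards [coeFn_toComplex a, g.coeFn_toLp 2 volume] with x h1 h2
  rw [h1, h2, RCLike.inner_apply, Complex.conj_ofReal, mul_comm]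

lemma integrable_ofReal_mul_schwartz (a : L2) (g : 𝓢(E3, ℂ)) :
    Integrable fun x => (a x : ℂ) * g x :=
  (Lp.memLp a).ofReal.integrable_mul (g.memLp 2 volume)

/-- The dilation `u (ε x)` of a Schwartz function. -/
noncomputable def dilate (ε : ℝˣ) (u : 𝓢(E3, ℂ)) : 𝓢(E3, ℂ) :=
  SchwartzMap.compCLMOfContinuousLinearEquiv ℂ (ContinuousLinearEquiv.smulLeft ε : E3 ≃L[ℝ] E3) u

lemma dilate_apply (ε : ℝˣ) (u : 𝓢(E3, ℂ)) (x : E3) : dilate ε u x = u ((ε : ℝ) • x) := rfl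

lemma lineDeriv_dilate (ε : ℝˣ) (u : 𝓢(E3, ℂ)) (v : E3) :
    ∂_{v} (dilate ε u) = (ε : ℝ) • dilate ε (∂_{v} u) := by
  rw [dilate, SchwartzMap.lineDerivOp_compCLMOfContinuousLinearEquiv]
  have : (ContinuousLinearEquiv.smulLeft ε : E3 ≃L[ℝ] E3) v = (ε : ℝ) • v := rfl
  rw [this, LineDeriv.lineDerivOp_left_smul]
  ext x
  rfl

/-- The pointwise product of Schwartz functions. -/
noncomputable def schwartzMul (u g : 𝓢(E3, ℂ)) : 𝓢(E3, ℂ) :=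
  SchwartzMap.pairing (ContinuousLinearMap.mul ℝ ℂ) u g

lemma schwartzMul_apply (u g : 𝓢(E3, ℂ)) (x : E3) : schwartzMul u g x = u x * g x := rfl

lemma lineDeriv_schwartzMul (u g : 𝓢(E3, ℂ)) (v : E3) :
    ∂_{v} (schwartzMul u g) = schwartzMul (∂_{v} u) g + schwartzMul u (∂_{v} g) := by
  ext x
  have h := ((u.hasFDerivAt x).mul (g.hasFDerivAt x)).fderiv
  have e : (schwartzMul u g : E3 → ℂ) = ⇑u * ⇑g := rfl
  simp only [add_apply, schwartzMul_apply, SchwartzMap.lineDerivOp_apply_eq_fderiv]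
  rw [e, h]
  simp
  ring

/-- In the Leibniz expansion each derivative falling on the cutoff carries a factor ε; only the last
term survives as ε → 0. -/
lemma laplacian_dilate_mul (ε : ℝˣ) (u g : 𝓢(E3, ℂ)) :
    Δ (schwartzMul (dilate ε u) g) = ∑ i,
      (((ε : ℝ) : ℂ) ^ 2 • schwartzMul (dilate ε (∂_{stdOrthonormalBasis ℝ E3 i}
          (∂_{stdOrthonormalBasis ℝ E3 i} u))) g +
        (2 * ((ε : ℝ) : ℂ)) • schwartzMul (dilate ε (∂_{stdOrthonormalBasis ℝ E3 i} u))
          (∂_{stdOrthonormalBasis ℝ E3 i} g) +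
        schwartzMul (dilate ε u) (∂_{stdOrthonormalBasis ℝ E3 i}
          (∂_{stdOrthonormalBasis ℝ E3 i} g))) := by
  rw [SchwartzMap.laplacian_eq_sum (stdOrthonormalBasis ℝ E3)]
  refine Finset.sum_congr rfl fun i _ => ?_
  set v := stdOrthonormalBasis ℝ E3 i
  rw [lineDeriv_schwartzMul, LineDeriv.lineDerivOp_add, lineDeriv_schwartzMul,
    lineDeriv_schwartzMul, lineDeriv_dilate, LineDeriv.lineDerivOp_smul, lineDeriv_dilate]
  ext x
  simp only [add_apply, smul_apply, schwartzMul_apply, Complex.real_smul, smul_eq_mul]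
  ring

lemma tendsto_pair_dilate (a : L2) (u h : 𝓢(E3, ℂ)) {ε : ℕ → ℝˣ}
    (hε : Tendsto (fun n => (ε n : ℝ)) atTop (𝓝 0)) :
    Tendsto (fun n => pair a (schwartzMul (dilate (ε n) u) h)) atTop (𝓝 (u 0 * pair a h)) := by
  simp_rw [pair_apply]
  rw [← integral_const_mul]
  obtain ⟨C, hC⟩ : ∃ C, ∀ x, ‖u x‖ ≤ C := ⟨_, SchwartzMap.norm_le_seminorm ℝ u⟩
  refine tendsto_integral_of_dominated_convergence (fun x => C * ‖(a x : ℂ) * h x‖)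
    (fun n => (integrable_ofReal_mul_schwartz a _).1)
    ((integrable_ofReal_mul_schwartz a h).norm.const_mul C) (fun n => ae_of_all _ fun x => ?_)
    (ae_of_all _ fun x => ?_)
  · rw [schwartzMul_apply, dilate_apply, mul_left_comm, norm_mul]
    gcongr
    exact hC _
  · simp_rw [schwartzMul_apply, dilate_apply, mul_left_comm (a x : ℂ)]
    refine Tendsto.mul_const _ ?_
    have h1 : Continuous fun r : ℝ => u (r • x) := u.continuous.comp (by fun_prop)
    simpa [Function.comp_def] using (h1.tendsto 0).comp hε

section WeakLaplacian

variable {a b : L2} (hab : ∀ χ : E3 → ℝ, IsTest χ → ∫ x, a x * χ x = ∫ x, b x * Δ χ x)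

include hab in
lemma pair_eq_pair_laplacian_of_hasCompactSupport (g : 𝓢(E3, ℂ)) (hg : HasCompactSupport g) :
    pair a g = pair b (Δ g) := by
  have key : ∀ L : ℂ →L[ℝ] ℝ, (∀ (r : ℝ) (z : ℂ), L (r * z) = r * L z) →
      L (pair a g) = L (pair b (Δ g)) := fun L hL => by
    have h1 : IsTest (L ∘ g) := ⟨L.contDiff.comp (g.smooth ⊤), hg.comp_left (map_zero L)⟩
    have h2 := hab _ h1
    rw [pair_apply, pair_apply, ← L.integral_comp_comm (integrable_ofReal_mul_schwartz a g),
      ← L.integral_comp_comm (integrable_ofReal_mul_schwartz b _)]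
    simp_rw [hL]
    refine h2.trans (integral_congr_ae (ae_of_all _ fun x => ?_))
    simp only
    rw [(g.contDiffAt 2).laplacian_CLM_comp_left, SchwartzMap.laplacian_apply]
    rfl
  refine Complex.ext (key Complex.reCLM fun r z => ?_) (key Complex.imCLM fun r z => ?_)
  · simp
  · simp

include hab in
-- The identity is extended from compactly supported to all Schwartz functions by the cutoffs u(εx)
-- with u(0) = 1.
lemma pair_eq_pair_laplacian (g : 𝓢(E3, ℂ)) : pair a g = pair b (Δ g) := by
  obtain ⟨u, hu, hu0⟩ : ∃ u : 𝓢(E3, ℂ), HasCompactSupport u ∧ u 0 = 1 := by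
    let f : ContDiffBump (0 : E3) := ⟨1, 2, one_pos, one_lt_two⟩
    have h1 : HasCompactSupport (fun x => (f x : ℂ)) :=
      f.hasCompactSupport.comp_left Complex.ofReal_zero
    have h2 : ContDiff ℝ (⊤ : ℕ∞) fun x => (f x : ℂ) := Complex.ofRealCLM.contDiff.comp f.contDiff
    refine ⟨h1.toSchwartzMap h2, h1, ?_⟩
    have h3 : f 0 = 1 := f.one_of_mem_closedBall (Metric.mem_closedBall_self zero_le_one)
    change (f 0 : ℂ) = 1
    rw [h3, Complex.ofReal_one]
  set ε : ℕ → ℝˣ := fun n => Units.mk0 (1 / ((n : ℝ) + 1)) (by positivity) with hε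
  have hε0 : Tendsto (fun n => (ε n : ℝ)) atTop (𝓝 0) := tendsto_one_div_add_atTop_nhds_zero_nat
  have hεc : Tendsto (fun n => ((ε n : ℝ) : ℂ)) atTop (𝓝 0) := by
    simpa [Function.comp_def] using (Complex.continuous_ofReal.tendsto 0).comp hε0
  have hlim := tendsto_pair_dilate a u g hε0
  rw [hu0, one_mul] at hlim
  refine tendsto_nhds_unique hlim ?_
  have hcs : ∀ n, HasCompactSupport (schwartzMul (dilate (ε n) u) g) := fun n => by
    have h1 : HasCompactSupport fun x => u ((ε n : ℝ) • x) :=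
      hu.comp_isClosedEmbedding
        (ContinuousLinearEquiv.smulLeft (ε n) : E3 ≃L[ℝ] E3).toHomeomorph.isClosedEmbedding
    exact h1.mul_right
  simp_rw [fun n => pair_eq_pair_laplacian_of_hasCompactSupport hab _ (hcs n),
    laplacian_dilate_mul, map_sum, map_add, map_smul, smul_eq_mul]
  have h2 : pair b (Δ g) = ∑ i, (0 ^ 2 * ((∂_{stdOrthonormalBasis ℝ E3 i}
      (∂_{stdOrthonormalBasis ℝ E3 i} u)) 0 * pair b g) +
      2 * 0 * ((∂_{stdOrthonormalBasis ℝ E3 i} u) 0 * pair b (∂_{stdOrthonormalBasis ℝ E3 i} g)) +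
      u 0 * pair b (∂_{stdOrthonormalBasis ℝ E3 i} (∂_{stdOrthonormalBasis ℝ E3 i} g))) := by
    rw [SchwartzMap.laplacian_eq_sum (stdOrthonormalBasis ℝ E3), map_sum]
    refine Finset.sum_congr rfl fun i _ => ?_
    rw [hu0]; ring
  rw [h2]
  refine tendsto_finsetSum _ fun i _ => ?_
  exact (((hεc.pow 2).mul (tendsto_pair_dilate b _ g hε0)).add
    ((hεc.const_mul 2).mul (tendsto_pair_dilate b _ _ hε0))).add (tendsto_pair_dilate b u _ hε0)

include hab in
/-- The Fourier transform turns the weak Laplacian into multiplication. -/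
lemma fourier_eq_of_weakLaplacian : ∀ᵐ k : E3, (𝓕 (toComplex a) : L2C) k =
    -((2 * Real.pi * ‖k‖) ^ 2 : ℝ) * (𝓕 (toComplex b) : L2C) k := by
  set A : L2C := 𝓕 (toComplex a) with hA
  set B : L2C := 𝓕 (toComplex b) with hB
  have hloc : ∀ f : L2C, LocallyIntegrable f := fun f =>
    (Lp.memLp f).locallyIntegrable (by norm_num)
  have hBloc : LocallyIntegrable fun k : E3 => ((2 * Real.pi * ‖k‖) ^ 2 : ℝ) * B k := by
    have h := (hloc B).continuous_smul
      (g := fun k : E3 => (((2 * Real.pi * ‖k‖) ^ 2 : ℝ) : ℂ)) (by fun_prop)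
    exact h
  have hsum : ∀ᵐ k : E3, A k + ((2 * Real.pi * ‖k‖) ^ 2 : ℝ) * B k = 0 := by
    refine ae_eq_zero_of_integral_contDiff_smul_eq_zero ((hloc A).add hBloc) fun χ hχ hχc => ?_
    have hχc' : HasCompactSupport fun k => (χ k : ℂ) := hχc.comp_left Complex.ofReal_zero
    set w : 𝓢(E3, ℂ) := hχc'.toSchwartzMap (Complex.ofRealCLM.contDiff.comp hχ) with hw
    have hwk : ∀ k, w k = (χ k : ℂ) := fun k => rfl
    set y : 𝓢(E3, ℂ) := SchwartzMap.smulLeftCLM ℂ (fun k : E3 => ‖k‖ ^ 2) w with hy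
    have hyk : ∀ k, y k = ((‖k‖ ^ 2 * χ k : ℝ) : ℂ) := fun k => by
      rw [hy, SchwartzMap.smulLeftCLM_apply_apply (by fun_prop), hwk]; push_cast; simp
    -- A test function w on the frequency side enters through 𝓕⁻ w, which need not have compact
    -- support; hence the extension to Schwartz functions.
    have h1 := pair_eq_pair_laplacian hab (𝓕⁻ w)
    rw [SchwartzMap.laplacian_eq_fourierMultiplierCLM, SchwartzMap.fourierMultiplierCLM_apply,
      FourierTransform.fourier_fourierInv_eq] at h1
    have h2 : pair a (𝓕⁻ w) = inner ℂ A (w.toLp 2 volume) := by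
      rw [pair_eq_inner, ← Lp.inner_fourier_eq, SchwartzMap.toLp_fourier_eq,
        FourierTransform.fourier_fourierInv_eq]
    have h3 : pair b (𝓕⁻ y) = inner ℂ B (y.toLp 2 volume) := by
      rw [pair_eq_inner, ← Lp.inner_fourier_eq, SchwartzMap.toLp_fourier_eq,
        FourierTransform.fourier_fourierInv_eq]
    have h4 : inner ℂ A (w.toLp 2 volume) = -((2 * Real.pi) ^ 2 : ℝ) * inner ℂ B (y.toLp 2 volume) := by
      have h5 : (-(2 * Real.pi) ^ 2 : ℝ) • 𝓕⁻ y =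
          ((-(2 * Real.pi) ^ 2 : ℝ) : ℂ) • 𝓕⁻ y := by
        ext x; simp only [smul_apply, Complex.real_smul, smul_eq_mul]
      rw [← h2, ← h3, h1]
      refine (congrArg (pair b) h5).trans ?_
      rw [map_smul, smul_eq_mul, Complex.ofReal_neg]
    have h5 := congrArg (starRingEnd ℂ) h4
    rw [map_mul, inner_conj_symm, inner_conj_symm, map_neg, Complex.conj_ofReal, L2.inner_def,
      L2.inner_def] at h5
    have h6 : ∀ (f : L2C) (u : 𝓢(E3, ℂ)) (c : E3 → ℝ), (∀ k, u k = (c k : ℂ)) →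
        (Integrable fun k => (c k : ℂ) * f k) ∧
        ∫ k, inner ℂ ((u.toLp 2 volume : L2C) k) (f k) = ∫ k, (c k : ℂ) * f k := fun f u c hu => by
      have h7 : ∀ᵐ k, inner ℂ ((u.toLp 2 volume : L2C) k) (f k) = (c k : ℂ) * f k := by
        filter_upwards [u.coeFn_toLp 2 volume] with k hk
        rw [hk, hu, RCLike.inner_apply, Complex.conj_ofReal, mul_comm]
      exact ⟨(L2.integrable_inner (𝕜 := ℂ) (u.toLp 2 volume : L2C) f).congr h7,
        integral_congr_ae h7⟩
    rw [(h6 A w χ hwk).2, (h6 B y _ hyk).2] at h5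
    have h8 : ∀ k : E3, χ k • (A k + ((2 * Real.pi * ‖k‖) ^ 2 : ℝ) * B k) =
        (χ k : ℂ) * A k +
          (((2 * Real.pi) ^ 2 : ℝ) : ℂ) * (((‖k‖ ^ 2 * χ k : ℝ) : ℂ) * B k) := fun k => by
      rw [Complex.real_smul]; push_cast; ring
    simp_rw [h8]
    rw [integral_add (h6 A w χ hwk).1 ((h6 B y _ hyk).1.const_mul _), integral_const_mul, h5]
    ring
  filter_upwards [hsum] with k hk
  linear_combination hk

end WeakLaplacian

/-! ### The free waves as differentiable curves in L². -/

lemma hasDerivAt_toLp {a b : ℝ → E3 → ℂ} (ha : ∀ τ, MemLp (a τ) 2 (volume : Measure E3))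
    (hb : ∀ τ, MemLp (b τ) 2 (volume : Measure E3)) {g : E3 → ℂ} (hg : MemLp g 2 volume)
    (h : ∀ τ h, ∀ᵐ k, ‖a (τ + h) k - a τ k - h • b τ k‖ ≤ h ^ 2 * ‖g k‖) (τ : ℝ) :
    HasDerivAt (fun τ => (ha τ).toLp) (hb τ).toLp τ := by
  rw [hasDerivAt_iff_isLittleO_nhds_zero]
  -- A pointwise quadratic remainder with a square integrable coefficient is a quadratic remainder
  -- in the L² norm.
  have hbd : ∀ h : ℝ, ‖(ha (τ + h)).toLp - (ha τ).toLp - h • (hb τ).toLp‖ ≤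
      h ^ 2 * ‖hg.toLp‖ := fun r => by
    refine Lp.norm_le_mul_norm_of_ae_le_mul ?_
    filter_upwards [h τ r, Lp.coeFn_sub ((ha (τ + r)).toLp - (ha τ).toLp) (r • (hb τ).toLp),
      Lp.coeFn_sub (ha (τ + r)).toLp (ha τ).toLp, Lp.coeFn_smul r (hb τ).toLp,
      (ha (τ + r)).coeFn_toLp, (ha τ).coeFn_toLp, (hb τ).coeFn_toLp, hg.coeFn_toLp]
      with k h1 h2 h3 h4 h5 h6 h7 h8
    rw [h2, Pi.sub_apply, h3, Pi.sub_apply, h4, Pi.smul_apply, h5, h6, h7, h8]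
    exact h1
  refine Asymptotics.IsBigO.trans_isLittleO (g := fun h : ℝ => h ^ 2) ?_ ?_
  · refine Asymptotics.IsBigO.of_bound ‖hg.toLp‖ (Eventually.of_forall fun h => ?_)
    rw [Real.norm_of_nonneg (sq_nonneg h), mul_comm]
    exact hbd h
  · have := Asymptotics.isLittleO_pow_pow (𝕜 := ℝ) (show 1 < 2 by norm_num)
    simpa using this

lemma abs_sin_add_sub_le (x y : ℝ) : |Real.sin (x + y) - Real.sin x - y * Real.cos x| ≤ y ^ 2 := by
  have hd : ∀ u : ℝ, HasDerivAt (fun u => Real.sin (x + u) - u * Real.cos x)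
      (Real.cos (x + u) - Real.cos x) u := fun u => by
    have h1 := ((hasDerivAt_id u).const_add x).sin
    convert! h1.sub ((hasDerivAt_id u).mul_const (Real.cos x)) using 1
    simp
  have h := (convex_uIcc (0 : ℝ) y).norm_image_sub_le_of_norm_hasDerivWithin_le (C := |y|)
    (fun u _ => (hd u).hasDerivWithinAt) (fun u hu => ?_) left_mem_uIcc right_mem_uIcc
  · simp only [add_zero, zero_mul, sub_zero, Real.norm_eq_abs] at h
    rw [← sq_abs, sq]
    convert! h using 2
    ring
  · refine (Real.abs_cos_sub_cos_le _ _).trans ?_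
    rw [add_sub_cancel_left]
    simpa using abs_sub_left_of_mem_uIcc hu

lemma abs_cos_add_sub_le (x y : ℝ) : |Real.cos (x + y) - Real.cos x + y * Real.sin x| ≤ y ^ 2 := by
  have h := abs_sin_add_sub_le (x + Real.pi / 2) y
  have e : x + Real.pi / 2 + y = x + y + Real.pi / 2 := by ring
  rwa [e, Real.sin_add_pi_div_two, Real.sin_add_pi_div_two, Real.cos_add_pi_div_two, mul_neg,
    sub_neg_eq_add] at h

/-- The Schwartz function `(1 + λ²) G`. -/
noncomputable def energyWeight (m : ℝ) (G : 𝓢(E3, ℂ)) : 𝓢(E3, ℂ) :=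
  SchwartzMap.smulLeftCLM ℂ (fun k : E3 => 1 + ((2 * Real.pi) ^ 2 * ‖k‖ ^ 2 + m ^ 2)) G

lemma energyWeight_apply (m : ℝ) (G : 𝓢(E3, ℂ)) (k : E3) :
    energyWeight m G k = ((1 + lam m k ^ 2 : ℝ) : ℂ) * G k := by
  rw [energyWeight, SchwartzMap.smulLeftCLM_apply_apply (by fun_prop), lam_sq,
    Complex.real_smul]
  congr 2
  ring

lemma norm_energyWeight (m : ℝ) (G : 𝓢(E3, ℂ)) (k : E3) :
    ‖energyWeight m G k‖ = (1 + lam m k ^ 2) * ‖G k‖ := by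
  rw [energyWeight_apply, norm_mul, Complex.norm_real, Real.norm_of_nonneg (by positivity)]

lemma memLp_ofReal_mul (m : ℝ) (G : 𝓢(E3, ℂ)) {c : E3 → ℝ} (hc : Measurable c) {C : ℝ}
    (h : ∀ k, |c k| ≤ C * (1 + lam m k ^ 2)) :
    MemLp (fun k => (c k : ℂ) * G k) 2 (volume : Measure E3) := by
  have hG := G.continuous.measurable
  refine ((energyWeight m G).memLp 2 volume).of_le_mul (c := C)
    (Measurable.aestronglyMeasurable (by fun_prop)) (ae_of_all _ fun k => ?_)
  rw [norm_mul, Complex.norm_real, norm_energyWeight, ← mul_assoc]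
  exact mul_le_mul_of_nonneg_right (h k) (norm_nonneg _)

lemma measurable_lam (m : ℝ) : Measurable (lam m) := (continuous_lam m).measurable

lemma memLp_cos (m : ℝ) (G : 𝓢(E3, ℂ)) (τ : ℝ) :
    MemLp (fun k => ((Real.cos (τ * lam m k) : ℝ) : ℂ) * G k) 2 (volume : Measure E3) := by
  have := measurable_lam m
  refine memLp_ofReal_mul m G (C := 1) (by fun_prop) fun k => ?_
  nlinarith [Real.abs_cos_le_one (τ * lam m k), sq_nonneg (lam m k)]

lemma abs_sin_mul_div_le (τ l : ℝ) : |Real.sin (τ * l) / l| ≤ |τ| := by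
  rw [abs_div]
  refine div_le_of_le_mul₀ (abs_nonneg _) (abs_nonneg _) ?_
  rw [← abs_mul]
  exact Real.abs_sin_le_abs

lemma memLp_sin_div (m : ℝ) (G : 𝓢(E3, ℂ)) (τ : ℝ) :
    MemLp (fun k => ((Real.sin (τ * lam m k) / lam m k : ℝ) : ℂ) * G k) 2
      (volume : Measure E3) := by
  have := measurable_lam m
  refine memLp_ofReal_mul m G (C := |τ|) (by fun_prop) fun k => ?_
  refine (abs_sin_mul_div_le τ _).trans (le_mul_of_one_le_right (abs_nonneg _) ?_)
  nlinarith [sq_nonneg (lam m k)]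

lemma memLp_mul_sin (m : ℝ) (G : 𝓢(E3, ℂ)) (τ : ℝ) :
    MemLp (fun k => ((lam m k * Real.sin (τ * lam m k) : ℝ) : ℂ) * G k) 2
      (volume : Measure E3) := by
  have := measurable_lam m
  refine memLp_ofReal_mul m G (C := 1) (by fun_prop) fun k => ?_
  rw [abs_mul, abs_of_nonneg (lam_nonneg m k)]
  nlinarith [Real.abs_sin_le_one (τ * lam m k), lam_nonneg m k, sq_nonneg (lam m k - 1)]

/-- The wave `cos(τ λ) G`. -/
noncomputable def cosWave (m : ℝ) (G : 𝓢(E3, ℂ)) (τ : ℝ) : L2C := (memLp_cos m G τ).toLp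

/-- The wave `sin(τ λ) / λ · G`. -/
noncomputable def sinWave (m : ℝ) (G : 𝓢(E3, ℂ)) (τ : ℝ) : L2C := (memLp_sin_div m G τ).toLp

/-- The wave `λ sin(τ λ) G`. -/
noncomputable def mulSinWave (m : ℝ) (G : 𝓢(E3, ℂ)) (τ : ℝ) : L2C := (memLp_mul_sin m G τ).toLp

lemma ae_ne_zero : ∀ᵐ k : E3, k ≠ 0 := by simp [ae_iff, measure_singleton]

lemma hasDerivAt_sinWave (m : ℝ) (G : 𝓢(E3, ℂ)) (τ : ℝ) :
    HasDerivAt (sinWave m G) (cosWave m G τ) τ := by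
  refine hasDerivAt_toLp (memLp_sin_div m G) (memLp_cos m G) ((energyWeight m G).memLp 2 volume)
    (fun τ h => ae_ne_zero.mono fun k hk => ?_) τ
  have hl := lam_pos m hk
  have e : ((Real.sin ((τ + h) * lam m k) / lam m k : ℝ) : ℂ) * G k -
      ((Real.sin (τ * lam m k) / lam m k : ℝ) : ℂ) * G k -
      h • (((Real.cos (τ * lam m k) : ℝ) : ℂ) * G k) =
      (((Real.sin (τ * lam m k + h * lam m k) - Real.sin (τ * lam m k) -
        h * lam m k * Real.cos (τ * lam m k)) / lam m k : ℝ) : ℂ) * G k := by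
    rw [add_mul, Complex.real_smul]
    have : (lam m k : ℂ) ≠ 0 := by exact_mod_cast hl.ne'
    push_cast
    field_simp
  rw [e, norm_mul, Complex.norm_real, norm_energyWeight, ← mul_assoc, norm_div, Real.norm_eq_abs,
    Real.norm_of_nonneg hl.le]
  refine mul_le_mul_of_nonneg_right ?_ (norm_nonneg _)
  rw [div_le_iff₀ hl]
  refine (abs_sin_add_sub_le _ _).trans ?_
  have h1 : lam m k ≤ 1 + lam m k ^ 2 := by nlinarith [sq_nonneg (lam m k - 1)]
  calc (h * lam m k) ^ 2 = h ^ 2 * lam m k * lam m k := by ring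
    _ ≤ _ := by gcongr

lemma hasDerivAt_cosWave (m : ℝ) (G : 𝓢(E3, ℂ)) (τ : ℝ) :
    HasDerivAt (cosWave m G) (-mulSinWave m G τ) τ := by
  have hn : ∀ τ, MemLp (fun k => -(((lam m k * Real.sin (τ * lam m k) : ℝ) : ℂ) * G k)) 2
    (volume : Measure E3) := fun τ => (memLp_mul_sin m G τ).neg
  have h0 := hasDerivAt_toLp (memLp_cos m G) hn ((energyWeight m G).memLp 2 volume)
    (fun τ h => ae_of_all _ fun k => ?_) τ
  · exact h0
  have e : ((Real.cos ((τ + h) * lam m k) : ℝ) : ℂ) * G k -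
      ((Real.cos (τ * lam m k) : ℝ) : ℂ) * G k -
      h • (-(((lam m k * Real.sin (τ * lam m k) : ℝ) : ℂ) * G k)) =
      ((Real.cos (τ * lam m k + h * lam m k) - Real.cos (τ * lam m k) +
        h * lam m k * Real.sin (τ * lam m k) : ℝ) : ℂ) * G k := by
    rw [add_mul, Complex.real_smul]
    push_cast
    ring
  rw [e, norm_mul, Complex.norm_real, norm_energyWeight, ← mul_assoc, Real.norm_eq_abs]
  refine mul_le_mul_of_nonneg_right ((abs_cos_add_sub_le _ _).trans ?_) (norm_nonneg _)
  rw [mul_pow]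
  gcongr
  linarith

lemma cosWave_zero (m : ℝ) (G : 𝓢(E3, ℂ)) : cosWave m G 0 = G.toLp 2 volume := by
  refine Lp.ext ?_
  filter_upwards [(memLp_cos m G 0).coeFn_toLp, G.coeFn_toLp 2 volume] with k h1 h2
  rw [cosWave, h1, h2]; simp

lemma sinWave_zero (m : ℝ) (G : 𝓢(E3, ℂ)) : sinWave m G 0 = 0 := by
  refine Lp.ext ?_
  filter_upwards [(memLp_sin_div m G 0).coeFn_toLp, Lp.coeFn_zero ℂ 2 (volume : Measure E3)]
    with k h1 h2
  rw [sinWave, h1, h2]; simp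

/-- The unbounded factor λ² is moved from g, which is only in L², to the wave, where it turns sin/λ
into λ sin acting on a Schwartz function. -/
lemma inner_sinWave_eq_neg (m : ℝ) (G : 𝓢(E3, ℂ)) (τ : ℝ) {f g : L2C}
    (hfg : ∀ᵐ k, f k = -((lam m k ^ 2 : ℝ) : ℂ) * g k) :
    inner ℂ (sinWave m G τ) f = -inner ℂ (mulSinWave m G τ) g := by
  rw [L2.inner_def, L2.inner_def, ← integral_neg]
  refine integral_congr_ae ?_
  filter_upwards [hfg, (memLp_sin_div m G τ).coeFn_toLp, (memLp_mul_sin m G τ).coeFn_toLp,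
    ae_ne_zero] with k h1 h2 h3 hk
  have hl : (lam m k : ℂ) ≠ 0 := by exact_mod_cast (lam_pos m hk).ne'
  rw [sinWave, mulSinWave, h1, h2, h3]
  simp only [RCLike.inner_apply, map_mul, Complex.conj_ofReal]
  push_cast
  field_simp

/-- A product rule which needs only weak differentiability of the second factor. -/
lemma hasDerivAt_inner_of_weak {H : Type*} [NormedAddCommGroup H] [InnerProductSpace ℂ H]
    {f g : ℝ → H} {f' : H} {d : ℂ} {s : ℝ} (hf : HasDerivAt f f' s) (hg : ContinuousAt g s)
    (hd : HasDerivAt (fun r => inner ℂ (f s) (g r)) d s) :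
    HasDerivAt (fun r => inner ℂ (f r) (g r)) (inner ℂ f' (g s) + d) s := by
  -- Since f r - f s vanishes at r = s, only the slope of f matters and continuity of g is enough.
  have h1 : HasDerivAt (fun r => inner ℂ (f r - f s) (g r)) (inner ℂ f' (g s)) s := by
    rw [hasDerivAt_iff_tendsto_slope] at hf ⊢
    have h2 := hf.inner (𝕜 := ℂ) (hg.tendsto.mono_left nhdsWithin_le_nhds)
    refine h2.congr fun r => ?_
    rw [slope_def_module, slope_def_module, sub_self, inner_zero_left, sub_zero,
      inner_smul_left_eq_smul]
  refine (h1.add hd).congr_of_eventuallyEq (Eventually.of_forall fun r => ?_)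
  simp only [Pi.add_apply, inner_sub_left]
  ring

/-- The unitary Fourier transform on real square integrable functions. -/
noncomputable def fourierReal : L2 →L[ℝ] L2C :=
  (((Lp.fourierTransformₗᵢ E3 ℂ).toContinuousLinearEquiv : L2C →L[ℂ] L2C).restrictScalars ℝ).comp
    toComplex

lemma fourierReal_apply (a : L2) : fourierReal a = 𝓕 (toComplex a) := rfl

/-- The coordinate derivative of a Schwartz function. -/
noncomputable def partialDeriv (s : 𝓢(E3, ℂ)) (i : Fin 3) : 𝓢(E3, ℂ) :=
  ∂_{(EuclideanSpace.single i (1 : ℝ) : E3)} s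

lemma fourier_partialDeriv (s : 𝓢(E3, ℂ)) (i : Fin 3) (k : E3) :
    𝓕 (partialDeriv s i) k = 2 * Real.pi * Complex.I * k i * 𝓕 s k := by
  rw [partialDeriv, SchwartzMap.fourier_lineDerivOp_eq, smul_apply,
    SchwartzMap.smulLeftCLM_apply_apply (by fun_prop), EuclideanSpace.inner_single_right]
  simp
  ring

/-- The factor 2πi k from each derivative, one of them conjugated, produces the 4π² k_i k_j of the
memory kernel. -/
lemma inner_sinWave_partialDeriv (m : ℝ) (s : 𝓢(E3, ℂ)) (i j : Fin 3) (τ : ℝ) :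
    inner ℂ (sinWave m (𝓕 (partialDeriv s i)) τ) ((𝓕 (partialDeriv s j)).toLp 2 volume) =
      4 * (Real.pi : ℂ) ^ 2 * retarded m (formFactorSchwartz s) i j τ := by
  rw [L2.inner_def, retarded, ← integral_const_mul]
  refine integral_congr_ae ?_
  filter_upwards [(memLp_sin_div m (𝓕 (partialDeriv s i)) τ).coeFn_toLp,
    (𝓕 (partialDeriv s j)).coeFn_toLp 2 volume] with k h1 h2
  rw [sinWave, h1, h2, formFactorSchwartz_apply, formFactor, Complex.ofReal_pow,
    ← Complex.conj_mul']
  simp only [RCLike.inner_apply, map_mul, Complex.conj_ofReal, fourier_partialDeriv,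
    Complex.conj_I, map_ofNat]
  push_cast
  linear_combination (-4 * Real.pi ^ 2 * (k i : ℂ) * k j * (starRingEnd ℂ) (𝓕 s k) * 𝓕 s k *
    (Complex.sin (τ * lam m k) / lam m k)) * Complex.I_sq

/-! ### Duhamel's formula for the fields. -/

/-- The field equations, integrated in time: `φ̇ = π` in `L²` and, in the weak sense,
`π(t) - π(0) = (Δ - m²) ∫ φ - ∑ⱼ (∫ qⱼ) rⱼ`. -/
structure FieldEvolution (m : ℝ) (r : Fin 3 → L2) (q : Fin 3 → ℝ → ℝ) (φ π : ℝ → L2) : Prop where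
  hasDerivAt : ∀ t, HasDerivAt φ (π t) t
  continuous_mom : Continuous π
  continuous_source : ∀ j, Continuous (q j)
  weak : ∀ t, ∀ χ : E3 → ℝ, IsTest χ →
    ∫ x, (π t - π 0 + m ^ 2 • (∫ s in (0 : ℝ)..t, φ s) +
      ∑ j, (∫ s in (0 : ℝ)..t, q j s) • r j : L2) x * χ x =
        ∫ x, (∫ s in (0 : ℝ)..t, φ s : L2) x * Δ χ x

namespace FieldEvolution

variable {m : ℝ} {r : Fin 3 → L2} {q : Fin 3 → ℝ → ℝ} {φ π : ℝ → L2}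
  (h : FieldEvolution m r q φ π)

include h

lemma continuous_pos : Continuous φ :=
  continuous_iff_continuousAt.mpr fun t => (h.hasDerivAt t).continuousAt

lemma fourier_weak (t : ℝ) : ∀ᵐ k, (fourierReal (π t) - fourierReal (π 0) +
      ∑ j, (∫ s in (0 : ℝ)..t, q j s) • fourierReal (r j) : L2C) k =
    -((lam m k ^ 2 : ℝ) : ℂ) * (fourierReal (∫ s in (0 : ℝ)..t, φ s) : L2C) k := by
  set Φ : L2 := ∫ s in (0 : ℝ)..t, φ s with hΦ
  have h1 := fourier_eq_of_weakLaplacian (h.weak t)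
  rw [← hΦ, ← fourierReal_apply, ← fourierReal_apply] at h1
  simp only [map_add, map_sub, map_sum, map_smul] at h1
  set S : L2C := fourierReal (π t) - fourierReal (π 0) with hS
  set U : L2C := ∑ j, (∫ s in (0 : ℝ)..t, q j s) • fourierReal (r j) with hU
  filter_upwards [h1, Lp.coeFn_add (S + m ^ 2 • fourierReal Φ) U, Lp.coeFn_add S U,
    Lp.coeFn_add S (m ^ 2 • fourierReal Φ), Lp.coeFn_smul (m ^ 2) (fourierReal Φ)]
    with k h1 h2 h3 h4 h5
  rw [h2, Pi.add_apply, h4, Pi.add_apply, h5, Pi.smul_apply, Complex.real_smul] at h1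
  rw [h3, Pi.add_apply, lam_sq]
  push_cast at h1 ⊢
  linear_combination h1

/-- Although π itself is only continuous in L², its pairing with a wave of Schwartz profile is
differentiable: `fourier_weak` expresses it through time integrals of φ and q. -/
lemma hasDerivAt_inner_sinWave (G : 𝓢(E3, ℂ)) (τ t : ℝ) :
    HasDerivAt (fun t => inner ℂ (sinWave m G τ) (fourierReal (π t)))
      (-inner ℂ (mulSinWave m G τ) (fourierReal (φ t)) -
        ∑ j, (q j t : ℂ) * inner ℂ (sinWave m G τ) (fourierReal (r j))) t := by
  have e : (fun t => inner ℂ (sinWave m G τ) (fourierReal (π t))) = fun t =>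
      inner ℂ (sinWave m G τ) (fourierReal (π 0)) +
        (-inner ℂ (mulSinWave m G τ) (fourierReal (∫ s in (0 : ℝ)..t, φ s)) -
        ∑ j, ((∫ s in (0 : ℝ)..t, q j s : ℝ) : ℂ) *
          inner ℂ (sinWave m G τ) (fourierReal (r j))) := by
    funext t
    have h1 := inner_sinWave_eq_neg m G τ (h.fourier_weak t)
    rw [inner_add_right, inner_sub_right, inner_sum] at h1
    have h2 : ∀ j, inner ℂ (sinWave m G τ) ((∫ s in (0 : ℝ)..t, q j s) • fourierReal (r j)) =
        ((∫ s in (0 : ℝ)..t, q j s : ℝ) : ℂ) * inner ℂ (sinWave m G τ) (fourierReal (r j)) :=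
      fun j => by rw [inner_smul_right_eq_smul, Complex.real_smul]
    simp_rw [h2] at h1
    linear_combination h1
  rw [e]
  refine HasDerivAt.const_add _ (HasDerivAt.sub (HasDerivAt.neg ?_)
    (HasDerivAt.fun_sum fun j _ => HasDerivAt.mul_const ?_ _))
  · have h1 : HasDerivAt (fun t => ∫ s in (0 : ℝ)..t, φ s) (φ t) t :=
      intervalIntegral.integral_hasDerivAt_right (h.continuous_pos.intervalIntegrable _ _)
        (h.continuous_pos.stronglyMeasurableAtFilter _ _) h.continuous_pos.continuousAt
    exact ((((innerSL ℂ (mulSinWave m G τ)).restrictScalars ℝ).comp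
      fourierReal).hasFDerivAt.comp_hasDerivAt t h1)
  · exact (intervalIntegral.integral_hasDerivAt_right ((h.continuous_source j).intervalIntegrable _ _)
      ((h.continuous_source j).stronglyMeasurableAtFilter _ _)
      (h.continuous_source j).continuousAt).ofReal_comp

/-- The waves at time T - s solve the backward free equation, so all terms cancel except the source.
-/
lemma hasDerivAt_duality (G : 𝓢(E3, ℂ)) (T s : ℝ) :
    HasDerivAt (fun s => inner ℂ (cosWave m G (T - s)) (fourierReal (φ s)) +
      inner ℂ (sinWave m G (T - s)) (fourierReal (π s)))
      (-∑ j, (q j s : ℂ) * inner ℂ (sinWave m G (T - s)) (fourierReal (r j))) s := by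
  have hT : HasDerivAt (fun s => T - s) (-1) s := by simpa using (hasDerivAt_id s).const_sub T
  have hc := (hasDerivAt_cosWave m G (T - s)).scomp s hT
  have hs := (hasDerivAt_sinWave m G (T - s)).scomp s hT
  have hφ := fourierReal.hasFDerivAt.comp_hasDerivAt s (h.hasDerivAt s)
  have h1 := hc.inner ℂ hφ
  have h2 := hasDerivAt_inner_of_weak hs
    (fourierReal.continuous.comp h.continuous_mom).continuousAt
    (h.hasDerivAt_inner_sinWave G (T - s) s)
  convert! h1.add h2 using 1
  simp only [Function.comp_apply, neg_smul, one_smul, neg_neg, inner_neg_left]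
  ring

/-- Duhamel's formula for the field, tested against `G`. -/
theorem inner_eq_duhamel (G : 𝓢(E3, ℂ)) (T : ℝ) :
    inner ℂ (G.toLp 2 volume) (fourierReal (φ T)) =
      inner ℂ (cosWave m G T) (fourierReal (φ 0)) + inner ℂ (sinWave m G T) (fourierReal (π 0)) -
        ∫ s in (0 : ℝ)..T, ∑ j, (q j s : ℂ) *
          inner ℂ (sinWave m G (T - s)) (fourierReal (r j)) := by
  have hsc : Continuous (sinWave m G) :=
    continuous_iff_continuousAt.mpr fun τ => (hasDerivAt_sinWave m G τ).continuousAt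
  have hcont : Continuous fun s => -∑ j, (q j s : ℂ) *
      inner ℂ (sinWave m G (T - s)) (fourierReal (r j)) := by
    have := h.continuous_source
    refine (continuous_finsetSum _ fun j _ => ?_).neg
    exact (Complex.continuous_ofReal.comp (this j)).mul
      ((hsc.comp (continuous_const.sub continuous_id)).inner continuous_const)
  have h1 := intervalIntegral.integral_eq_sub_of_hasDerivAt
    (fun s _ => h.hasDerivAt_duality G T s) (hcont.intervalIntegrable 0 T)
  rw [intervalIntegral.integral_neg, sub_self, cosWave_zero, sinWave_zero, inner_zero_left,
    sub_zero] at h1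
  linear_combination -h1

end FieldEvolution

/-! ### Pairing of free waves with localized data. -/

lemma integral_fourierInv_mul_schwartz {g : E3 → ℂ} (hg : Integrable g) (u : 𝓢(E3, ℂ)) :
    ∫ k, 𝓕⁻ u k • g k = ∫ x, u x • 𝓕⁻ g x := by
  have h := VectorFourier.integral_fourierIntegral_smul_eq_flip (L := -innerₗ E3)
    (μ := volume) (ν := volume) Real.continuous_fourierChar
    (show Continuous fun p : E3 × E3 => (-innerₗ E3) p.1 p.2 from continuous_inner.neg)
    u.integrable hg
  have e : (-innerₗ E3).flip = -innerₗ E3 := by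
    ext x y; simp [real_inner_comm]
  rw [e] at h
  rw [SchwartzMap.fourierInv_coe]
  exact h

/-- On `L¹ ∩ L²` the unitary inverse Fourier transform is given by the Fourier integral. -/
lemma fourierInv_toLp_ae_eq {g : E3 → ℂ} (hg : Integrable g) (hg2 : MemLp g 2 volume) :
    ((𝓕⁻ hg2.toLp : L2C) : E3 → ℂ) =ᵐ[volume] 𝓕⁻ g := by
  have hcont : Continuous (𝓕⁻ g) :=
    VectorFourier.fourierIntegral_continuous (L := -innerₗ E3) Real.continuous_fourierChar
      (show Continuous fun p : E3 × E3 => (-innerₗ E3) p.1 p.2 from continuous_inner.neg) hg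
  refine ae_eq_of_integral_contDiff_smul_eq
    ((Lp.memLp _).locallyIntegrable (by norm_num)) hcont.locallyIntegrable fun χ hχ hχc => ?_
  have hχc' : HasCompactSupport fun k => (χ k : ℂ) := hχc.comp_left Complex.ofReal_zero
  set u : 𝓢(E3, ℂ) := hχc'.toSchwartzMap (Complex.ofRealCLM.contDiff.comp hχ)
  have h1 := DFunLike.congr_fun (Lp.fourierInv_toTemperedDistribution_eq (hg2.toLp g)) u
  rw [TemperedDistribution.fourierInv_apply, Lp.toTemperedDistribution_apply,
    Lp.toTemperedDistribution_apply] at h1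
  have h2 : ∫ x, 𝓕⁻ u x • (hg2.toLp g) x = ∫ x, 𝓕⁻ u x • g x := by
    refine integral_congr_ae ?_
    filter_upwards [hg2.coeFn_toLp] with x hx
    rw [hx]
  rw [h2, integral_fourierInv_mul_schwartz hg] at h1
  exact h1.symm

/-- Plancherel brings the pairing back to x-space, where `a` lives on a ball: only the supremum of
the wave on that ball enters, and Cauchy–Schwarz bounds the L¹ norm of `a`. -/
lemma norm_inner_toLp_fourierReal_le {g : E3 → ℂ} (hg : Integrable g) (hg2 : MemLp g 2 volume)
    {a : L2} {R B : ℝ} (ha : ∀ᵐ x : E3, R < ‖x‖ → a x = 0) (hB0 : 0 ≤ B)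
    (hB : ∀ x : E3, ‖x‖ ≤ R → ‖𝓕⁻ g x‖ ≤ B) :
    ‖inner ℂ (hg2.toLp : L2C) (fourierReal a)‖ ≤
      B * (√(volume.real (Metric.closedBall (0 : E3) R)) * ‖a‖) := by
  have e : inner ℂ (hg2.toLp : L2C) (fourierReal a) =
      ∫ x in Metric.closedBall (0 : E3) R, starRingEnd ℂ (𝓕⁻ g x) * (a x : ℂ) := by
    have h1 : inner ℂ (hg2.toLp : L2C) (fourierReal a) =
        inner ℂ (𝓕⁻ hg2.toLp : L2C) (toComplex a) := by
      rw [fourierReal_apply, ← Lp.inner_fourier_eq (𝓕⁻ hg2.toLp) (toComplex a),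
        FourierTransform.fourier_fourierInv_eq]
    rw [h1, L2.inner_def, ← integral_indicator Metric.isClosed_closedBall.measurableSet]
    refine integral_congr_ae ?_
    filter_upwards [fourierInv_toLp_ae_eq hg hg2, coeFn_toComplex a, ha] with x h2 h3 h4
    rw [h2, h3, RCLike.inner_apply, mul_comm]
    by_cases hx : x ∈ Metric.closedBall (0 : E3) R
    · rw [indicator_of_mem hx]
    · rw [indicator_of_notMem hx, h4 (by simpa using hx)]
      simp
  have hfin : IsFiniteMeasure ((volume : Measure E3).restrict (Metric.closedBall 0 R)) :=
    ⟨by simpa using (measure_closedBall_lt_top : volume (Metric.closedBall (0 : E3) R) < ⊤)⟩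
  have hai : IntegrableOn a (Metric.closedBall (0 : E3) R) :=
    ((Lp.memLp a).restrict _).integrable (by norm_num)
  have h5 : ∫ x in Metric.closedBall (0 : E3) R, ‖a x‖ ≤
      √(volume.real (Metric.closedBall (0 : E3) R)) * ‖a‖ := by
    have hone : MemLp (fun _ : E3 => (1 : ℝ)) (ENNReal.ofReal 2)
        (volume.restrict (Metric.closedBall 0 R)) := memLp_const 1
    have ha2 : MemLp (fun x => ‖a x‖) (ENNReal.ofReal 2)
        (volume.restrict (Metric.closedBall 0 R)) := by
      have : MemLp a (ENNReal.ofReal 2) (volume.restrict (Metric.closedBall 0 R)) := by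
        simpa using (Lp.memLp a).restrict (Metric.closedBall (0 : E3) R)
      exact this.norm
    have h6 := integral_mul_le_Lp_mul_Lq_of_nonneg Real.HolderConjugate.two_two
      (ae_of_all _ fun _ => zero_le_one) (ae_of_all _ fun x => norm_nonneg (a x)) hone ha2
    simp only [one_mul, Real.rpow_two] at h6
    rw [← Real.sqrt_eq_rpow, ← Real.sqrt_eq_rpow] at h6
    refine h6.trans ?_
    rw [setIntegral_const, smul_eq_mul, one_pow, mul_one]
    gcongr
    refine Real.sqrt_le_iff.mpr ⟨norm_nonneg _, ?_⟩
    have h7 : ‖a‖ ^ 2 = ∫ x, ‖a x‖ ^ 2 := by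
      rw [← real_inner_self_eq_norm_sq, L2.inner_def]
      simp
    rw [h7]
    refine setIntegral_le_integral ?_ (ae_of_all _ fun x => sq_nonneg _)
    exact (memLp_two_iff_integrable_sq_norm (Lp.memLp a).1).mp (Lp.memLp a)
  rw [e]
  calc _ ≤ ∫ x in Metric.closedBall (0 : E3) R, B * ‖a x‖ := by
        refine norm_integral_le_of_norm_le (hai.norm.const_mul B) ?_
        filter_upwards [ae_restrict_mem Metric.isClosed_closedBall.measurableSet] with x hx
        rw [norm_mul, RCLike.norm_conj, Complex.norm_real]
        exact mul_le_mul_of_nonneg_right (hB x (by simpa using hx)) (norm_nonneg _)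
    _ ≤ _ := by
        rw [integral_const_mul]
        gcongr

lemma fourierInv_apply_eq_integral (g : E3 → ℂ) (x : E3) : 𝓕⁻ g x =
    ∫ k, Complex.exp (Complex.I * ((2 * Real.pi * inner ℝ x k : ℝ) : ℂ)) * g k := by
  rw [Real.fourierInv_eq']
  congr 1 with k
  rw [smul_eq_mul, real_inner_comm, mul_comm Complex.I]

section Waves

variable {m : ℝ} {G : 𝓢(E3, ℂ)}

lemma integrable_cos_mul (m : ℝ) (G : 𝓢(E3, ℂ)) (τ : ℝ) :
    Integrable fun k => ((Real.cos (τ * lam m k) : ℝ) : ℂ) * G k := by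
  have h1 := measurable_lam m
  have h2 := G.continuous.measurable
  refine G.integrable.mono (Measurable.aestronglyMeasurable (by fun_prop)) (ae_of_all _ fun k => ?_)
  rw [norm_mul, Complex.norm_real]
  exact mul_le_of_le_one_left (norm_nonneg _) (Real.abs_cos_le_one _)

lemma integrable_sin_div_mul (m : ℝ) (G : 𝓢(E3, ℂ)) (τ : ℝ) :
    Integrable fun k => ((Real.sin (τ * lam m k) / lam m k : ℝ) : ℂ) * G k := by
  have h1 := measurable_lam m
  have h2 := G.continuous.measurable
  refine (G.integrable.norm.const_mul |τ|).mono' (Measurable.aestronglyMeasurable (by fun_prop))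
    (ae_of_all _ fun k => ?_)
  rw [norm_mul, Complex.norm_real]
  exact mul_le_mul_of_nonneg_right (abs_sin_mul_div_le τ _) (norm_nonneg _)

lemma norm_cexp_I_mul (r : ℝ) : ‖Complex.exp (Complex.I * r)‖ = 1 := by
  rw [Complex.norm_exp]; simp

/-- Local decay of the free waves issuing from a smooth profile. -/
lemma exists_norm_fourierInv_wave_le (hm : 0 ≤ m)
    (hG : Integrable fun k => G k / (lam m k : ℂ)) {R : ℝ} (hR : 0 ≤ R) :
    ∃ C, 0 ≤ C ∧ ∀ τ, ∀ x : E3, ‖x‖ ≤ R →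
      ‖𝓕⁻ (fun k => ((Real.cos (τ * lam m k) : ℝ) : ℂ) * G k) x‖ ≤ C * wt τ ∧
      ‖𝓕⁻ (fun k => ((Real.sin (τ * lam m k) / lam m k : ℝ) : ℂ) * G k) x‖ ≤ C * wt τ := by
  obtain ⟨C, hC, h⟩ := exists_norm_integral_cexp_lam_le G hm hR
  refine ⟨C, hC, fun τ x hx => ?_⟩
  have hlm := measurable_lam m
  have hGm := G.continuous.measurable
  set e : E3 → ℂ := fun k => Complex.exp (Complex.I * ((2 * Real.pi * inner ℝ x k : ℝ) : ℂ)) with he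
  have he1 : ∀ k, ‖e k‖ = 1 := fun k => norm_cexp_I_mul _
  have heτ : ∀ (τ : ℝ) k, ‖Complex.exp (Complex.I * τ * lam m k)‖ = 1 := fun τ k => by
    have := norm_cexp_I_mul (τ * lam m k)
    push_cast at this
    rwa [← mul_assoc] at this
  have hi1 : ∀ τ : ℝ, Integrable fun k => e k * G k * Complex.exp (Complex.I * τ * lam m k) :=
    fun τ => by
      refine G.integrable.mono (Measurable.aestronglyMeasurable (by fun_prop))
        (ae_of_all _ fun k => ?_)
      rw [norm_mul, norm_mul, he1, heτ, one_mul, mul_one]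
  have hi2 : ∀ τ : ℝ, Integrable fun k =>
      e k * G k * (Complex.exp (Complex.I * τ * lam m k) / lam m k) := fun τ => by
    refine hG.mono (Measurable.aestronglyMeasurable (by fun_prop)) (ae_of_all _ fun k => ?_)
    rw [norm_mul, norm_mul, norm_div, he1, heτ, one_mul, norm_div, mul_one_div]
  have hp : ‖∫ k, e k * G k * Complex.exp (Complex.I * τ * lam m k)‖ ≤ C * wt τ ∧
      ‖∫ k, e k * G k * (Complex.exp (Complex.I * τ * lam m k) / lam m k)‖ ≤ C * wt τ := h x hx τ
  have hn : ‖∫ k, e k * G k * Complex.exp (Complex.I * (-τ : ℝ) * lam m k)‖ ≤ C * wt τ ∧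
      ‖∫ k, e k * G k * (Complex.exp (Complex.I * (-τ : ℝ) * lam m k) / lam m k)‖ ≤ C * wt τ := by
    rw [← wt_neg τ]
    exact h x hx (-τ)
  have e2 : ∀ k, Complex.I * ((-τ : ℝ) : ℂ) * lam m k = -(τ * lam m k) * Complex.I := fun k => by
    push_cast; ring
  have e1 : ∀ k, Complex.I * (τ : ℂ) * lam m k = τ * lam m k * Complex.I := fun k => by ring
  constructor
  · have e3 : 𝓕⁻ (fun k => ((Real.cos (τ * lam m k) : ℝ) : ℂ) * G k) x =
        2⁻¹ * ((∫ k, e k * G k * Complex.exp (Complex.I * τ * lam m k)) +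
          ∫ k, e k * G k * Complex.exp (Complex.I * (-τ : ℝ) * lam m k)) := by
      rw [fourierInv_apply_eq_integral, ← integral_add (hi1 τ) (hi1 (-τ)), ← integral_const_mul]
      congr 1 with k
      change e k * _ = _
      rw [e2, e1]
      push_cast
      rw [Complex.cos]
      ring
    rw [e3, norm_mul]
    have := norm_add_le (∫ k, e k * G k * Complex.exp (Complex.I * τ * lam m k))
      (∫ k, e k * G k * Complex.exp (Complex.I * (-τ : ℝ) * lam m k))
    rw [norm_inv, Complex.norm_ofNat]
    linarith [hp.1, hn.1]
  · have e3 : 𝓕⁻ (fun k => ((Real.sin (τ * lam m k) / lam m k : ℝ) : ℂ) * G k) x =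
        (-Complex.I / 2) * ((∫ k, e k * G k * (Complex.exp (Complex.I * τ * lam m k) / lam m k)) -
          ∫ k, e k * G k * (Complex.exp (Complex.I * (-τ : ℝ) * lam m k) / lam m k)) := by
      rw [fourierInv_apply_eq_integral, ← integral_sub (hi2 τ) (hi2 (-τ)), ← integral_const_mul]
      congr 1 with k
      change e k * _ = _
      rw [e2, e1]
      push_cast
      rw [Complex.sin]
      ring
    rw [e3, norm_mul, norm_div, norm_neg, Complex.norm_I, Complex.norm_ofNat]
    have := norm_sub_le (∫ k, e k * G k * (Complex.exp (Complex.I * τ * lam m k) / lam m k))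
      (∫ k, e k * G k * (Complex.exp (Complex.I * (-τ : ℝ) * lam m k) / lam m k))
    linarith [hp.2, hn.2]

/-- Local decay of the free waves, tested against localized data. -/
lemma exists_norm_inner_wave_le (hm : 0 ≤ m)
    (hG : Integrable fun k => G k / (lam m k : ℂ)) {R : ℝ} (hR : 0 ≤ R) :
    ∃ C, 0 ≤ C ∧ ∀ a b : L2, (∀ᵐ x : E3, R < ‖x‖ → a x = 0) → (∀ᵐ x : E3, R < ‖x‖ → b x = 0) →
      ∀ τ, ‖inner ℂ (cosWave m G τ) (fourierReal a) + inner ℂ (sinWave m G τ) (fourierReal b)‖ ≤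
        C * (‖a‖ + ‖b‖) * wt τ := by
  obtain ⟨C, hC, h⟩ := exists_norm_fourierInv_wave_le hm hG hR
  set v := √(volume.real (Metric.closedBall (0 : E3) R))
  refine ⟨C * v, by positivity, fun a b ha hb τ => ?_⟩
  have hw : 0 ≤ C * wt τ := mul_nonneg hC (wt_nonneg τ)
  have h1 := norm_inner_toLp_fourierReal_le (integrable_cos_mul m G τ) (memLp_cos m G τ) ha hw
    fun x hx => (h τ x hx).1
  have h2 := norm_inner_toLp_fourierReal_le (integrable_sin_div_mul m G τ) (memLp_sin_div m G τ)
    hb hw fun x hx => (h τ x hx).2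
  calc _ ≤ _ := norm_add_le _ _
    _ ≤ C * wt τ * (v * ‖a‖) + C * wt τ * (v * ‖b‖) := add_le_add h1 h2
    _ = _ := by ring

/-- The factor 2πi k_i of the derivative is bounded by λ, which removes the singularity at k = 0 for
a massless field. -/
lemma integrable_fourier_partialDeriv_div (m : ℝ) (s : 𝓢(E3, ℂ)) (i : Fin 3) :
    Integrable fun k => 𝓕 (partialDeriv s i) k / (lam m k : ℂ) := by
  have h1 := measurable_lam m
  have h2 := (𝓕 (partialDeriv s i)).continuous.measurable
  refine (𝓕 s).integrable.mono (Measurable.aestronglyMeasurable (by fun_prop))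
    (ae_of_all _ fun k => ?_)
  rw [fourier_partialDeriv, norm_div, Complex.norm_real, Real.norm_of_nonneg (lam_nonneg m k)]
  refine div_le_of_le_mul₀ (lam_nonneg m k) (norm_nonneg _) ?_
  have h3 : ‖(2 * Real.pi * Complex.I * k i : ℂ)‖ ≤ lam m k := by
    refine le_trans ?_ (two_pi_norm_le_lam m k)
    simp only [norm_mul, Complex.norm_I, Complex.norm_real, Complex.norm_ofNat, mul_one]
    rw [Real.norm_of_nonneg Real.pi_pos.le]
    exact mul_le_mul_of_nonneg_left (PiLp.norm_apply_le k i) (by positivity)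
  rw [norm_mul, mul_comm]
  exact mul_le_mul_of_nonneg_left h3 (norm_nonneg _)

end Waves

/-! ### From a solution of the coupled system to the Volterra equation. -/

/-- The pairing of a square integrable function with a real Schwartz function. -/
noncomputable def realPair (u : 𝓢(E3, ℝ)) : L2 →L[ℝ] ℝ := innerSL ℝ (u.toLp 2 volume)

lemma realPair_apply (u : 𝓢(E3, ℝ)) (a : L2) : realPair u a = ∫ x, a x * u x := by
  rw [realPair, innerSL_apply_apply, L2.inner_def]
  refine integral_congr_ae ?_
  filter_upwards [u.coeFn_toLp 2 volume] with x hx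
  rw [hx]; rfl

/-- A test function as a Schwartz function. -/
noncomputable def IsTest.toSchwartz {χ : E3 → ℝ} (hχ : IsTest χ) : 𝓢(E3, ℝ) :=
  hχ.2.toSchwartzMap hχ.1

lemma IsTest.toSchwartz_apply {χ : E3 → ℝ} (hχ : IsTest χ) (x : E3) : hχ.toSchwartz x = χ x := rfl

lemma IsTest.realPair_laplacian {χ : E3 → ℝ} (hχ : IsTest χ) (a : L2) :
    realPair (Δ hχ.toSchwartz) a = ∫ x, a x * Δ χ x := by
  rw [realPair_apply]
  congr 1 with x
  rw [SchwartzMap.laplacian_apply]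
  rfl

lemma eq_zero_of_realPair_eq_zero {a : L2}
    (h : ∀ (χ : E3 → ℝ) (hχ : IsTest χ), realPair hχ.toSchwartz a = 0) : a = 0 := by
  have h0 : a =ᵐ[volume] (0 : E3 → ℝ) := ae_eq_zero_of_integral_contDiff_smul_eq_zero
    ((Lp.memLp a).locallyIntegrable (by norm_num)) fun χ h1 h2 => ?_
  · exact Lp.ext (h0.trans (Lp.coeFn_zero ℝ 2 (volume : Measure E3)).symm)
  have h3 := h χ ⟨h1, h2⟩
  rw [realPair_apply] at h3
  rw [← h3]
  congr 1 with x
  rw [smul_eq_mul, mul_comm]; rfl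

lemma hasDerivAt_intervalIntegral {F : Type*} [NormedAddCommGroup F] [NormedSpace ℝ F]
    [CompleteSpace F] {f : ℝ → F} (hf : Continuous f) (t : ℝ) :
    HasDerivAt (fun t => ∫ s in (0 : ℝ)..t, f s) (f t) t :=
  intervalIntegral.integral_hasDerivAt_right (hf.intervalIntegrable _ _)
    (hf.stronglyMeasurableAtFilter _ _) hf.continuousAt

/-- The real square integrable function `∂ⱼρ`. -/
noncomputable def gradL2 (s : 𝓢(E3, ℂ)) (j : Fin 3) : L2 :=
  (SchwartzMap.postcompCLM Complex.reCLM (partialDeriv s j)).toLp 2 volume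

section Source

variable {ρ : E3 → ℝ} {s : 𝓢(E3, ℂ)} (hs : ∀ x, s x = (ρ x : ℂ))

include hs in
lemma partialDeriv_apply (hρ : Differentiable ℝ ρ) (j : Fin 3) (x : E3) :
    partialDeriv s j x = ((gradient ρ x j : ℝ) : ℂ) := by
  have e : (s : E3 → ℂ) = fun x => (ρ x : ℂ) := funext hs
  have h1 : HasFDerivAt (fun x => (ρ x : ℂ)) (Complex.ofRealCLM.comp (fderiv ℝ ρ x)) x :=
    Complex.ofRealCLM.hasFDerivAt.comp x (hρ x).hasFDerivAt
  rw [partialDeriv, SchwartzMap.lineDerivOp_apply_eq_fderiv, e, h1.fderiv]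
  have h2 : gradient ρ x j = inner ℝ (gradient ρ x) (EuclideanSpace.single j (1 : ℝ)) := by
    rw [EuclideanSpace.inner_single_right]; simp
  rw [h2, gradient, InnerProductSpace.toDual_symm_apply]
  rfl

include hs in
lemma coeFn_gradL2 (hρ : Differentiable ℝ ρ) (j : Fin 3) :
    gradL2 s j =ᵐ[volume] fun x => gradient ρ x j := by
  filter_upwards [(SchwartzMap.postcompCLM Complex.reCLM (partialDeriv s j)).coeFn_toLp 2 volume]
    with x hx
  rw [gradL2, hx, SchwartzMap.postcompCLM_apply, partialDeriv_apply hs hρ]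
  simp

include hs in
lemma toComplex_gradL2 (hρ : Differentiable ℝ ρ) (j : Fin 3) :
    toComplex (gradL2 s j) = (partialDeriv s j).toLp 2 volume := by
  refine Lp.ext ?_
  filter_upwards [coeFn_toComplex (gradL2 s j), coeFn_gradL2 hs hρ j,
    (partialDeriv s j).coeFn_toLp 2 volume] with x h1 h2 h3
  rw [h1, h2, h3, partialDeriv_apply hs hρ]

include hs in
lemma fourierReal_gradL2 (hρ : Differentiable ℝ ρ) (j : Fin 3) :
    fourierReal (gradL2 s j) = (𝓕 (partialDeriv s j)).toLp 2 volume := by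
  rw [fourierReal_apply, toComplex_gradL2 hs hρ, SchwartzMap.toLp_fourier_eq]

include hs in
lemma inner_fourier_partialDeriv (hρ : Differentiable ℝ ρ) (i : Fin 3) (a : L2) :
    inner ℂ ((𝓕 (partialDeriv s i)).toLp 2 volume) (fourierReal a) =
      ((∫ x, a x * gradient ρ x i : ℝ) : ℂ) := by
  rw [fourierReal_apply, ← SchwartzMap.toLp_fourier_eq, Lp.inner_fourier_eq, L2.inner_def,
    ← integral_complex_ofReal]
  refine integral_congr_ae ?_
  filter_upwards [coeFn_toComplex a, (partialDeriv s i).coeFn_toLp 2 volume] with x h1 h2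
  rw [h1, h2, partialDeriv_apply hs hρ, RCLike.inner_apply, Complex.conj_ofReal]
  push_cast; rfl

include hs in
lemma integrable_smul_gradient (hρ : Differentiable ℝ ρ) (a : L2) :
    Integrable fun x => a x • gradient ρ x := by
  have h1 : ∀ j : Fin 3, MemLp (fun x => gradient ρ x j) 2 volume := fun j =>
    (memLp_congr_ae (coeFn_gradL2 hs hρ j)).mp (Lp.memLp _)
  have h2 : MemLp (fun x => gradient ρ x) 2 volume := by
    have h3 : (fun x => gradient ρ x) = fun x => ∑ j : Fin 3,
        gradient ρ x j • (EuclideanSpace.single j (1 : ℝ) : E3) := by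
      funext x
      ext i
      simp [Pi.single_apply]
    rw [h3]
    exact memLp_finsetSum _ fun j _ =>
      (ContinuousLinearMap.toSpanSingleton ℝ (EuclideanSpace.single j (1 : ℝ) : E3)).comp_memLp' (h1 j)
  exact memLp_one_iff_integrable.mp (h2.smul (Lp.memLp a))

include hs in
lemma realPair_inner_gradient (hρ : Differentiable ℝ ρ) {χ : E3 → ℝ} (hχ : IsTest χ) (v : E3) :
    ∫ x, inner ℝ v (gradient ρ x) * χ x =
      ∑ j, v j * realPair hχ.toSchwartz (gradL2 s j) := by
  simp_rw [realPair_apply, ← integral_const_mul]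
  rw [← integral_finsetSum]
  · refine integral_congr_ae ?_
    filter_upwards [eventually_all.mpr (coeFn_gradL2 hs hρ)] with x hx
    rw [PiLp.inner_apply, Finset.sum_mul]
    refine Finset.sum_congr rfl fun j _ => ?_
    rw [hx j, hχ.toSchwartz_apply]
    simp
    ring
  · intro j _
    exact ((Lp.memLp (gradL2 s j)).integrable_mul (hχ.toSchwartz.memLp 2 volume)).const_mul _

end Source

section Solution

variable {d : ℕ} {m : Fin d → ℝ} {ω : ℝ} {ρ : Fin d → E3 → ℝ} {Y : ℝ → PhaseSpace d}
  (h : IsSolution m ω ρ Y)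

include h

lemma IsSolution.continuous_fieldPos (n : Fin d) : Continuous fun t => fieldPos (Y t) n :=
  continuous_fst.comp (continuous_subtype_val.comp ((continuous_apply n).comp
    (continuous_fst.comp h.continuous)))

lemma IsSolution.continuous_fieldMom (n : Fin d) : Continuous fun t => fieldMom (Y t) n :=
  (continuous_apply n).comp (continuous_fst.comp (continuous_snd.comp h.continuous))

lemma IsSolution.continuous_particlePos : Continuous fun t => pos (Y t) :=
  continuous_fst.comp (continuous_snd.comp (continuous_snd.comp h.continuous))

lemma IsSolution.continuous_particleMom : Continuous fun t => mom (Y t) :=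
  continuous_snd.comp (continuous_snd.comp (continuous_snd.comp h.continuous))

/-- The distributional equation is integrated in time against each test function. Since π is
continuous into L², the weak derivative of φ becomes a strong one. -/
lemma IsSolution.fieldPos_eq (n : Fin d) (t : ℝ) :
    fieldPos (Y t) n = fieldPos (Y 0) n + ∫ s in (0 : ℝ)..t, fieldMom (Y s) n := by
  rw [← sub_eq_zero]
  refine eq_zero_of_realPair_eq_zero fun χ hχ => ?_
  set ℓ := realPair hχ.toSchwartz
  have hd : ∀ s, HasDerivAt (fun s => ℓ (fieldPos (Y s) n)) (ℓ (fieldMom (Y s) n)) s := fun s => by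
    have h1 := h.field_pos n χ hχ s
    simp only [ℓ, realPair_apply, hχ.toSchwartz_apply]
    exact h1
  have hc : Continuous fun s => ℓ (fieldMom (Y s) n) := ℓ.continuous.comp (h.continuous_fieldMom n)
  have h2 := intervalIntegral.integral_eq_sub_of_hasDerivAt (fun s _ => hd s)
    (hc.intervalIntegrable 0 t)
  rw [ℓ.intervalIntegral_comp_comm ((h.continuous_fieldMom n).intervalIntegrable 0 t)] at h2
  rw [map_sub, map_add, h2]
  ring

lemma IsSolution.fieldEvolution (hρ : ∀ n, Differentiable ℝ (ρ n)) {s : Fin d → 𝓢(E3, ℂ)}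
    (hs : ∀ n x, s n x = (ρ n x : ℂ)) (n : Fin d) :
    FieldEvolution (m n) (gradL2 (s n)) (fun j t => pos (Y t) j) (fun t => fieldPos (Y t) n)
      (fun t => fieldMom (Y t) n) := by
  have hq : ∀ j, Continuous fun t => pos (Y t) j := fun j =>
    (EuclideanSpace.proj j : E3 →L[ℝ] ℝ).continuous.comp h.continuous_particlePos
  refine ⟨fun t => ?_, h.continuous_fieldMom n, hq, fun t χ hχ => ?_⟩
  · rw [show (fun t => fieldPos (Y t) n) = _ from funext (h.fieldPos_eq n)]
    exact (hasDerivAt_intervalIntegral (h.continuous_fieldMom n) t).const_add _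
  · rw [← hχ.realPair_laplacian]
    set ℓ := realPair hχ.toSchwartz with hℓ
    set ℓ' := realPair (Δ hχ.toSchwartz) with hℓ'
    have e : ∀ a : L2, ∫ x, a x * χ x = ℓ a := fun a => by rw [hℓ, realPair_apply]; rfl
    rw [e]
    simp only [map_add, map_sub, map_smul, map_sum, smul_eq_mul]
    -- The defect in the time-integrated equation; it vanishes at 0 and has derivative 0.
    set F : ℝ → ℝ := fun t => ℓ (fieldMom (Y t) n) - ℓ (fieldMom (Y 0) n) +
      m n ^ 2 * ℓ (∫ s in (0 : ℝ)..t, fieldPos (Y s) n) +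
      ∑ j, (∫ s in (0 : ℝ)..t, pos (Y s) j) * ℓ (gradL2 (s n) j) -
      ℓ' (∫ s in (0 : ℝ)..t, fieldPos (Y s) n) with hF
    have hd : ∀ t, HasDerivAt F 0 t := fun t => by
      have h1 : HasDerivAt (fun t => ℓ (fieldMom (Y t) n)) (ℓ' (fieldPos (Y t) n) -
          m n ^ 2 * ℓ (fieldPos (Y t) n) - ∑ j, pos (Y t) j * ℓ (gradL2 (s n) j)) t := by
        have h2 := h.field_mom n χ hχ t
        rw [realPair_inner_gradient (hs n) (hρ n) hχ] at h2
        have h3 : ∫ x, fieldPos (Y t) n x * (Δ χ x - m n ^ 2 * χ x) =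
            ℓ' (fieldPos (Y t) n) - m n ^ 2 * ℓ (fieldPos (Y t) n) := by
          have h4 : ∀ u : 𝓢(E3, ℝ), Integrable fun x => fieldPos (Y t) n x * u x := fun u =>
            (Lp.memLp _).integrable_mul (u.memLp 2 volume)
          rw [hℓ, hℓ', realPair_apply, realPair_apply, ← integral_const_mul,
            ← integral_sub (h4 _) ((h4 _).const_mul _)]
          congr 1 with x
          rw [SchwartzMap.laplacian_apply, hχ.toSchwartz_apply]
          change _ = fieldPos (Y t) n x * Δ χ x - _
          ring
        rw [h3] at h2
        refine h2.congr_of_eventuallyEq (Eventually.of_forall fun s => ?_)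
        exact (e _).symm
      have h5 := hasDerivAt_intervalIntegral (h.continuous_fieldPos n) t
      have h6 : HasDerivAt (fun t => ∑ j, (∫ s in (0 : ℝ)..t, pos (Y s) j) * ℓ (gradL2 (s n) j))
          (∑ j, pos (Y t) j * ℓ (gradL2 (s n) j)) t :=
        HasDerivAt.fun_sum fun j _ => (hasDerivAt_intervalIntegral (hq j) t).mul_const _
      have h7 := (((h1.sub_const (ℓ (fieldMom (Y 0) n))).add
        ((ℓ.hasFDerivAt.comp_hasDerivAt t h5).const_mul (m n ^ 2))).add h6).sub
        (ℓ'.hasFDerivAt.comp_hasDerivAt t h5)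
      convert! h7 using 1
      ring
    have h8 := is_const_of_deriv_eq_zero (fun t => (hd t).differentiableAt) (fun t => (hd t).deriv)
      t 0
    have h9 : F 0 = 0 := by simp [hF]
    rw [h9] at h8
    exact sub_eq_zero.mp h8

end Solution

/-- The inclusion of the configuration space of the particle into its complexification. -/
noncomputable def complexVec : E3 →L[ℝ] V3 :=
  LinearMap.toContinuousLinearMap
    { toFun := fun v => WithLp.toLp 2 fun i => (v i : ℂ)
      map_add' := fun v w => by ext i; simp
      map_smul' := fun c v => by ext i; simp }

lemma complexVec_apply (v : E3) (i : Fin 3) : complexVec v i = (v i : ℂ) := rfl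

lemma norm_complexVec (v : E3) : ‖complexVec v‖ = ‖v‖ := by
  rw [EuclideanSpace.norm_eq, EuclideanSpace.norm_eq]
  simp [complexVec_apply]

/-- The force exerted on the particle by the free fields with the given initial data. -/
noncomputable def freeForce {d : ℕ} (m : Fin d → ℝ) (s : Fin d → 𝓢(E3, ℂ)) (a b : Fin d → L2)
    (t : ℝ) : V3 :=
  WithLp.toLp 2 fun i => -∑ n,
    (inner ℂ (cosWave (m n) (𝓕 (partialDeriv (s n) i)) t) (fourierReal (a n)) +
      inner ℂ (sinWave (m n) (𝓕 (partialDeriv (s n) i)) t) (fourierReal (b n)))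

lemma continuous_freeForce {d : ℕ} (m : Fin d → ℝ) (s : Fin d → 𝓢(E3, ℂ)) (a b : Fin d → L2) :
    Continuous (freeForce m s a b) := by
  have hc : ∀ n i, Continuous (cosWave (m n) (𝓕 (partialDeriv (s n) i))) := fun n i =>
    continuous_iff_continuousAt.mpr fun τ => (hasDerivAt_cosWave _ _ τ).continuousAt
  have hsn : ∀ n i, Continuous (sinWave (m n) (𝓕 (partialDeriv (s n) i))) := fun n i =>
    continuous_iff_continuousAt.mpr fun τ => (hasDerivAt_sinWave _ _ τ).continuousAt
  unfold freeForce
  refine (PiLp.continuous_toLp 2 _).comp (continuous_pi fun i => (continuous_finsetSum _ fun n _ =>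
    ((hc n i).inner continuous_const).add ((hsn n i).inner continuous_const)).neg)

lemma norm_le_sum_apply (v : V3) : ‖v‖ ≤ ∑ i, ‖v i‖ := by
  have e : v = ∑ i, v i • (EuclideanSpace.single i (1 : ℂ) : V3) := by
    ext j; simp [Pi.single_apply]
  calc ‖v‖ = ‖∑ i, v i • (EuclideanSpace.single i (1 : ℂ) : V3)‖ := congrArg _ e
    _ ≤ ∑ i, ‖v i • (EuclideanSpace.single i (1 : ℂ) : V3)‖ := norm_sum_le _ _
    _ = _ := by simp [norm_smul]

lemma exists_norm_freeForce_le {d : ℕ} {m : Fin d → ℝ} (hm : ∀ n, 0 ≤ m n)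
    (s : Fin d → 𝓢(E3, ℂ)) {R : ℝ} (hR : 0 ≤ R) :
    ∃ C, 0 ≤ C ∧ ∀ a b : Fin d → L2, (∀ n, ∀ᵐ x : E3, R < ‖x‖ → a n x = 0) →
      (∀ n, ∀ᵐ x : E3, R < ‖x‖ → b n x = 0) → ∀ N, (∀ n, ‖a n‖ ≤ N) → (∀ n, ‖b n‖ ≤ N) →
        ∀ t, ‖freeForce m s a b t‖ ≤ C * N * wt t := by
  choose C hC h using fun n i => exists_norm_inner_wave_le (hm n)
    (integrable_fourier_partialDeriv_div (m n) (s n) i) hR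
  refine ⟨∑ i, ∑ n, 2 * C n i, Finset.sum_nonneg fun i _ => Finset.sum_nonneg fun n _ =>
    mul_nonneg zero_le_two (hC n i), fun a b ha hb N haN hbN t => ?_⟩
  refine (norm_le_sum_apply _).trans ?_
  simp only [Finset.sum_mul]
  refine Finset.sum_le_sum fun i _ => ?_
  simp only [freeForce]
  rw [norm_neg]
  refine (norm_sum_le _ _).trans (Finset.sum_le_sum fun n _ => ?_)
  refine (h n i (a n) (b n) (ha n) (hb n) t).trans ?_
  refine mul_le_mul_of_nonneg_right ?_ (wt_nonneg t)
  calc C n i * (‖a n‖ + ‖b n‖) ≤ C n i * (N + N) := by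
        have := hC n i
        have := haN n
        have := hbN n
        gcongr
    _ = _ := by ring

/-- Along a solution the particle obeys a Volterra equation. -/
lemma IsSolution.solvesVolterra {d : ℕ} {m : Fin d → ℝ} {ω : ℝ} {ρ : Fin d → E3 → ℝ}
    {Y : ℝ → PhaseSpace d} (h : IsSolution m ω ρ Y) (hρ : ∀ n, Differentiable ℝ (ρ n))
    {s : Fin d → 𝓢(E3, ℂ)} (hs : ∀ n x, s n x = (ρ n x : ℂ)) :
    SolvesVolterra ω (memoryKernel m fun n => formFactorSchwartz (s n))
      (freeForce m s (fieldPos (Y 0)) (fieldMom (Y 0)))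
      (fun t => complexVec (pos (Y t))) (fun t => complexVec (mom (Y t))) := by
  refine ⟨fun t => complexVec.hasFDerivAt.comp_hasDerivAt t (h.particle_pos t), fun t _ => ?_⟩
  convert! complexVec.hasFDerivAt.comp_hasDerivAt t (h.particle_mom t) using 1
  set W := fun n => formFactorSchwartz (s n) with hW
  have hqc : Continuous fun t => complexVec (pos (Y t)) :=
    complexVec.continuous.comp h.continuous_particlePos
  have hDc := continuous_memoryKernel m W
  have hret := fun n i j => continuous_retarded (m n) (W n) i j
  have hpj : ∀ j, Continuous fun t => ((pos (Y t) j : ℝ) : ℂ) := fun j =>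
    (EuclideanSpace.proj j : V3 →L[ℂ] ℂ).continuous.comp hqc
  ext i
  have h1 : (∫ r in (0 : ℝ)..t, memoryKernel m W (t - r) (complexVec (pos (Y r))) : V3) i =
      ∑ n, ∫ r in (0 : ℝ)..t, ∑ j, ((pos (Y r) j : ℝ) : ℂ) *
        (4 * (Real.pi : ℂ) ^ 2 * retarded (m n) (W n) i j (t - r)) := by
    have hc : Continuous fun r => memoryKernel m W (t - r) (complexVec (pos (Y r))) :=
      (hDc.comp (continuous_const.sub continuous_id)).clm_apply hqc
    have h2 := (EuclideanSpace.proj i : V3 →L[ℂ] ℂ).intervalIntegral_comp_comm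
      (μ := volume) (hc.intervalIntegrable 0 t)
    rw [← intervalIntegral.integral_finsetSum]
    · refine Eq.trans h2.symm (intervalIntegral.integral_congr fun r _ => ?_)
      change (memoryKernel m W (t - r) (complexVec (pos (Y r)))) i = _
      rw [memoryKernel_apply]
      refine Finset.sum_congr rfl fun n _ => Finset.sum_congr rfl fun j _ => ?_
      rw [complexVec_apply]; ring
    · intro n _
      refine Continuous.intervalIntegrable (continuous_finsetSum _ fun j _ => ?_) _ _
      exact (hpj j).mul (continuous_const.mul
        ((hret n i j).comp (continuous_const.sub continuous_id)))
  have h3 : ∀ n, (((∫ x, fieldPos (Y t) n x • gradient (ρ n) x : E3) i : ℝ) : ℂ) =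
      inner ℂ (cosWave (m n) (𝓕 (partialDeriv (s n) i)) t) (fourierReal (fieldPos (Y 0) n)) +
      inner ℂ (sinWave (m n) (𝓕 (partialDeriv (s n) i)) t) (fourierReal (fieldMom (Y 0) n)) -
      ∫ r in (0 : ℝ)..t, ∑ j, ((pos (Y r) j : ℝ) : ℂ) *
        (4 * (Real.pi : ℂ) ^ 2 * retarded (m n) (W n) i j (t - r)) := fun n => by
    -- Duhamel with the profile 𝓕(∂ᵢρₙ): the left side is the force of the n-th field on the
    -- particle, up to sign, and the source term is the memory kernel convolved with q.
    have h4 := (h.fieldEvolution hρ hs n).inner_eq_duhamel (𝓕 (partialDeriv (s n) i)) t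
    simp_rw [fourierReal_gradL2 (hs n) (hρ n), inner_sinWave_partialDeriv] at h4
    rw [inner_fourier_partialDeriv (hs n) (hρ n)] at h4
    rw [← h4]
    congr 1
    have h5 := (EuclideanSpace.proj i : E3 →L[ℝ] ℝ).integral_comp_comm
      (integrable_smul_gradient (hs n) (hρ n) (fieldPos (Y t) n))
    exact h5.symm
  have h6 : (complexVec (-(ω ^ 2 • pos (Y t)) -
      ∑ n, ∫ x, fieldPos (Y t) n x • gradient (ρ n) x)) i =
      -((ω : ℂ) ^ 2 * pos (Y t) i) -
        ∑ n, (((∫ x, fieldPos (Y t) n x • gradient (ρ n) x : E3) i : ℝ) : ℂ) := by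
    rw [complexVec_apply]
    simp
  rw [h6]
  simp_rw [h3]
  rw [Finset.sum_sub_distrib, ← h1]
  simp only [PiLp.add_apply, PiLp.neg_apply, PiLp.smul_apply, complexVec_apply, smul_eq_mul,
    freeForce]
  ring

/-! ### Comparison with the norm of the state, and conclusion. -/

lemma norm_fieldPos_le_stateNorm {d : ℕ} (Y : PhaseSpace d) (n : Fin d) :
    ‖fieldPos Y n‖ ≤ stateNorm Y := by
  refine Real.le_sqrt_of_sq_le ?_
  have h1 := Finset.single_le_sum (f := fun n => ‖fieldPos Y n‖ ^ 2 + ‖fieldGrad Y n‖ ^ 2 +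
    ‖fieldMom Y n‖ ^ 2) (fun n _ => by positivity) (Finset.mem_univ n)
  nlinarith [sq_nonneg ‖fieldGrad Y n‖, sq_nonneg ‖fieldMom Y n‖, sq_nonneg ‖pos Y‖,
    sq_nonneg ‖mom Y‖]

lemma norm_fieldMom_le_stateNorm {d : ℕ} (Y : PhaseSpace d) (n : Fin d) :
    ‖fieldMom Y n‖ ≤ stateNorm Y := by
  refine Real.le_sqrt_of_sq_le ?_
  have h1 := Finset.single_le_sum (f := fun n => ‖fieldPos Y n‖ ^ 2 + ‖fieldGrad Y n‖ ^ 2 +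
    ‖fieldMom Y n‖ ^ 2) (fun n _ => by positivity) (Finset.mem_univ n)
  nlinarith [sq_nonneg ‖fieldGrad Y n‖, sq_nonneg ‖fieldPos Y n‖, sq_nonneg ‖pos Y‖,
    sq_nonneg ‖mom Y‖]

lemma norm_pos_le_stateNorm {d : ℕ} (Y : PhaseSpace d) : ‖pos Y‖ ≤ stateNorm Y := by
  refine Real.le_sqrt_of_sq_le ?_
  have h1 : 0 ≤ ∑ n, (‖fieldPos Y n‖ ^ 2 + ‖fieldGrad Y n‖ ^ 2 + ‖fieldMom Y n‖ ^ 2) :=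
    Finset.sum_nonneg fun n _ => by positivity
  nlinarith [sq_nonneg ‖mom Y‖]

lemma norm_mom_le_stateNorm {d : ℕ} (Y : PhaseSpace d) : ‖mom Y‖ ≤ stateNorm Y := by
  refine Real.le_sqrt_of_sq_le ?_
  have h1 : 0 ≤ ∑ n, (‖fieldPos Y n‖ ^ 2 + ‖fieldGrad Y n‖ ^ 2 + ‖fieldMom Y n‖ ^ 2) :=
    Finset.sum_nonneg fun n _ => by positivity
  nlinarith [sq_nonneg ‖pos Y‖]

lemma exists_schwartz_eq {f : E3 → ℝ} (hf : ContDiff ℝ (⊤ : ℕ∞) f) {R : ℝ}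
    (hR : ∀ x : E3, R ≤ ‖x‖ → f x = 0) : ∃ s : 𝓢(E3, ℂ), ∀ x, s x = (f x : ℂ) := by
  have h1 : HasCompactSupport fun x => (f x : ℂ) := by
    refine HasCompactSupport.intro (isCompact_closedBall (0 : E3) R) fun x hx => ?_
    rw [hR x (by simpa using (not_le.mp (by simpa using hx) : R < ‖x‖).le), Complex.ofReal_zero]
  exact ⟨h1.toSchwartzMap (Complex.ofRealCLM.contDiff.comp hf), fun x => rfl⟩

end KGParticle

theorem theorem7p1 (d : ℕ) (m : Fin d → ℝ) (hm_nonneg : ∀ n, 0 ≤ m n) (hm : m ≠ 0)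
    (ω : ℝ) (hω : 0 < ω) (ρ : Fin d → KGParticle.E3 → ℝ)
    (hA1 : KGParticle.ConditionA1 m ω ρ) (hA2 : KGParticle.ConditionA2 ρ)
    (hA3 : KGParticle.ConditionA3 ρ) (R₁ : ℝ) (hR₁ : 0 < R₁) :
    ∃ C : ℝ, 0 < C ∧ ∀ (Y₀ : KGParticle.PhaseSpace d) (Y : ℝ → KGParticle.PhaseSpace d),
      KGParticle.FieldsVanishOutside Y₀ R₁ → KGParticle.IsSolution m ω ρ Y → Y 0 = Y₀ →
        Continuous (fun t => KGParticle.pos (Y t)) ∧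
        Continuous (fun t => KGParticle.mom (Y t)) ∧
        ∀ t : ℝ, 0 ≤ t →
          ‖KGParticle.pos (Y t)‖ + ‖KGParticle.mom (Y t)‖
            ≤ C * (1 + t) ^ (-(3 / 2 : ℝ)) * KGParticle.stateNorm Y₀ := by
  open KGParticle in
  obtain ⟨hsm, -, R, hR⟩ := hA2
  choose s hs using fun n => exists_schwartz_eq (hsm n) (hR n)
  have hρ : ∀ n, Differentiable ℝ (ρ n) := fun n => (hsm n).differentiable (by simp)
  -- A nonzero mass vector requires at least one index, so the minimum mass is attained and equals
  -- `mStar m`.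
  have : Nonempty (Fin d) := by
    by_contra h
    rw [not_nonempty_iff] at h
    exact hm (Subsingleton.elim _ _)
  obtain ⟨n₀, hn₀⟩ := Finite.exists_min m
  have hstar : mStar m = m n₀ := le_antisymm (ciInf_le (Set.finite_range m).bddBelow n₀)
    (le_ciInf hn₀)
  have hcm : ∀ n, mStar m ^ 2 ≤ m n ^ 2 := fun n => by
    rw [hstar]; exact pow_le_pow_left₀ (hm_nonneg n₀) (hn₀ n) 2
  obtain ⟨A, hA⟩ := exists_admissibleKernel hm_nonneg (W := fun n => formFactorSchwartz (s n))
    (f := fun n => formFactor (s n)) (fun n k => sq_nonneg _)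
    (fun n k => formFactorSchwartz_apply (s n) k)
    (fun n k hk => by
      -- A3 is used at the rescaled wave vector -2πk.
      have h1 : (-(2 * Real.pi)) • k ≠ 0 := smul_ne_zero (by simp [Real.pi_ne_zero]) hk
      have h2 := hA3 n _ h1
      rw [rhoHat_neg_two_pi_smul (hs n)] at h2
      exact pow_pos (norm_pos_iff.mpr h2) 2) hn₀ (ω := ω)
    (fun v hv => by
      rw [← hstar]
      exact sum_integral_weight_lt hs hA1 hcm hv)
  obtain ⟨C₁, hC₁, hdecay⟩ := hA.exists_decay
  obtain ⟨C₂, hC₂, hforce⟩ := exists_norm_freeForce_le hm_nonneg s hR₁.le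
  -- C₂ accounts for the free force, the 2 for the initial position and momentum.
  refine ⟨C₁ * (C₂ + 2), by positivity, fun Y₀ Y hY₀ hY h0 => ⟨hY.continuous_particlePos,
    hY.continuous_particleMom, fun t ht => ?_⟩⟩
  subst h0
  have h1 := hdecay _ _ _ (C₂ * stateNorm (Y 0)) (hY.solvesVolterra hρ hs)
    (continuous_freeForce m s _ _) (fun t _ => hforce _ _ (fun n => (hY₀ n).1)
      (fun n => (hY₀ n).2) _ (norm_fieldPos_le_stateNorm (Y 0))
      (norm_fieldMom_le_stateNorm (Y 0)) t) t ht
  simp only [norm_complexVec] at h1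
  have h2 : wt t = (1 + t) ^ (-(3 / 2 : ℝ)) := by rw [wt, abs_of_nonneg ht]
  rw [h2] at h1
  have h3 : C₂ * stateNorm (Y 0) + ‖pos (Y 0)‖ + ‖mom (Y 0)‖ ≤ (C₂ + 2) * stateNorm (Y 0) := by
    linarith [norm_pos_le_stateNorm (Y 0), norm_mom_le_stateNorm (Y 0)]
  have h4 : 0 ≤ (1 + t) ^ (-(3 / 2 : ℝ)) := by positivity
  calc _ ≤ C₁ * (C₂ * stateNorm (Y 0) + ‖pos (Y 0)‖ + ‖mom (Y 0)‖) * (1 + t) ^ (-(3 / 2 : ℝ)) := h1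
    _ ≤ C₁ * ((C₂ + 2) * stateNorm (Y 0)) * (1 + t) ^ (-(3 / 2 : ℝ)) := by gcongr
    _ = _ := by ring
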